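/- **Setting.** Fix integers $d\ge 1$, $K\ge 1$ and $\mathcal G\in\{\mathcal O(d),\mathcal{SO}(d)\}$. Let $n=Km$, let the ground truth be a clustering $C^*:[n]\to[K]$ with all $K$ clusters of size $m$ together with group elements $R^*_1,\dots,R^*_n\in\mathcal G$, and let $V^*\in\mathbb R^{nd\times Kd}$ be the matrix whose $(i,k)$ block of size $d\times d$ is $R_i^*$ if $C^*(i)=k$ and $0$ otherwise. The observation $A\in\mathbb R^{nd\times nd}$, generated by $\mathrm{SGBM}(n,p,q,K,d,\mathcal G)$ with $p=\alpha\frac{\log n}{n}$, $q=\beta\frac{\log n}{n}$, is symmetric with identity diagonal blocks; independently over $i<j$, if $C^*(i)=C^*(j)$ then $A_{ij}=R_i^*R_j^{*\top}$ with probability $p$ and $A_{ij}=0$ otherwise, and if $C^*(i)\ne C^*(j)$ then with probability $q$ the block $A_{ij}$ is a Haar-uniform element of $\mathcal G$, and $A_{ij}=0$ otherwise. Let $\mathcal H$ be the set of matrices $H\in\{0,1\}^{n\times K}$ with unit row sums and column sums $m$, let $\mathcal F$ be the set of block matrices $V\in\mathbb R^{nd\times Kd}$ with blocks $V_{ik}=H_{ik}R_i$,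 $H\in\mathcal H$, $R_i\in\mathcal O(d)$, and put $$\epsilon_{\mathcal O(d)}(V)=\min_Q\|V-V^*Q\|_F ,$$ the minimum being over all $Q=\mathrm{bdiag}(U_1,\dots,U_K)(P\otimes I_d)$ with $U_k\in\mathcal O(d)$ and $P$ a $K\times K$ permutation matrix. **Randomized spectral clustering** (with a constant $\mu>0$). Input $A$. (1) Let $W\in\mathbb R^{n\times K}$ consist of orthonormal eigenvectors for the $K$ largest eigenvalues of the adjacency matrix of the graph on $[n]$ whose edges (loops included) are the pairs $\{i,j\}$ with $A_{ij}\neq 0$. Cluster its rows greedily: with $S=[n]$ initially, for $k=1,\dots,K$ choose $t_k\in S$ maximizing $|\{v\in S:\|W_v-W_u\|<\mu\sqrt{K/n}\}|$ over $u\in S$, let $\widehat C_k=\{v\in S:\|W_v-W_{t_k}\|<\mu\sqrt{K/n}\}$ and remove $\widehat C_k$ from $S$; finally put each node still in $S$ into the cluster $k$ minimizing its average distance to the rows in $\widehat C_k$. (2) Replace the resulting clustering matrix by a Frobenius-nearest $H^0\in\mathcal H$, with clusters $\mathcal I^0_1,\dots,\mathcal I^0_K$. (3) Let $\widehat U\in\mathbb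 R^{nd\times Kd}$ consist of orthonormal eigenvectors for the $Kd$ largest eigenvalues of $A$. (4) Choose pivots $\tau_k\in\mathcal I^0_k$ independently and uniformly at random, and for $v\in\mathcal I^0_k$ let $R^0_v\in\mathcal O(d)$ minimize $\|\widehat U_{v\times}-R\,\widehat U_{\tau_k\times}\|_F$ over $R\in\mathcal O(d)$, where $\widehat U_{v\times}$ denotes the $v$-th $d\times Kd$ block row. (5) Return $V^0$ with blocks $V^0_{ik}=H^0_{ik}R^0_i$. **Theorem.** (a) Let $0<\mu\le\frac12$, $\rho>0$, $0<a\le b$ and $\delta>0$ be constants. There are $c>0$ and $N$, depending only on these constants and on $d,K,\mathcal G$, such that for all $n=Km\ge N$, all $\alpha,\beta\in[a,b]$ with $\alpha\ge\beta+\delta$, every ground truth and every way of resolving ties in the algorithm, the randomized spectral clustering returns $V^0\in\mathcal F$ with $\epsilon_{\mathcal O(d)}(V^0)\le\sqrt m/\rho$ with probability at least $1-(\log n)^{-c}$. (b) There is a randomized initializer, that is, a randomized map $A\mapsto V^0$, not depending on $\alpha,\beta$ or on the ground truth, with the following property. Let $\chi>0$, $0<a\le b$ and $\delta>0$ be constants.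 There are $c>0$ and $N$, depending only on these constants and on $d,K,\mathcal G$, such that for all $n=Km\ge N$, all $\alpha,\beta\in[a,b]$ (with $|\alpha-\beta|\ge\delta$ in case $\mathcal G=\mathcal{SO}(1)$) and every ground truth, with probability at least $1-(\log n)^{-c}$ condition (iii) holds: $V^0\in\mathcal F$ and there is $$\rho>2\sqrt2\sqrt{\frac{d^2}{\chi^2}+\frac{\alpha^2}{2K\beta}}\qquad\text{with}\qquad \epsilon_{\mathcal O(d)}(V^0)\le\frac{\sqrt m}{\rho}.$$ -/

import Mathlib

namespace SGBM

noncomputable section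

open MeasureTheory ProbabilityTheory
open scoped Kronecker ENNReal

/-! ### Matrices partitioned into `d × d` blocks -/

/-- An `nd × nd` observation matrix; the index `(i, a)` is row `a` of the `i`-th block row. -/
abbrev Obs (n d : ℕ) : Type := Matrix (Fin n × Fin d) (Fin n × Fin d) ℝ

/-- An `nd × Kd` matrix. -/
abbrev VMat (n K d : ℕ) : Type := Matrix (Fin n × Fin d) (Fin K × Fin d) ℝ

/-- The Frobenius norm. -/
def frob {ι κ : Type*} [Fintype ι] [Fintype κ] (M : Matrix ι κ ℝ) : ℝ :=
  Real.sqrt (∑ i, ∑ j, M i j ^ 2)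

/-- The `(i, j)`-th `d × d` block. -/
def blk {n d : ℕ} (A : Obs n d) (i j : Fin n) : Matrix (Fin d) (Fin d) ℝ :=
  Matrix.of fun a b => A (i, a) (j, b)

/-- The `v`-th block row. -/
def blockRow {n d : ℕ} {κ : Type*} (U : Matrix (Fin n × Fin d) κ ℝ) (v : Fin n) :
    Matrix (Fin d) κ ℝ :=
  Matrix.of fun a j => U (v, a) j

/-- `U = eigs_k(M)`: for a spectral decomposition `M = Q Λ Qᵀ` of the symmetric matrix `M`, the
columns of `U` are the columns of `Q` that belong to the `card κ` (algebraically) largest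
eigenvalues, counted with multiplicity. -/
def IsLeadingEigs {ι κ : Type*} [Fintype ι] [DecidableEq ι]
    (M : Matrix ι ι ℝ) (U : Matrix ι κ ℝ) : Prop :=
  ∃ (Q : Matrix ι ι ℝ) (lam : ι → ℝ) (f : κ ↪ ι),
    Q ∈ Matrix.orthogonalGroup ι ℝ ∧
    M = Q * Matrix.diagonal lam * Q.transpose ∧
    U = Q.submatrix id f ∧
    ∀ j, ∀ i, i ∉ Set.range f → lam i ≤ lam (f j)

/-! ### Clusterings, the feasible region and the estimation error -/

/-- The set `ℋ` of balanced clustering matrices: `0/1` entries, unit row sums, column sums `m`. -/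
def clusteringMatrices (n m K : ℕ) : Set (Matrix (Fin n) (Fin K) ℝ) :=
  {H | (∀ i k, H i k = 0 ∨ H i k = 1) ∧ (∀ i, ∑ k, H i k = 1) ∧ ∀ k, ∑ i, H i k = m}

/-- The matrix of a (possibly imbalanced) clustering function. -/
def clusterMatrix {n K : ℕ} (C : Fin n → Fin K) : Matrix (Fin n) (Fin K) ℝ :=
  Matrix.of fun i k => if C i = k then 1 else 0

/-- `(1_{1×K} ⊗ R) ⊙ (H ⊗ 1_{d×d})`. -/
def entangle {n K d : ℕ} (R : Fin n → Matrix (Fin d) (Fin d) ℝ)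
    (H : Matrix (Fin n) (Fin K) ℝ) : VMat n K d :=
  Matrix.of fun ia kb => R ia.1 ia.2 kb.2 * H ia.1 kb.1

/-- The feasible region `ℱ`. -/
def feasible (n m K d : ℕ) : Set (VMat n K d) :=
  {V | ∃ (R : Fin n → Matrix (Fin d) (Fin d) ℝ) (H : Matrix (Fin n) (Fin K) ℝ),
    (∀ i, R i ∈ Matrix.orthogonalGroup (Fin d) ℝ) ∧ H ∈ clusteringMatrices n m K ∧
      V = entangle R H}

/-- The block-diagonal matrix with diagonal blocks `R 1, …, R K`. -/
def bdiag {K d : ℕ} (R : Fin K → Matrix (Fin d) (Fin d) ℝ) :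
    Matrix (Fin K × Fin d) (Fin K × Fin d) ℝ :=
  Matrix.of fun ka lb => if ka.1 = lb.1 then R ka.1 ka.2 lb.2 else 0

/-- The group `𝒫_K(𝒪(d))` of the matrices `bdiag(R) (P ⊗ I_d)`. -/
def blockPerms (K d : ℕ) : Set (Matrix (Fin K × Fin d) (Fin K × Fin d) ℝ) :=
  {Q | ∃ (R : Fin K → Matrix (Fin d) (Fin d) ℝ) (π : Equiv.Perm (Fin K)),
    (∀ k, R k ∈ Matrix.orthogonalGroup (Fin d) ℝ) ∧
      Q = bdiag R * (π.permMatrix ℝ ⊗ₖ (1 : Matrix (Fin d) (Fin d) ℝ))}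

/-- The estimation error `ε_{𝒪(d)}(V) = min_{Q ∈ 𝒫_K(𝒪(d))} ‖V - V* Q‖_F`. -/
def estErr {n K d : ℕ} (Vstar V : VMat n K d) : ℝ :=
  ⨅ Q : blockPerms K d, frob (V - Vstar * (Q : Matrix (Fin K × Fin d) (Fin K × Fin d) ℝ))

/-! ### The groups `𝒪(d)`, `𝒮𝒪(d)` and their uniform distributions -/

/-- The two admissible choices of the group. -/
inductive GroupKind : Type
  | orthogonal
  | rotation

/-- `𝒪(d)` or `𝒮𝒪(d)`, as a subgroup of `𝒪(d)`. -/
def grp (d : ℕ) : GroupKind → Subgroup (Matrix.orthogonalGroup (Fin d) ℝ)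
  | .orthogonal => ⊤
  | .rotation =>
    (Matrix.detMonoidHom.comp (Matrix.orthogonalGroup (Fin d) ℝ).subtype :
      Matrix.orthogonalGroup (Fin d) ℝ →* ℝ).ker

theorem isCompact_orthogonalGroup (d : ℕ) :
    IsCompact (Matrix.orthogonalGroup (Fin d) ℝ : Set (Matrix (Fin d) (Fin d) ℝ)) := by
  have hbox : IsCompact (Set.pi Set.univ fun _ : Fin d =>
      Set.pi Set.univ fun _ : Fin d => Set.Icc (-1 : ℝ) 1) :=
    isCompact_univ_pi fun _ => isCompact_univ_pi fun _ => isCompact_Icc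
  have hcl : IsClosed {M : Matrix (Fin d) (Fin d) ℝ | M * M.transpose = 1} :=
    isClosed_eq (by fun_prop) continuous_const
  refine IsCompact.of_isClosed_subset (s := Set.pi Set.univ fun _ : Fin d =>
      Set.pi Set.univ fun _ : Fin d => Set.Icc (-1 : ℝ) 1) hbox ?_ ?_
  · have hset : (Matrix.orthogonalGroup (Fin d) ℝ : Set (Matrix (Fin d) (Fin d) ℝ)) =
        {M : Matrix (Fin d) (Fin d) ℝ | M * M.transpose = 1} :=
      Set.ext fun M => Matrix.mem_orthogonalGroup_iff (Fin d) ℝ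
    rw [hset]
    exact hcl
  · intro (M : Matrix (Fin d) (Fin d) ℝ) hM
    have h1 : M * Matrix.transpose M = 1 := Matrix.mem_orthogonalGroup_iff (Fin d) ℝ |>.1 hM
    intro i _ j _
    have h2 : ∑ k, M i k * M i k = 1 := by
      have := congrFun (congrFun h1 i) i
      rw [Matrix.mul_apply, Matrix.one_apply_eq] at this
      exact this
    have h3 : M i j * M i j ≤ 1 := by
      rw [← h2]
      exact Finset.single_le_sum (f := fun k => M i k * M i k)
        (fun k _ => mul_self_nonneg _) (Finset.mem_univ j)
    exact ⟨by nlinarith, by nlinarith⟩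

instance (d : ℕ) : CompactSpace (Matrix.orthogonalGroup (Fin d) ℝ) :=
  isCompact_iff_compactSpace.1 (isCompact_orthogonalGroup d)

instance (d : ℕ) (𝒢 : GroupKind) : CompactSpace (grp d 𝒢) := by
  refine isCompact_iff_compactSpace.1 (IsClosed.isCompact ?_)
  cases 𝒢 with
  | orthogonal => exact isClosed_univ
  | rotation =>
    have : IsClosed {g : Matrix.orthogonalGroup (Fin d) ℝ |
        (g : Matrix (Fin d) (Fin d) ℝ).det = 1} :=
      isClosed_eq (by fun_prop) continuous_const
    exact this

instance (d : ℕ) (𝒢 : GroupKind) : MeasurableSpace (grp d 𝒢) := borel _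

instance (d : ℕ) (𝒢 : GroupKind) : BorelSpace (grp d 𝒢) := ⟨rfl⟩

/-- `Unif(𝒢)`: the Haar measure of total mass one. -/
def unif (d : ℕ) (𝒢 : GroupKind) : Measure (grp d 𝒢) :=
  Measure.haarMeasure ⊤

/-! ### The stochastic group block model -/

/-- `C` has `K` clusters, each of size `m`. -/
def IsBalanced {n K : ℕ} (m : ℕ) (C : Fin n → Fin K) : Prop :=
  ∀ k, (Finset.univ.filter fun i => C i = k).card = m

/-- The matrix underlying a group element. -/
def toMat {d : ℕ} {𝒢 : GroupKind} (g : grp d 𝒢) : Matrix (Fin d) (Fin d) ℝ :=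
  ((g : Matrix.orthogonalGroup (Fin d) ℝ) : Matrix (Fin d) (Fin d) ℝ)

/-- The ground truth matrix `V*`. -/
def groundTruth {n K d : ℕ} {𝒢 : GroupKind} (C : Fin n → Fin K) (R : Fin n → grp d 𝒢) :
    VMat n K d :=
  entangle (fun i => toMat (R i)) (clusterMatrix C)

/-- The randomness of the model: for a pair `(i, j)`, the edge indicator and the outlier. Only the
entries with `i < j` are used below. -/
abbrev Sample (n d : ℕ) (𝒢 : GroupKind) : Type := Fin n × Fin n → Bool × grp d 𝒢

/-- All indicators and outliers are independent; an indicator is `Bern(p)` inside a cluster and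
`Bern(q)` across clusters, an outlier is `Unif(𝒢)`. A parameter outside of `[0, 1]` is replaced by
the nearest point of `[0, 1]`. -/
def sampleMeasure {n K : ℕ} (d : ℕ) (𝒢 : GroupKind) (p q : ℝ) (C : Fin n → Fin K) :
    Measure (Sample n d 𝒢) :=
  Measure.pi fun e : Fin n × Fin n =>
    (bernoulliMeasure true false
      (Set.projIcc (0 : ℝ) 1 zero_le_one (if C e.1 = C e.2 then p else q))).prod (unif d 𝒢)

/-- The block `A_{ij}` for `i < j`. -/
def upperBlock {n K d : ℕ} {𝒢 : GroupKind} (C : Fin n → Fin K) (R : Fin n → grp d 𝒢)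
    (ω : Sample n d 𝒢) (i j : Fin n) : Matrix (Fin d) (Fin d) ℝ :=
  if (ω (i, j)).1 = true then
    if C i = C j then toMat (R i) * (toMat (R j)).transpose else toMat (ω (i, j)).2
  else 0

/-- The observation matrix `A`. -/
def observation {n K d : ℕ} {𝒢 : GroupKind} (C : Fin n → Fin K) (R : Fin n → grp d 𝒢)
    (ω : Sample n d 𝒢) : Obs n d :=
  Matrix.of fun ia jb =>
    if ia.1 < jb.1 then upperBlock C R ω ia.1 jb.1 ia.2 jb.2
    else if jb.1 < ia.1 then upperBlock C R ω jb.1 ia.1 jb.2 ia.2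
    else (1 : Matrix (Fin d) (Fin d) ℝ) ia.2 jb.2

/-- A randomized initializer: from the observation matrix alone it draws an initial point. -/
abbrev Initializer (n K d : ℕ) : Type := Obs n d → PMF (VMat n K d)

/-- The probability, over `A ∼ SGBM(n, α log n / n, β log n / n, K, d, 𝒢)` with ground truth
`(C, R)` and over the internal randomness of the initializer, that the output lies in `S`. -/
def successProb {n K d : ℕ} {𝒢 : GroupKind} (α β : ℝ) (C : Fin n → Fin K)
    (R : Fin n → grp d 𝒢) (alg : Initializer n K d) (S : Set (VMat n K d)) : ℝ≥0∞ :=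
  ∫⁻ ω, (alg (observation C R ω)).toOuterMeasure S
    ∂(sampleMeasure d 𝒢 (α * Real.log n / n) (β * Real.log n / n) C)

/-- Condition (iii) for the separation constant `χ`. -/
def ConditionIII {n K d : ℕ} (m : ℕ) (α β χ : ℝ) (Vstar V : VMat n K d) : Prop :=
  V ∈ feasible n m K d ∧
  ∃ ρ : ℝ, 2 * Real.sqrt 2 * Real.sqrt ((d : ℝ) ^ 2 / χ ^ 2 + α ^ 2 / (2 * K * β)) < ρ ∧
    estErr Vstar V ≤ Real.sqrt m / ρ

/-! ### The randomized spectral clustering algorithm -/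

open Classical in
/-- The adjacency matrix (with self-loops) of the measurement graph that `A` reveals. -/
def adjacency {n d : ℕ} (A : Obs n d) : Matrix (Fin n) (Fin n) ℝ :=
  Matrix.of fun i j => if blk A i j = 0 then 0 else 1

/-- Euclidean distance of two rows. -/
def rowDist {n : ℕ} {κ : Type*} [Fintype κ] (W : Matrix (Fin n) κ ℝ) (u v : Fin n) : ℝ :=
  Real.sqrt (∑ k, (W u k - W v k) ^ 2)

open Classical in
/-- The nodes of `S` whose row lies at distance less than `r` from that of `u`. -/
def rowBall {n : ℕ} {κ : Type*} [Fintype κ] (W : Matrix (Fin n) κ ℝ) (r : ℝ)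
    (S : Finset (Fin n)) (u : Fin n) : Finset (Fin n) :=
  S.filter fun v => rowDist W u v < r

open Classical in
/-- `σ` is an output of the greedy clustering of the rows of `W` with critical radius `r`. For
`i = 1, …, K` a center `t i` with the largest number of remaining nodes within distance `r` is
picked among the remaining nodes, and these nodes form the cluster `Ĉ i` and are removed. A node
that remains at the end joins the cluster to which its average distance is smallest. -/
def IsGreedyClustering {n K : ℕ} {κ : Type*} [Fintype κ] (W : Matrix (Fin n) κ ℝ) (r : ℝ)
    (σ : Fin n → Fin K) : Prop :=
  ∃ (t : Fin K → Fin n) (S Chat : Fin K → Finset (Fin n)),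
    (∀ i, S i = Finset.univ.filter fun v => ∀ j < i, v ∉ Chat j) ∧
    (∀ i, (S i).Nonempty →
      t i ∈ S i ∧ ∀ u ∈ S i, (rowBall W r (S i) u).card ≤ (rowBall W r (S i) (t i)).card) ∧
    (∀ i, Chat i = rowBall W r (S i) (t i)) ∧
    (∀ i, ∀ v ∈ Chat i, σ v = i) ∧
    ∀ u, (∀ i, u ∉ Chat i) → ∀ j,
      (∑ v ∈ Chat (σ u), rowDist W u v) / ((Chat (σ u)).card : ℝ) ≤
        (∑ v ∈ Chat j, rowDist W u v) / ((Chat j).card : ℝ)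

/-- `H ∈ Π_ℋ(M)`. -/
def IsProjH {n K : ℕ} (m : ℕ) (M H : Matrix (Fin n) (Fin K) ℝ) : Prop :=
  H ∈ clusteringMatrices n m K ∧ ∀ H' ∈ clusteringMatrices n m K, frob (M - H) ≤ frob (M - H')

/-- A realization of the randomized spectral clustering algorithm, that is, a choice of the
eigenvectors and of a minimizer or maximizer wherever the algorithm leaves several possibilities.
The number `μ` is the constant of the critical radius `μ √(K / n)` of the greedy clustering. -/
structure SpectralClustering (n m K d : ℕ) (μ : ℝ) where
  /-- the balanced clustering -/
  H₀ : Obs n d → Matrix (Fin n) (Fin K) ℝ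
  /-- the leading eigenvectors of the observation matrix -/
  U : Obs n d → VMat n K d
  /-- the group estimates, given the pivots -/
  R₀ : Obs n d → (Fin K → Fin n) → Fin n → Matrix (Fin d) (Fin d) ℝ
  H₀_spec : ∀ A : Obs n d, A.IsSymm →
    ∃ (W : Matrix (Fin n) (Fin K) ℝ) (σ : Fin n → Fin K),
      IsLeadingEigs (adjacency A) W ∧
      IsGreedyClustering W (μ * Real.sqrt ((K : ℝ) / n)) σ ∧
      IsProjH m (clusterMatrix σ) (H₀ A)
  U_spec : ∀ A : Obs n d, A.IsSymm → IsLeadingEigs A (U A)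
  R₀_spec : ∀ A : Obs n d, A.IsSymm → ∀ τ : Fin K → Fin n, (∀ k, H₀ A (τ k) k = 1) →
    ∀ k v, H₀ A v k = 1 →
      R₀ A τ v ∈ Matrix.orthogonalGroup (Fin d) ℝ ∧
      ∀ R' ∈ Matrix.orthogonalGroup (Fin d) ℝ,
        frob (blockRow (U A) v - R₀ A τ v * blockRow (U A) (τ k)) ≤
          frob (blockRow (U A) v - R' * blockRow (U A) (τ k))

namespace SpectralClustering

variable {n m K d : ℕ} {μ : ℝ}

open Classical in
/-- The admissible pivots: `τ k` belongs to the `k`-th estimated cluster. -/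
def pivots (alg : SpectralClustering n m K d μ) (A : Obs n d) : Finset (Fin K → Fin n) :=
  Finset.univ.filter fun τ => ∀ k, alg.H₀ A (τ k) k = 1

open Classical in
/-- The output `V⁰` for pivots that are drawn independently and uniformly from the estimated
clusters, that is, uniformly from `alg.pivots A`. (The second branch is never reached for a
symmetric matrix `A` and `1 ≤ m`.) -/
def toInitializer (alg : SpectralClustering n m K d μ) : Initializer n K d := fun A =>
  if h : (alg.pivots A).Nonempty then
    (PMF.uniformOfFinset (alg.pivots A) h).map fun τ => entangle (alg.R₀ A τ) (alg.H₀ A)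
  else PMF.pure 0

end SpectralClustering

end

end SGBM

/-! Both parts rest on one estimate. The observation is a multiple of the identity, plus its
structured mean, plus centred noise with independent contributions. With probability at least `1 -
1/n` the quadratic form of the noise is at most `ε log n` times the squared norm, for any fixed `ε`
(`exists_quadForm_noise_le`). The signal has eigenvalues of order `m (p - q)`, which is of order
`log n`, so it dominates. The estimate follows Bilu–Linial. Vectors are expanded in binary digits,
which reduces the form to sums over rectangles `S × T`. Chernoff bounds and a union bound control
rectangles of bounded aspect ratio, and row sums of order `log n` control the thin ones. The
adjacency matrix is treated in the same way.

Part (a). The noise bound separates the leading eigenvalues from the rest.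
`leadingEigs_perturbation` then measures the eigenvector error by `‖N V‖²/g²`, where `V` is the
orthonormal signal basis and `g` the gap. Only a fixed number of columns is involved, so a second
moment computation gives `‖N V‖²` expectation `O(log n)`; by Markov's inequality it is below `(log
n)^(3/2)` outside an event of probability `O((log n)^(-1/2))`. With `g²` of order `(log n)²`, the
error tends to zero. Hence most rows of `W` lie near well-separated centres and greedy clustering
misplaces a small fraction of nodes. Balancing preserves this up to a constant factor. Random pivots
avoid nodes that are misplaced or have a large row error, and aligning block rows to a good pivot
recovers the group elements up to one rotation per cluster, which `ε_{𝒪(d)}` ignores.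

Part (b) imposes no order on `α` and `β`, so a different initializer is used: a feasible `V` nearly
maximizing `⟨A, V Vᵀ⟩`. If the Haar mean vanishes, the mean of `A` is, up to the identity, `p V*
V*ᵀ`, so a near-maximizer has almost the maximal overlap `‖V*ᵀ V‖²`, whatever `q` is. Almost full
overlap forces `V` to be close to `V*` up to the symmetries (`estErr_sq_le_of_overlap`). The Haar
mean is nonzero only for `𝒮𝒪(1)`. There the group is trivial, the correlation is centred to remove
the `q` term, and its absolute value is maximized because the sign of `p - q` is unknown; this is
where `|α - β| ≥ δ` enters. -/

namespace SGBM

/-! ### Quadratic forms from rectangle discrepancies. -/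

open Finset in
/-- Dyadic summation: a double sequence controlled by `a √(A s B t)` near the diagonal and by
`D · min (A s) (B t)` away from it. -/
theorem sum_dyadic_le (c : ℕ → ℕ → ℝ) (A B : ℕ → ℝ) (a D : ℝ) (γ L : ℕ)
    (hA : ∀ s, 0 ≤ A s) (hB : ∀ s, 0 ≤ B s) (ha : 0 ≤ a) (hD : 0 ≤ D)
    (h1 : ∀ s t, c s t ≤ a * Real.sqrt (A s * B t))
    (h2 : ∀ s t, c s t ≤ D * A s) (h3 : ∀ s t, c s t ≤ D * B t) :
    ∑ s ∈ range L, ∑ t ∈ range L, (2 : ℝ) ^ s * 2 ^ t * c s t ≤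
      (a * (2 * γ + 1) / 2 + D / 2 ^ γ) *
        (∑ s ∈ range L, 4 ^ s * A s + ∑ t ∈ range L, 4 ^ t * B t) := by
  have hcard : ∀ s, ∑ t ∈ range L, (if s ≤ t + γ ∧ t ≤ s + γ then (1 : ℝ) else 0) ≤ 2 * γ + 1 := by
    intro s
    rw [← sum_filter, sum_const, nsmul_eq_mul, mul_one]
    have : ((range L).filter fun t => s ≤ t + γ ∧ t ≤ s + γ) ⊆ Icc (s - γ) (s + γ) := by
      intro t ht
      simp only [mem_filter, mem_range, mem_Icc] at ht ⊢
      omega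
    have h := card_le_card this
    rw [Nat.card_Icc] at h
    have : ((range L).filter fun t => s ≤ t + γ ∧ t ≤ s + γ).card ≤ 2 * γ + 1 := by omega
    exact_mod_cast this
  have hgeo : ∀ s, ∑ t ∈ range L, (if t + γ < s then (2 : ℝ) ^ t else 0) ≤ 2 ^ s / 2 ^ γ := by
    intro s
    rw [← sum_filter]
    by_cases hs : γ ≤ s
    · have hsub : ((range L).filter fun t => t + γ < s) ⊆ range (s - γ) := by
        intro t ht
        simp only [mem_filter, mem_range] at ht ⊢
        omega
      calc ∑ t ∈ (range L).filter fun t => t + γ < s, (2 : ℝ) ^ t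
          ≤ ∑ t ∈ range (s - γ), (2 : ℝ) ^ t :=
            sum_le_sum_of_subset_of_nonneg hsub fun _ _ _ => by positivity
        _ = 2 ^ (s - γ) - 1 := by rw [geom_sum_eq (by norm_num)]; norm_num
        _ ≤ 2 ^ s / 2 ^ γ := by
            rw [le_div_iff₀ (by positivity), sub_mul, ← pow_add, Nat.sub_add_cancel hs]
            have : (0 : ℝ) < 2 ^ γ := by positivity
            linarith
    · have : ((range L).filter fun t => t + γ < s) = ∅ := by
        apply filter_eq_empty_iff.2
        intro t _
        omega
      rw [this, sum_empty]
      positivity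
  -- Within distance `γ` of the diagonal AM–GM splits `√(A s * B t)`. Outside, the trivial bound is
  -- taken in the variable with the larger index, so that the other index sums to a geometric series
  -- that gains `2 ^ γ`.
  have hpt : ∀ s t, (2 : ℝ) ^ s * 2 ^ t * c s t ≤
      (if s ≤ t + γ ∧ t ≤ s + γ then (1 : ℝ) else 0) * (a / 2 * (4 ^ s * A s)) +
      (if t ≤ s + γ ∧ s ≤ t + γ then (1 : ℝ) else 0) * (a / 2 * (4 ^ t * B t)) +
      ((if t + γ < s then (2 : ℝ) ^ t else 0) * (2 ^ s * (D * A s)) +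
       (if s + γ < t then (2 : ℝ) ^ s else 0) * (2 ^ t * (D * B t))) := by
    intro s t
    have h4 : ∀ k : ℕ, (4 : ℝ) ^ k = 2 ^ k * 2 ^ k := fun k => by
      rw [← mul_pow]; norm_num
    have hps : (0 : ℝ) < 2 ^ s := by positivity
    have hpt : (0 : ℝ) < 2 ^ t := by positivity
    rcases lt_or_ge (t + γ) s with h | h
    · have e1 : ¬ (s ≤ t + γ ∧ t ≤ s + γ) := by omega
      have e2 : ¬ (t ≤ s + γ ∧ s ≤ t + γ) := by omega
      have e3 : ¬ (s + γ < t) := by omega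
      simp only [e1, e2, e3, h, if_true, if_false]
      have := mul_le_mul_of_nonneg_left (h2 s t) (mul_pos hps hpt).le
      linarith
    · rcases lt_or_ge (s + γ) t with h' | h'
      · have e1 : ¬ (s ≤ t + γ ∧ t ≤ s + γ) := by omega
        have e2 : ¬ (t ≤ s + γ ∧ s ≤ t + γ) := by omega
        have e3 : ¬ (t + γ < s) := by omega
        simp only [e1, e2, e3, h', if_true, if_false]
        have := mul_le_mul_of_nonneg_left (h3 s t) (mul_pos hps hpt).le
        linarith
      · have e1 : (s ≤ t + γ ∧ t ≤ s + γ) := by omega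
        have e2 : (t ≤ s + γ ∧ s ≤ t + γ) := by omega
        have e3 : ¬ (t + γ < s) := by omega
        have e4 : ¬ (s + γ < t) := by omega
        rw [if_pos e1, if_pos e2, if_neg e3, if_neg e4]
        have h5 := mul_le_mul_of_nonneg_left (h1 s t) (mul_pos hps hpt).le
        have h6 : 2 ^ s * 2 ^ t * Real.sqrt (A s * B t) ≤ (4 ^ s * A s + 4 ^ t * B t) / 2 := by
          rw [Real.sqrt_mul (hA s), h4, h4]
          have e5 := Real.mul_self_sqrt (hA s)
          have e6 := Real.mul_self_sqrt (hB t)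
          have e7 : 2 ^ s * 2 ^ s * A s = (2 ^ s * Real.sqrt (A s)) ^ 2 := by
            rw [← e5]; ring_nf; rw [Real.sqrt_sq (Real.sqrt_nonneg _)]
          have e8 : 2 ^ t * 2 ^ t * B t = (2 ^ t * Real.sqrt (B t)) ^ 2 := by
            rw [← e6]; ring_nf; rw [Real.sqrt_sq (Real.sqrt_nonneg _)]
          rw [e7, e8]
          nlinarith [sq_nonneg (2 ^ s * Real.sqrt (A s) - 2 ^ t * Real.sqrt (B t))]
        have h7 := mul_le_mul_of_nonneg_left h6 ha
        linarith
  have hsum := sum_le_sum fun s (_ : s ∈ range L) => sum_le_sum fun t (_ : t ∈ range L) => hpt s t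
  refine hsum.trans ?_
  simp only [sum_add_distrib]
  have t1 : ∑ s ∈ range L, ∑ t ∈ range L,
      (if s ≤ t + γ ∧ t ≤ s + γ then (1 : ℝ) else 0) * (a / 2 * (4 ^ s * A s)) ≤
      ∑ s ∈ range L, (2 * γ + 1) * (a / 2 * (4 ^ s * A s)) := by
    refine sum_le_sum fun s _ => ?_
    rw [← sum_mul]
    exact mul_le_mul_of_nonneg_right (hcard s)
      (mul_nonneg (by linarith) (mul_nonneg (by positivity) (hA s)))
  have t2 : ∑ s ∈ range L, ∑ t ∈ range L,
      (if t ≤ s + γ ∧ s ≤ t + γ then (1 : ℝ) else 0) * (a / 2 * (4 ^ t * B t)) ≤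
      ∑ s ∈ range L, (2 * γ + 1) * (a / 2 * (4 ^ s * B s)) := by
    rw [sum_comm]
    refine sum_le_sum fun s _ => ?_
    rw [← sum_mul]
    exact mul_le_mul_of_nonneg_right (hcard s)
      (mul_nonneg (by linarith) (mul_nonneg (by positivity) (hB s)))
  have t3 : ∑ s ∈ range L, ∑ t ∈ range L,
      (if t + γ < s then (2 : ℝ) ^ t else 0) * (2 ^ s * (D * A s)) ≤
      ∑ s ∈ range L, 2 ^ s / 2 ^ γ * (2 ^ s * (D * A s)) := by
    refine sum_le_sum fun s _ => ?_
    rw [← sum_mul]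
    exact mul_le_mul_of_nonneg_right (hgeo s)
      (mul_nonneg (by positivity) (mul_nonneg hD (hA s)))
  have t4 : ∑ s ∈ range L, ∑ t ∈ range L,
      (if s + γ < t then (2 : ℝ) ^ s else 0) * (2 ^ t * (D * B t)) ≤
      ∑ s ∈ range L, 2 ^ s / 2 ^ γ * (2 ^ s * (D * B s)) := by
    rw [sum_comm]
    refine sum_le_sum fun s _ => ?_
    rw [← sum_mul]
    exact mul_le_mul_of_nonneg_right (hgeo s)
      (mul_nonneg (by positivity) (mul_nonneg hD (hB s)))
  have f : ∀ (x : ℝ) s, (2 : ℝ) ^ s / 2 ^ γ * (2 ^ s * (D * x)) = D / 2 ^ γ * (4 ^ s * x) := by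
    intro x s
    have : (4 : ℝ) ^ s = 2 ^ s * 2 ^ s := by rw [← mul_pow]; norm_num
    rw [this]; ring
  simp only [f] at t3 t4
  simp only [← mul_sum] at t1 t2 t3 t4 ⊢
  linarith

section Quadratic

variable {ι : Type*} [Fintype ι]

open Finset

/-- The bilinear form of a real matrix. -/
noncomputable def bil (M : Matrix ι ι ℝ) (u w : ι → ℝ) : ℝ := ∑ x, ∑ y, M x y * u x * w y

/-- Binary digits write an integer vector as `∑ 2 ^ s 1_{S s}`, so the form becomes a dyadic double
sum of rectangle sums and `sum_dyadic_le` applies. The level sets satisfy `∑ 4 ^ s |S s| ≤ ∑ u²`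
because a sum of squares of nonnegative terms is at most the square of their sum. -/
theorem bil_le_of_nat [DecidableEq ι] (M : Matrix ι ι ℝ) (a D : ℝ) (γ : ℕ) (ha : 0 ≤ a) (hD : 0 ≤ D)
    (h1 : ∀ S T : Finset ι, |∑ x ∈ S, ∑ y ∈ T, M x y| ≤ a * Real.sqrt (S.card * T.card))
    (h2 : ∀ S T : Finset ι, |∑ x ∈ S, ∑ y ∈ T, M x y| ≤ D * S.card)
    (h3 : ∀ S T : Finset ι, |∑ x ∈ S, ∑ y ∈ T, M x y| ≤ D * T.card) (u w : ι → ℕ) :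
    |bil M (fun x => u x) (fun x => w x)| ≤ (a * (2 * γ + 1) / 2 + D / 2 ^ γ) *
      (∑ x, (u x : ℝ) ^ 2 + ∑ x, (w x : ℝ) ^ 2) := by
  obtain ⟨L, hL⟩ : ∃ L : ℕ, ∀ x, u x < 2 ^ L ∧ w x < 2 ^ L := by
    refine ⟨∑ x, u x + ∑ x, w x, fun x => ?_⟩
    have hu := single_le_sum (f := u) (fun _ _ => Nat.zero_le _) (mem_univ x)
    have hw := single_le_sum (f := w) (fun _ _ => Nat.zero_le _) (mem_univ x)
    have := Nat.lt_two_pow_self (n := ∑ x, u x + ∑ x, w x)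
    omega
  have hbit : ∀ n : ℕ, n < 2 ^ L → (n : ℝ) = ∑ s ∈ range L, 2 ^ s * (if n / 2 ^ s % 2 = 1 then (1 : ℝ) else 0) := by
    intro n hn
    have key : ∀ k, n % 2 ^ k = ∑ s ∈ range k, 2 ^ s * (n / 2 ^ s % 2) := by
      intro k
      induction k with
      | zero => simp [Nat.mod_one]
      | succ k ih => rw [sum_range_succ, ← ih, Nat.mod_pow_succ]
    have h := key L
    rw [Nat.mod_eq_of_lt hn] at h
    conv_lhs => rw [h]
    push_cast
    refine sum_congr rfl fun s _ => ?_
    rcases Nat.mod_two_eq_zero_or_one (n / 2 ^ s) with h0 | h0 <;> simp [h0]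
  set S : (ι → ℕ) → ℕ → Finset ι := fun v s => univ.filter fun x => v x / 2 ^ s % 2 = 1 with hS
  have hsq : ∀ v : ι → ℕ, (∀ x, v x < 2 ^ L) →
      ∑ s ∈ range L, (4 : ℝ) ^ s * ((S v s).card : ℝ) ≤ ∑ x, (v x : ℝ) ^ 2 := by
    intro v hv
    have : ∀ s, ((S v s).card : ℝ) = ∑ x, (if v x / 2 ^ s % 2 = 1 then (1 : ℝ) else 0) := by
      intro s; simp [hS]
    simp only [this, mul_sum]
    rw [sum_comm]
    refine sum_le_sum fun x _ => ?_
    rw [hbit _ (hv x)]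
    refine le_trans (le_of_eq ?_) (sum_sq_le_sq_sum_of_nonneg fun s _ => by positivity)
    refine sum_congr rfl fun s _ => ?_
    have : (4 : ℝ) ^ s = 2 ^ s * 2 ^ s := by rw [← mul_pow]; norm_num
    split_ifs <;> simp [this]; ring
  have hexp : bil M (fun x => u x) (fun x => w x) =
      ∑ s ∈ range L, ∑ t ∈ range L, 2 ^ s * 2 ^ t * ∑ x ∈ S u s, ∑ y ∈ S w t, M x y := by
    have : ∀ s t, ∑ x ∈ S u s, ∑ y ∈ S w t, M x y =
        ∑ x, ∑ y, M x y * (if u x / 2 ^ s % 2 = 1 then (1 : ℝ) else 0) *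
          (if w y / 2 ^ t % 2 = 1 then (1 : ℝ) else 0) := by
      intro s t
      simp only [hS, sum_filter]
      refine sum_congr rfl fun x _ => ?_
      split_ifs <;> simp
    simp only [this]
    unfold bil
    have e : ∀ x y, M x y * (u x : ℝ) * (w y : ℝ) = ∑ s ∈ range L, ∑ t ∈ range L,
        2 ^ s * 2 ^ t * (M x y * (if u x / 2 ^ s % 2 = 1 then (1 : ℝ) else 0) *
          (if w y / 2 ^ t % 2 = 1 then (1 : ℝ) else 0)) := by
      intro x y
      rw [hbit _ (hL x).1, hbit _ (hL y).2, mul_assoc, sum_mul_sum, mul_sum]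
      refine sum_congr rfl fun s _ => ?_
      rw [mul_sum]
      refine sum_congr rfl fun t _ => ?_
      ring
    simp only [e, mul_sum]
    rw [sum_congr rfl fun x _ => sum_comm]
    rw [sum_comm]
    refine sum_congr rfl fun s _ => ?_
    rw [sum_congr rfl fun x _ => sum_comm]
    rw [sum_comm]
  rw [hexp]
  have hb := sum_dyadic_le (fun s t => |∑ x ∈ S u s, ∑ y ∈ S w t, M x y|)
    (fun s => (S u s).card) (fun t => (S w t).card) a D γ L (fun _ => by positivity)
    (fun _ => by positivity) ha hD (fun s t => h1 _ _) (fun s t => h2 _ _) (fun s t => h3 _ _)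
  have hab : |∑ s ∈ range L, ∑ t ∈ range L, (2 : ℝ) ^ s * 2 ^ t * ∑ x ∈ S u s, ∑ y ∈ S w t, M x y| ≤
      ∑ s ∈ range L, ∑ t ∈ range L, (2 : ℝ) ^ s * 2 ^ t * |∑ x ∈ S u s, ∑ y ∈ S w t, M x y| := by
    refine (abs_sum_le_sum_abs _ _).trans (sum_le_sum fun s _ => ?_)
    refine (abs_sum_le_sum_abs _ _).trans (sum_le_sum fun t _ => ?_)
    rw [abs_mul, abs_of_nonneg (by positivity : (0 : ℝ) ≤ 2 ^ s * 2 ^ t)]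
  refine hab.trans (hb.trans ?_)
  exact mul_le_mul_of_nonneg_left (add_le_add (hsq u fun x => (hL x).1) (hsq w fun x => (hL x).2))
    (by positivity)

theorem bil_smul (M : Matrix ι ι ℝ) (c : ℝ) (u w : ι → ℝ) :
    bil M (fun x => c * u x) (fun x => c * w x) = c ^ 2 * bil M u w := by
  simp only [bil, mul_sum]
  refine sum_congr rfl fun x _ => sum_congr rfl fun y _ => by ring

-- Both sides are homogeneous of degree two, so the bound passes from integer vectors to `⌊k u⌋ /
-- k`, and to `u` as `k → ∞`.
open Filter Topology in
theorem bil_le_of_nonneg [DecidableEq ι] (M : Matrix ι ι ℝ) (c : ℝ)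
    (h : ∀ u w : ι → ℕ, |bil M (fun x => u x) (fun x => w x)| ≤
      c * (∑ x, (u x : ℝ) ^ 2 + ∑ x, (w x : ℝ) ^ 2)) (u w : ι → ℝ) (hu : ∀ x, 0 ≤ u x)
    (hw : ∀ x, 0 ≤ w x) : |bil M u w| ≤ c * (∑ x, u x ^ 2 + ∑ x, w x ^ 2) := by
  have lim : ∀ r : ℝ, 0 ≤ r →
      Tendsto (fun k : ℕ => ((k : ℝ))⁻¹ * (⌊(k : ℝ) * r⌋₊ : ℝ)) atTop (𝓝 r) := by
    intro r hr
    have := (tendsto_nat_floor_mul_div_atTop hr).comp (tendsto_natCast_atTop_atTop (R := ℝ))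
    refine this.congr fun k => ?_
    simp only [Function.comp]
    rw [mul_comm r, div_eq_inv_mul]
  have hk : ∀ k : ℕ,
      |bil M (fun x => (k : ℝ)⁻¹ * (⌊(k : ℝ) * u x⌋₊ : ℝ)) (fun x => (k : ℝ)⁻¹ * (⌊(k : ℝ) * w x⌋₊ : ℝ))| ≤
      c * (∑ x, ((k : ℝ)⁻¹ * (⌊(k : ℝ) * u x⌋₊ : ℝ)) ^ 2 +
        ∑ x, ((k : ℝ)⁻¹ * (⌊(k : ℝ) * w x⌋₊ : ℝ)) ^ 2) := by
    intro k
    have hh := h (fun x => ⌊(k : ℝ) * u x⌋₊) (fun x => ⌊(k : ℝ) * w x⌋₊)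
    rw [bil_smul M, abs_mul, abs_of_nonneg (sq_nonneg _)]
    have := mul_le_mul_of_nonneg_left hh (sq_nonneg ((k : ℝ)⁻¹))
    refine this.trans (le_of_eq ?_)
    simp only [mul_pow, ← mul_sum]
    ring
  have l1 : Tendsto (fun k : ℕ => |bil M (fun x => (k : ℝ)⁻¹ * (⌊(k : ℝ) * u x⌋₊ : ℝ))
      (fun x => (k : ℝ)⁻¹ * (⌊(k : ℝ) * w x⌋₊ : ℝ))|) atTop (𝓝 |bil M u w|) := by
    refine Tendsto.abs ?_
    unfold bil
    refine tendsto_finsetSum _ fun x _ => tendsto_finsetSum _ fun y _ => ?_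
    exact (tendsto_const_nhds.mul (lim _ (hu x))).mul (lim _ (hw y))
  have l2 : Tendsto (fun k : ℕ => c * (∑ x, ((k : ℝ)⁻¹ * (⌊(k : ℝ) * u x⌋₊ : ℝ)) ^ 2 +
        ∑ x, ((k : ℝ)⁻¹ * (⌊(k : ℝ) * w x⌋₊ : ℝ)) ^ 2)) atTop
      (𝓝 (c * (∑ x, u x ^ 2 + ∑ x, w x ^ 2))) := by
    refine tendsto_const_nhds.mul (Tendsto.add ?_ ?_)
    · exact tendsto_finsetSum _ fun x _ => (lim _ (hu x)).pow 2
    · exact tendsto_finsetSum _ fun x _ => (lim _ (hw x)).pow 2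
  exact le_of_tendsto_of_tendsto' l1 l2 hk

/-- A discrepancy bound on all rectangles bounds the quadratic form (Bilu–Linial). -/
theorem quadForm_le_of_discrepancy [DecidableEq ι] (M : Matrix ι ι ℝ) (a D : ℝ) (γ : ℕ)
    (ha : 0 ≤ a) (hD : 0 ≤ D)
    (h1 : ∀ S T : Finset ι, |∑ x ∈ S, ∑ y ∈ T, M x y| ≤ a * Real.sqrt (S.card * T.card))
    (h2 : ∀ S T : Finset ι, |∑ x ∈ S, ∑ y ∈ T, M x y| ≤ D * S.card)
    (h3 : ∀ S T : Finset ι, |∑ x ∈ S, ∑ y ∈ T, M x y| ≤ D * T.card) (u : ι → ℝ) :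
    |bil M u u| ≤ 4 * (a * (2 * γ + 1) / 2 + D / 2 ^ γ) * ∑ x, u x ^ 2 := by
  set c := a * (2 * γ + 1) / 2 + D / 2 ^ γ with hc
  have hb := bil_le_of_nonneg M c (bil_le_of_nat M a D γ ha hD h1 h2 h3)
  -- Splitting into positive and negative parts gives four forms of nonnegative vectors with
  -- disjoint supports; adding their bounds gives the factor `4`.
  set p : ι → ℝ := fun x => max (u x) 0
  set q : ι → ℝ := fun x => max (-u x) 0
  have hp : ∀ x, 0 ≤ p x := fun x => le_max_right _ _
  have hq : ∀ x, 0 ≤ q x := fun x => le_max_right _ _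
  have hu : ∀ x, u x = p x - q x := fun x => by
    simp only [p, q]
    rcases le_total (u x) 0 with h | h
    · rw [max_eq_right h, max_eq_left (by linarith)]; ring
    · rw [max_eq_left h, max_eq_right (by linarith)]; ring
  have hs : ∑ x, u x ^ 2 = ∑ x, p x ^ 2 + ∑ x, q x ^ 2 := by
    rw [← sum_add_distrib]
    refine sum_congr rfl fun x _ => ?_
    simp only [p, q]
    rcases le_total (u x) 0 with h | h
    · rw [max_eq_right h, max_eq_left (by linarith)]; ring
    · rw [max_eq_left h, max_eq_right (by linarith)]; ring
  have he : bil M u u = bil M p p - bil M p q - bil M q p + bil M q q := by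
    simp only [bil, ← sum_sub_distrib, ← sum_add_distrib]
    refine sum_congr rfl fun x _ => sum_congr rfl fun y _ => ?_
    rw [hu x, hu y]; ring
  have b1 := abs_le.1 (hb p p hp hp)
  have b2 := abs_le.1 (hb p q hp hq)
  have b3 := abs_le.1 (hb q p hq hp)
  have b4 := abs_le.1 (hb q q hq hq)
  rw [he, hs, abs_le]
  constructor <;> linarith [b1.1, b1.2, b2.1, b2.2, b3.1, b3.2, b4.1, b4.2]

end Quadratic

end SGBM

/-! ### Tail bounds for sums of independent variables. -/

namespace SGBM

open MeasureTheory ProbabilityTheory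

section Concentration

variable {E X : Type*} [Fintype E] [MeasurableSpace X] (ν : E → Measure X)
  [∀ e, IsProbabilityMeasure (ν e)]

theorem integrable_of_abs_le {Y : Type*} [MeasurableSpace Y] (P : Measure Y) [IsFiniteMeasure P]
    {f : Y → ℝ} (hf : Measurable f) (L : ℝ) (h : ∀ z, |f z| ≤ L) : Integrable f P :=
  Integrable.of_bound hf.aestronglyMeasurable L (ae_of_all _ h)

/-- The Chernoff bound: exponential Markov inequality, with the moment generating function factoring
over the product measure. -/
theorem measureReal_le_sum_pi_le (g : E → X → ℝ) (L : ℝ) (hg : ∀ e, Measurable (g e))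
    (hb : ∀ e z, |g e z| ≤ L) {θ lam : ℝ} (hθ : 0 ≤ θ) (c : E → ℝ)
    (hc : ∀ e, ∫ z, Real.exp (θ * g e z) ∂(ν e) ≤ Real.exp (c e)) :
    (Measure.pi ν).real {ω | lam ≤ ∑ e, g e (ω e)} ≤ Real.exp (-θ * lam + ∑ e, c e) := by
  have hexp : ∀ ω : E → X, Real.exp (θ * ∑ e, g e (ω e)) = ∏ e, Real.exp (θ * g e (ω e)) := by
    intro ω
    rw [Finset.mul_sum, Real.exp_sum]
  have hint : Integrable (fun ω : E → X => Real.exp (θ * ∑ e, g e (ω e))) (Measure.pi ν) := by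
    simp only [hexp]
    refine Integrable.fintype_prod_dep (f := fun e z => Real.exp (θ * g e z)) fun e => ?_
    refine integrable_of_abs_le _ (by fun_prop) (Real.exp (θ * L)) fun z => ?_
    rw [Real.abs_exp]
    exact Real.exp_le_exp.2 (mul_le_mul_of_nonneg_left ((le_abs_self _).trans (hb e z)) hθ)
  have h := measure_ge_le_exp_mul_mgf (μ := Measure.pi ν) (X := fun ω => ∑ e, g e (ω e)) lam hθ hint
  refine h.trans ?_
  rw [Real.exp_add]
  refine mul_le_mul_of_nonneg_left ?_ (Real.exp_pos _).le
  unfold mgf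
  simp only [hexp]
  rw [integral_fintype_prod_eq_prod (f := fun e z => Real.exp (θ * g e z)), Real.exp_sum]
  exact Finset.prod_le_prod (fun e _ => integral_nonneg fun z => (Real.exp_pos _).le) fun e _ => hc e

theorem exp_le_one_add_add_sq_mul_exp (x : ℝ) : Real.exp x ≤ 1 + x + x ^ 2 * Real.exp |x| := by
  have h := Complex.norm_exp_sub_sum_le_norm_mul_exp (x : ℂ) 2
  simp only [Finset.sum_range_succ, Finset.sum_range_zero, pow_zero, Nat.factorial, pow_one] at h
  have e : Complex.exp x - (0 + 1 / ((1 : ℕ) : ℂ) + (x : ℂ) / ((((0 + 1) * 1 : ℕ)) : ℂ)) =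
      ((Real.exp x - (1 + x) : ℝ) : ℂ) := by push_cast; ring
  rw [e, Complex.norm_real, Complex.norm_real, Real.norm_eq_abs, Real.norm_eq_abs, sq_abs] at h
  linarith [le_abs_self (Real.exp x - (1 + x))]

/-- A Bennett-type tail bound for sums of independent bounded centred variables. -/
theorem measureReal_centered_sum_ge_le (g : E → X → ℝ) (L : ℝ) (hg : ∀ e, Measurable (g e))
    (hb : ∀ e z, |g e z| ≤ L) (hm : ∀ e, ∫ z, g e z ∂(ν e) = 0) {θ lam : ℝ} (hθ : 0 ≤ θ) :
    (Measure.pi ν).real {ω | lam ≤ ∑ e, g e (ω e)} ≤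
      Real.exp (-θ * lam + θ ^ 2 * L * Real.exp (θ * L) * ∑ e, ∫ z, |g e z| ∂(ν e)) := by
  rw [Finset.mul_sum]
  refine measureReal_le_sum_pi_le ν g L hg hb hθ _ fun e => ?_
  have i1 : Integrable (g e) (ν e) := integrable_of_abs_le _ (hg e) L (hb e)
  have i2 : Integrable (fun z => |g e z|) (ν e) := i1.abs
  set κ := θ ^ 2 * L * Real.exp (θ * L)
  calc ∫ z, Real.exp (θ * g e z) ∂(ν e)
      ≤ ∫ z, (1 + θ * g e z + κ * |g e z|) ∂(ν e) := by
        refine integral_mono_of_nonneg (ae_of_all _ fun z => (Real.exp_pos _).le) ?_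
          (ae_of_all _ fun z => ?_)
        · exact ((integrable_const _).add (i1.const_mul θ)).add (i2.const_mul κ)
        · have h := exp_le_one_add_add_sq_mul_exp (θ * g e z)
          have h1 : |θ * g e z| ≤ θ * L := by
            rw [abs_mul, abs_of_nonneg hθ]
            exact mul_le_mul_of_nonneg_left (hb e z) hθ
          -- Since `g² ≤ L |g|`, first absolute moments can replace variances; for sparse variables
          -- they have the same order.
          have h2 : (θ * g e z) ^ 2 * Real.exp |θ * g e z| ≤ κ * |g e z| := by
            have h3 : (θ * g e z) ^ 2 ≤ θ ^ 2 * (L * |g e z|) := by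
              rw [mul_pow, ← sq_abs (g e z), pow_two |g e z|]
              exact mul_le_mul_of_nonneg_left
                (mul_le_mul_of_nonneg_right (hb e z) (abs_nonneg _)) (sq_nonneg _)
            calc _ ≤ θ ^ 2 * (L * |g e z|) * Real.exp (θ * L) :=
                  mul_le_mul h3 (Real.exp_le_exp.2 h1) (Real.exp_pos _).le
                    ((sq_nonneg _).trans h3)
              _ = κ * |g e z| := by simp only [κ]; ring
          show Real.exp (θ * g e z) ≤ 1 + θ * g e z + κ * |g e z|
          linarith
    _ = 1 + κ * ∫ z, |g e z| ∂(ν e) := by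
        have i3 : Integrable (fun z => 1 + θ * g e z) (ν e) :=
          (integrable_const _).add (i1.const_mul θ)
        rw [integral_add i3 (i2.const_mul κ), integral_add (integrable_const _) (i1.const_mul θ),
          integral_const_mul, integral_const_mul, hm e]
        simp
    _ ≤ _ := by
        rw [add_comm]
        exact Real.add_one_le_exp _

/-- Chernoff with exponent `1` and `exp g ≤ 1 + exp L * g` on `[0, L]`. Without centring this is
crude, but it bounds row sums by a constant times `log n`, which is all that is needed of them. -/
theorem measureReal_nonneg_sum_ge_le (g : E → X → ℝ) (L : ℝ) (hg : ∀ e, Measurable (g e))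
    (h0 : ∀ e z, 0 ≤ g e z) (hb : ∀ e z, g e z ≤ L) (lam : ℝ) :
    (Measure.pi ν).real {ω | lam ≤ ∑ e, g e (ω e)} ≤
      Real.exp (-lam + Real.exp L * ∑ e, ∫ z, g e z ∂(ν e)) := by
  rw [Finset.mul_sum, ← neg_one_mul lam]
  have hb' : ∀ e z, |g e z| ≤ L := fun e z => by rw [abs_of_nonneg (h0 e z)]; exact hb e z
  refine measureReal_le_sum_pi_le ν g L hg hb' zero_le_one _ fun e => ?_
  have i1 : Integrable (g e) (ν e) := integrable_of_abs_le _ (hg e) L (hb' e)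
  calc ∫ z, Real.exp (1 * g e z) ∂(ν e)
      ≤ ∫ z, (1 + Real.exp L * g e z) ∂(ν e) := by
        refine integral_mono_of_nonneg (ae_of_all _ fun z => (Real.exp_pos _).le) ?_
          (ae_of_all _ fun z => ?_)
        · exact (integrable_const _).add (i1.const_mul _)
        · show Real.exp (1 * g e z) ≤ 1 + Real.exp L * g e z
          rw [one_mul]
          have h1 := Real.add_one_le_exp (-g e z)
          have h2 := mul_le_mul_of_nonneg_left h1 (Real.exp_pos (g e z)).le
          rw [← Real.exp_add, add_neg_cancel, Real.exp_zero] at h2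
          have h3 := mul_le_mul_of_nonneg_right (Real.exp_le_exp.2 (hb e z)) (h0 e z)
          linarith
    _ = 1 + Real.exp L * ∫ z, g e z ∂(ν e) := by
        rw [integral_add (integrable_const _) (i1.const_mul _), integral_const_mul]
        simp
    _ ≤ _ := by
        rw [add_comm]
        exact Real.add_one_le_exp _

theorem integral_sq_centered_sum (g : E → X → ℝ) (L : ℝ) (hg : ∀ e, Measurable (g e))
    (hb : ∀ e z, |g e z| ≤ L) (hm : ∀ e, ∫ z, g e z ∂(ν e) = 0) :
    ∫ ω, (∑ e, g e (ω e)) ^ 2 ∂(Measure.pi ν) = ∑ e, ∫ z, g e z ^ 2 ∂(ν e) := by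
  have hmem : ∀ e, MemLp (g e) 2 (ν e) := fun e =>
    MemLp.of_bound (hg e).aestronglyMeasurable L (ae_of_all _ (hb e))
  have h := variance_sum_pi (μ := ν) (X := fun e => g e) hmem
  have hmean : ∫ ω, (∑ e, fun ω : E → X => g e (ω e)) ω ∂(Measure.pi ν) = 0 := by
    simp only [Finset.sum_apply]
    rw [integral_finsetSum]
    · refine Finset.sum_eq_zero fun e _ => ?_
      rw [integral_comp_eval (μ := ν) (f := g e) (hg e).aestronglyMeasurable, hm e]
    · intro e _
      exact integrable_of_abs_le _ ((hg e).comp (measurable_pi_apply e)) L fun ω => hb e _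
  rw [variance_of_integral_eq_zero _ hmean] at h
  · simp only [Finset.sum_apply] at h
    rw [h]
    refine Finset.sum_congr rfl fun e _ => ?_
    rw [variance_of_integral_eq_zero (hg e).aemeasurable (hm e)]
  · exact (Finset.measurable_sum (f := fun e (ω : E → X) => g e (ω e)) Finset.univ fun e _ =>
      (hg e).comp (measurable_pi_apply e)).aemeasurable.congr
        (ae_of_all _ fun ω => by simp)

end Concentration

end SGBM

/-! ### Sparse noise matrices: rectangles, rows and the union bound. -/

namespace SGBM

open MeasureTheory ProbabilityTheory Finset

section NoiseMatrix

variable {ι E X : Type*} [Fintype ι] [Fintype E] [MeasurableSpace X]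

/-- The random matrix with entries `∑ e, h x y e (ω e)`. -/
def randMat (h : ι → ι → E → X → ℝ) (ω : E → X) : Matrix ι ι ℝ :=
  Matrix.of fun x y => ∑ e, h x y e (ω e)

/-- `h` describes a symmetric centred random matrix that is a sum of independent contributions
`h · · e`, each of entrywise `ℓ¹` norm at most `L`, whose entries have absolute moments at
most `v`. -/
structure IsNoise (ν : E → Measure X) (h : ι → ι → E → X → ℝ) (L v : ℝ) : Prop where
  meas : ∀ x y e, Measurable (h x y e)
  bound : ∀ e z, ∑ x, ∑ y, |h x y e z| ≤ L
  mean : ∀ x y e, ∫ z, h x y e z ∂(ν e) = 0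
  abs_le : ∀ x y, ∑ e, ∫ z, |h x y e z| ∂(ν e) ≤ v
  symm : ∀ x y e z, h x y e z = h y x e z

namespace IsNoise

theorem entry_le {ν : E → Measure X} {h : ι → ι → E → X → ℝ} {L v : ℝ} (H : IsNoise ν h L v) (x y e z) : |h x y e z| ≤ L :=
  ((single_le_sum (f := fun y => |h x y e z|) (fun _ _ => abs_nonneg _) (mem_univ y)).trans
    (single_le_sum (f := fun x => ∑ y, |h x y e z|)
      (fun _ _ => sum_nonneg fun _ _ => abs_nonneg _) (mem_univ x))).trans (H.bound e z)

variable {ν : E → Measure X} [∀ e, IsProbabilityMeasure (ν e)] {h : ι → ι → E → X → ℝ} {L v : ℝ}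

theorem integrable (H : IsNoise ν h L v) (x y e) : Integrable (h x y e) (ν e) :=
  integrable_of_abs_le _ (H.meas x y e) L (H.entry_le x y e)

/-- A rectangle sum is again a sum of independent centred contributions bounded by `L`, and their
absolute moments add up to at most `v |S| |T|`. The Bennett-type bound is applied to it and to its
negative. -/
theorem rect_tail (H : IsNoise ν h L v) (hL : 0 ≤ L) (S T : Finset ι) {θ lam : ℝ} (hθ : 0 ≤ θ) :
    (Measure.pi ν).real {ω | lam ≤ |∑ x ∈ S, ∑ y ∈ T, randMat h ω x y|} ≤
      2 * Real.exp (-θ * lam + θ ^ 2 * L * Real.exp (θ * L) * (v * (S.card * T.card))) := by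
  set g : E → X → ℝ := fun e z => ∑ x ∈ S, ∑ y ∈ T, h x y e z with hgdef
  have hg : ∀ e, Measurable (g e) := fun e =>
    Finset.measurable_sum _ fun x _ => Finset.measurable_sum _ fun y _ => H.meas x y e
  have habs : ∀ e z, |g e z| ≤ ∑ x ∈ S, ∑ y ∈ T, |h x y e z| := fun e z =>
    (abs_sum_le_sum_abs _ _).trans (sum_le_sum fun x _ => abs_sum_le_sum_abs _ _)
  have hb : ∀ e z, |g e z| ≤ L := fun e z => by
    refine (habs e z).trans (le_trans ?_ (H.bound e z))
    refine (sum_le_sum fun x _ => sum_le_sum_of_subset_of_nonneg (subset_univ T)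
      fun _ _ _ => abs_nonneg _).trans ?_
    exact sum_le_sum_of_subset_of_nonneg (subset_univ S)
      fun _ _ _ => sum_nonneg fun _ _ => abs_nonneg _
  have hm : ∀ e, ∫ z, g e z ∂(ν e) = 0 := fun e => by
    simp only [hgdef]
    rw [integral_finsetSum _ fun x _ => integrable_finsetSum _ fun y _ => H.integrable x y e]
    refine sum_eq_zero fun x _ => ?_
    rw [integral_finsetSum _ fun y _ => H.integrable x y e]
    exact sum_eq_zero fun y _ => H.mean x y e
  have hv : ∑ e, ∫ z, |g e z| ∂(ν e) ≤ v * (S.card * T.card) := by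
    calc ∑ e, ∫ z, |g e z| ∂(ν e)
        ≤ ∑ e, ∑ x ∈ S, ∑ y ∈ T, ∫ z, |h x y e z| ∂(ν e) := by
          refine sum_le_sum fun e _ => ?_
          have : ∑ x ∈ S, ∑ y ∈ T, ∫ z, |h x y e z| ∂(ν e) =
              ∫ z, ∑ x ∈ S, ∑ y ∈ T, |h x y e z| ∂(ν e) := by
            rw [integral_finsetSum _ fun x _ =>
              integrable_finsetSum _ fun y _ => (H.integrable x y e).abs]
            refine sum_congr rfl fun x _ => ?_
            rw [integral_finsetSum _ fun y _ => (H.integrable x y e).abs]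
          rw [this]
          refine integral_mono_of_nonneg (ae_of_all _ fun z => abs_nonneg _)
            (integrable_finsetSum _ fun x _ =>
              integrable_finsetSum _ fun y _ => (H.integrable x y e).abs)
            (ae_of_all _ fun z => habs e z)
      _ = ∑ x ∈ S, ∑ y ∈ T, ∑ e, ∫ z, |h x y e z| ∂(ν e) := by
          rw [sum_comm]
          exact sum_congr rfl fun x _ => sum_comm
      _ ≤ ∑ x ∈ S, ∑ y ∈ T, v := sum_le_sum fun x _ => sum_le_sum fun y _ => H.abs_le x y
      _ = v * (S.card * T.card) := by simp; ring
  have hsum : ∀ ω : E → X, ∑ x ∈ S, ∑ y ∈ T, randMat h ω x y = ∑ e, g e (ω e) := by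
    intro ω
    simp only [randMat, Matrix.of_apply, hgdef]
    rw [sum_congr rfl fun x _ => sum_comm, sum_comm]
  have hκ : 0 ≤ θ ^ 2 * L * Real.exp (θ * L) := by positivity
  have t1 := measureReal_centered_sum_ge_le ν g L hg hb hm (lam := lam) hθ
  have t2 := measureReal_centered_sum_ge_le ν (fun e z => -g e z) L (fun e => (hg e).neg)
    (fun e z => by rw [abs_neg]; exact hb e z)
    (fun e => by rw [integral_neg, hm e, neg_zero]) (lam := lam) hθ
  simp only [abs_neg] at t2
  have hsub : {ω | lam ≤ |∑ x ∈ S, ∑ y ∈ T, randMat h ω x y|} ⊆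
      {ω | lam ≤ ∑ e, g e (ω e)} ∪ {ω | lam ≤ ∑ e, -g e (ω e)} := by
    intro ω hω
    simp only [Set.mem_ofPred_eq, hsum] at hω
    rcases le_abs'.1 hω with h1 | h1
    · right
      simp only [Set.mem_ofPred_eq, sum_neg_distrib]
      linarith
    · left; exact h1
  have hexp := Real.exp_le_exp.2
    (add_le_add_right (mul_le_mul_of_nonneg_left hv hκ) (-θ * lam))
  calc _ ≤ _ := measureReal_mono hsub
    _ ≤ _ := measureReal_union_le _ _
    _ ≤ _ := by linarith

/-- The absolute values destroy the centring, but the row sum is dominated by independent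
nonnegative contributions with total mean at most `|ι| v`. -/
theorem row_tail (H : IsNoise ν h L v) (x : ι) (lam : ℝ) :
    (Measure.pi ν).real {ω | lam ≤ ∑ y, |randMat h ω x y|} ≤
      Real.exp (-lam + Real.exp L * (Fintype.card ι * v)) := by
  set g : E → X → ℝ := fun e z => ∑ y, |h x y e z| with hgdef
  have hg : ∀ e, Measurable (g e) := fun e =>
    Finset.measurable_sum _ fun y _ => (H.meas x y e).abs
  have hb : ∀ e z, g e z ≤ L := fun e z =>
    (single_le_sum (f := fun x => ∑ y, |h x y e z|)
      (fun _ _ => sum_nonneg fun _ _ => abs_nonneg _) (mem_univ x)).trans (H.bound e z)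
  have hv : ∑ e, ∫ z, g e z ∂(ν e) ≤ Fintype.card ι * v := by
    calc ∑ e, ∫ z, g e z ∂(ν e) = ∑ y, ∑ e, ∫ z, |h x y e z| ∂(ν e) := by
          rw [sum_comm]
          refine sum_congr rfl fun e _ => ?_
          rw [← integral_finsetSum _ fun y _ => (H.integrable x y e).abs]
      _ ≤ ∑ y : ι, v := sum_le_sum fun y _ => H.abs_le x y
      _ = Fintype.card ι * v := by simp
  have t := measureReal_nonneg_sum_ge_le ν g L hg (fun e z => sum_nonneg fun _ _ => abs_nonneg _)
    hb lam
  refine (measureReal_mono ?_).trans (t.trans ?_)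
  · intro ω hω
    rw [Set.mem_ofPred_eq] at hω ⊢
    refine hω.trans ?_
    simp only [randMat, Matrix.of_apply, hgdef]
    rw [sum_comm]
    exact sum_le_sum fun y _ => abs_sum_le_sum_abs _ _
  · exact Real.exp_le_exp.2 (add_le_add_right (mul_le_mul_of_nonneg_left hv (Real.exp_pos _).le) _)

end IsNoise

/-- Choice of the exponential parameter: for small sets the Chernoff exponent beats the number of
sets of that size, for large sets it beats the number of all sets. -/
theorem exists_chernoff_parameter (η L B d : ℝ) (hη : 0 < η) (hL : 0 < L) (hB : 0 < B)
    (hd : 0 < d) : ∃ c : ℝ, 0 < c ∧ ∀ n l w : ℝ, 0 < n → 0 ≤ l → 0 ≤ w → w ≤ d * n →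
      ∃ θ : ℝ, 0 ≤ θ ∧
        (-θ * (η * l * w) + θ ^ 2 * L * Real.exp (θ * L) * (B * l / n * w ^ 2) ≤ -(6 * w * l) ∨
         -θ * (η * l * w) + θ ^ 2 * L * Real.exp (θ * L) * (B * l / n * w ^ 2) ≤ -(c * n * l)) := by
  -- For `w ≤ n / M` the exponent `θ₁` makes the linear term `-7 w l` and the quadratic term at most
  -- `w l`.
  set θ₁ := 7 / η with hθ₁
  set M := θ₁ ^ 2 * L * Real.exp (θ₁ * L) * B with hM
  -- For larger `w` the exponent `θ₂` keeps the quadratic term below half of the linear one; the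
  -- other half is at least `c n l` because `w > n / M`.
  set θ₂ := min 1 (η / (2 * (L * Real.exp L * B * d))) with hθ₂
  have h1 : 0 < θ₁ := by positivity
  have hM0 : 0 < M := by positivity
  have h2 : 0 < θ₂ := lt_min one_pos (by positivity)
  refine ⟨θ₂ * η / (2 * M), by positivity, fun n l w hn hl hw hwd => ?_⟩
  rcases le_or_gt w (n / M) with h | h
  · refine ⟨θ₁, h1.le, Or.inl ?_⟩
    have e1 : θ₁ * η = 7 := by rw [hθ₁]; field_simp
    have e2 : θ₁ ^ 2 * L * Real.exp (θ₁ * L) * (B * l / n * w ^ 2) = M * w / n * (w * l) := by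
      rw [hM]; field_simp
    have e3 : M * w / n ≤ 1 := by
      rw [div_le_one hn]
      rw [le_div_iff₀ hM0] at h
      linarith
    have e4 := mul_le_mul_of_nonneg_right e3 (mul_nonneg hw hl)
    have e5 : -θ₁ * (η * l * w) = -7 * (w * l) := by rw [← e1]; ring
    rw [e2, e5]
    linarith
  · refine ⟨θ₂, h2.le, Or.inr ?_⟩
    have e1 : θ₂ * (L * Real.exp (θ₂ * L) * B * d) ≤ η / 2 := by
      have a1 : θ₂ ≤ η / (2 * (L * Real.exp L * B * d)) := min_le_right _ _
      have a2 : θ₂ ≤ 1 := min_le_left _ _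
      have a3 : Real.exp (θ₂ * L) ≤ Real.exp L := by
        apply Real.exp_le_exp.2
        nlinarith
      have a4 : L * Real.exp (θ₂ * L) * B * d ≤ L * Real.exp L * B * d := by gcongr
      calc θ₂ * (L * Real.exp (θ₂ * L) * B * d)
          ≤ η / (2 * (L * Real.exp L * B * d)) * (L * Real.exp L * B * d) :=
            mul_le_mul a1 a4 (by positivity) (by positivity)
        _ = η / 2 := by field_simp
    have e2 : θ₂ ^ 2 * L * Real.exp (θ₂ * L) * (B * l / n * w ^ 2) ≤
        θ₂ * (η / 2) * (l * w) := by
      have : θ₂ ^ 2 * L * Real.exp (θ₂ * L) * (B * l / n * w ^ 2) =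
          θ₂ * (θ₂ * (L * Real.exp (θ₂ * L) * B) * (w / n)) * (l * w) := by field_simp
      rw [this]
      have hwn : w / n ≤ d := by rw [div_le_iff₀ hn]; exact hwd
      have : θ₂ * (L * Real.exp (θ₂ * L) * B) * (w / n) ≤ η / 2 := by
        refine le_trans ?_ e1
        have := mul_le_mul_of_nonneg_left hwn
          (by positivity : 0 ≤ θ₂ * (L * Real.exp (θ₂ * L) * B))
        linarith
      gcongr
    have e3 : θ₂ * η / (2 * M) * n * l ≤ θ₂ * (η / 2) * (l * w) := by
      have : θ₂ * η / (2 * M) * n * l = θ₂ * (η / 2) * (l * (n / M)) := by field_simp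
      rw [this]
      gcongr
    linarith

/-- By the binomial theorem the sum is `(1 + z) ^ |ι| - 1`, hence at most `exp (|ι| z) - 1`. This
evaluates the union bound over all nonempty sets, each with weight `z` per element. -/
theorem sum_pow_card_nonempty_le [DecidableEq ι] (z : ℝ) (hz : 0 ≤ z)
    (h1 : Fintype.card ι * z ≤ 1) :
    ∑ S : Finset ι, (if S.Nonempty then z ^ S.card else 0) ≤ 2 * (Fintype.card ι * z) := by
  have e : ∑ S : Finset ι, z ^ S.card = (1 + z) ^ Fintype.card ι := by
    have := Fintype.sum_pow_mul_eq_add_pow ι z (1 : ℝ)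
    simpa [add_comm] using this
  have e2 : ∑ S : Finset ι, (if S.Nonempty then z ^ S.card else 0) =
      ∑ S : Finset ι, z ^ S.card - 1 := by
    rw [eq_sub_iff_add_eq, ← add_sum_erase _ _ (mem_univ (∅ : Finset ι)),
      ← add_sum_erase (univ : Finset (Finset ι)) (fun S => z ^ S.card) (mem_univ (∅ : Finset ι))]
    have : ∑ S ∈ (univ : Finset (Finset ι)).erase ∅, (if S.Nonempty then z ^ S.card else 0) =
        ∑ S ∈ (univ : Finset (Finset ι)).erase ∅, z ^ S.card := by
      refine sum_congr rfl fun S hS => ?_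
      rw [if_pos (nonempty_iff_ne_empty.2 (mem_erase.1 hS).1)]
    rw [this]
    simp [add_comm]
  rw [e2, e]
  set a := (Fintype.card ι : ℝ) * z
  have ha : 0 ≤ a := by positivity
  have h3 : (1 + z) ^ Fintype.card ι ≤ Real.exp a := by
    have : (1 + z) ^ Fintype.card ι ≤ Real.exp z ^ Fintype.card ι :=
      pow_le_pow_left₀ (by linarith) (by linarith [Real.add_one_le_exp z]) _
    rwa [← Real.exp_nat_mul] at this
  have h4 := Real.abs_exp_sub_one_le (x := a) (by rw [abs_of_nonneg ha]; exact h1)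
  rw [abs_of_nonneg ha] at h4
  linarith [le_abs_self (Real.exp a - 1)]

end NoiseMatrix

end SGBM

namespace SGBM

open MeasureTheory ProbabilityTheory Finset

section NoiseMatrix

variable {ι E X : Type*} [Fintype ι] [DecidableEq ι] [Fintype E] [MeasurableSpace X]
  {ν : E → Measure X} [∀ e, IsProbabilityMeasure (ν e)] {h : ι → ι → E → X → ℝ} {L v : ℝ}

/-- Tail bound for the discrepancy of one rectangle of bounded aspect ratio. -/
theorem IsNoise.rect_tail_le (H : IsNoise ν h L v) {η r B d c n l : ℝ} (hL : 0 < L) (hη : 0 < η)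
    (hr : 1 ≤ r) (hB : 0 < B) (hn : 0 < n) (hl : 0 ≤ l) (hv : v ≤ B * l / n)
    (hc : ∀ n l w : ℝ, 0 < n → 0 ≤ l → 0 ≤ w → w ≤ d * n → ∃ θ : ℝ, 0 ≤ θ ∧
        (-θ * (η / r * l * w) + θ ^ 2 * L * Real.exp (θ * L) * (B * l / n * w ^ 2) ≤
            -(6 * w * l) ∨
         -θ * (η / r * l * w) + θ ^ 2 * L * Real.exp (θ * L) * (B * l / n * w ^ 2) ≤
            -(c * n * l)))
    (hcard : (Fintype.card ι : ℝ) ≤ d * n) (S T : Finset ι)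
    (h1 : (T.card : ℝ) ≤ r ^ 2 * S.card) (h2 : (S.card : ℝ) ≤ r ^ 2 * T.card) :
    (Measure.pi ν).real
        {ω | η * l * Real.sqrt (S.card * T.card) ≤ |∑ x ∈ S, ∑ y ∈ T, randMat h ω x y|} ≤
      2 * (Real.exp (-(3 * l)) ^ S.card * Real.exp (-(3 * l)) ^ T.card +
        Real.exp (-(c * n * l))) := by
  set s : ℝ := (S.card : ℝ) with hs
  set t : ℝ := (T.card : ℝ) with ht
  have hs0 : 0 ≤ s := by positivity
  have ht0 : 0 ≤ t := by positivity
  have hsd : s ≤ d * n := le_trans (by rw [hs]; exact_mod_cast card_le_univ S) hcard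
  have htd : t ≤ d * n := le_trans (by rw [ht]; exact_mod_cast card_le_univ T) hcard
  set w := max s t with hw
  have hw0 : 0 ≤ w := le_max_of_le_left hs0
  obtain ⟨θ, hθ, hor⟩ := hc n l w hn hl hw0 (max_le hsd htd)
  have hsw : s ≤ w := le_max_left _ _
  have htw : t ≤ w := le_max_right _ _
  have hst : s * t ≤ w ^ 2 := by rw [pow_two]; exact mul_le_mul hsw htw ht0 hw0
  -- Bounded aspect ratio makes the larger side comparable to the geometric mean. This is why the
  -- Chernoff parameter was prepared for `η / r`.
  have hwr : w / r ≤ Real.sqrt (s * t) := by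
    apply Real.le_sqrt_of_sq_le
    rw [div_pow, div_le_iff₀ (by positivity)]
    rcases le_total s t with h | h
    · rw [hw, max_eq_right h]; nlinarith
    · rw [hw, max_eq_left h]; nlinarith
  have tail := H.rect_tail hL.le S T hθ (lam := η * l * Real.sqrt (s * t))
  refine tail.trans ?_
  have e1 : -θ * (η * l * Real.sqrt (s * t)) ≤ -θ * (η / r * l * w) := by
    have : η / r * l * w = η * l * (w / r) := by field_simp
    rw [this]
    have := mul_le_mul_of_nonneg_left hwr (mul_nonneg hθ (mul_nonneg hη.le hl))
    linarith
  have hBl : 0 ≤ B * l / n := by positivity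
  have e2 : θ ^ 2 * L * Real.exp (θ * L) * (v * (s * t)) ≤
      θ ^ 2 * L * Real.exp (θ * L) * (B * l / n * w ^ 2) := by
    refine mul_le_mul_of_nonneg_left ?_ (by positivity)
    exact mul_le_mul hv hst (by positivity) hBl
  refine mul_le_mul_of_nonneg_left ?_ (by norm_num)
  rcases hor with h | h
  -- The exponent `6 w l` is shared between the two sides, since `s + t ≤ 2 w`.
  · have e3 : -θ * (η * l * Real.sqrt (s * t)) + θ ^ 2 * L * Real.exp (θ * L) * (v * (s * t)) ≤
        -(3 * l) * s + -(3 * l) * t := by nlinarith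
    refine (Real.exp_le_exp.2 e3).trans ?_
    · rw [Real.exp_add, mul_comm (-(3 * l)) s, mul_comm (-(3 * l)) t, hs, ht, Real.exp_nat_mul,
        Real.exp_nat_mul]
      linarith [Real.exp_pos (-(c * n * l))]
  · refine le_trans (Real.exp_le_exp.2 (by linarith : _ ≤ -(c * n * l))) ?_
    have : 0 ≤ Real.exp (-(3 * l)) ^ S.card * Real.exp (-(3 * l)) ^ T.card := by positivity
    linarith

/-- Union bound over all rows and all rectangles of bounded aspect ratio. The Chernoff exponent
either gives a factor `n⁻³` per element of `S` and of `T`, which is summable over all pairs, or is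
of order `n log n` and beats the `4 ^ |ι|` pairs. -/
theorem IsNoise.bad_event_le (H : IsNoise ν h L v) {η r D B d c n l : ℝ} (hL : 0 < L) (hη : 0 < η)
    (hr : 1 ≤ r) (hB : 0 < B) (hd : 0 < d) (hn : 1 ≤ n) (hnl : l = Real.log n)
    (hv : v ≤ B * l / n)
    (hD : Real.exp L * d * B + 3 ≤ D)
    (hc : ∀ n l w : ℝ, 0 < n → 0 ≤ l → 0 ≤ w → w ≤ d * n → ∃ θ : ℝ, 0 ≤ θ ∧
        (-θ * (η / r * l * w) + θ ^ 2 * L * Real.exp (θ * L) * (B * l / n * w ^ 2) ≤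
            -(6 * w * l) ∨
         -θ * (η / r * l * w) + θ ^ 2 * L * Real.exp (θ * L) * (B * l / n * w ^ 2) ≤
            -(c * n * l)))
    (hcl : d * Real.log 4 + 1 ≤ c * l) (hnd : d + 8 * d ^ 2 + 4 ≤ n)
    (hcard : (Fintype.card ι : ℝ) ≤ d * n) :
    (Measure.pi ν).real {ω | (∃ x, D * l ≤ ∑ y, |randMat h ω x y|) ∨ ∃ S T : Finset ι,
        S.Nonempty ∧ T.Nonempty ∧ (T.card : ℝ) ≤ r ^ 2 * S.card ∧ (S.card : ℝ) ≤ r ^ 2 * T.card ∧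
        η * l * Real.sqrt (S.card * T.card) ≤ |∑ x ∈ S, ∑ y ∈ T, randMat h ω x y|} ≤ 1 / n := by
  classical
  have hn0 : 0 < n := by linarith
  have hl : 0 ≤ l := by rw [hnl]; exact Real.log_nonneg hn
  have hexpl : Real.exp l = n := by rw [hnl, Real.exp_log hn0]
  set P := Measure.pi ν
  set Pairs : Finset (Finset ι × Finset ι) := univ.filter fun p =>
    p.1.Nonempty ∧ p.2.Nonempty ∧ (p.2.card : ℝ) ≤ r ^ 2 * p.1.card ∧
      (p.1.card : ℝ) ≤ r ^ 2 * p.2.card with hPairs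
  have hrow : P.real (⋃ x ∈ (univ : Finset ι), {ω | D * l ≤ ∑ y, |randMat h ω x y|}) ≤ d / n ^ 2 := by
    refine (measureReal_biUnion_finset_le _ _).trans ?_
    have : ∀ x ∈ (univ : Finset ι), P.real {ω | D * l ≤ ∑ y, |randMat h ω x y|} ≤ 1 / n ^ 3 := by
      intro x _
      refine (H.row_tail x (D * l)).trans ?_
      have e1 : Fintype.card ι * v ≤ d * n * (B * l / n) :=
        (mul_le_mul_of_nonneg_left hv (by positivity)).trans
          (mul_le_mul_of_nonneg_right hcard (by positivity))
      have e2 : d * n * (B * l / n) = d * B * l := by field_simp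
      -- The summand `3` in the bound for `D` leaves `exp (-3 l) = n⁻³` per row, against at most `d
      -- n` rows.
      have e3 : -(D * l) + Real.exp L * (Fintype.card ι * v) ≤ -((3 : ℕ) * l) := by
        have := mul_le_mul_of_nonneg_left (e1.trans e2.le) (Real.exp_pos L).le
        have := mul_le_mul_of_nonneg_right hD hl
        push_cast
        linarith
      refine (Real.exp_le_exp.2 e3).trans (le_of_eq ?_)
      rw [Real.exp_neg, Real.exp_nat_mul, hexpl, one_div]
    refine (sum_le_sum this).trans ?_
    rw [sum_const, nsmul_eq_mul, card_univ]
    calc (Fintype.card ι : ℝ) * (1 / n ^ 3) ≤ d * n * (1 / n ^ 3) := by gcongr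
      _ = d / n ^ 2 := by field_simp
  set z := Real.exp (-(3 * l)) with hz
  have hz0 : 0 ≤ z := (Real.exp_pos _).le
  have hzn : z = 1 / n ^ 3 := by
    have : -(3 * l) = -((3 : ℕ) * l) := by push_cast; ring
    rw [hz, this, Real.exp_neg, Real.exp_nat_mul, hexpl, one_div]
  have hcz : (Fintype.card ι : ℝ) * z ≤ d / n ^ 2 := by
    rw [hzn]
    calc (Fintype.card ι : ℝ) * (1 / n ^ 3) ≤ d * n * (1 / n ^ 3) := by gcongr
      _ = d / n ^ 2 := by field_simp
  have hdn : d / n ^ 2 ≤ 1 := by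
    rw [div_le_one (by positivity)]
    nlinarith
  set W := Real.exp (-(c * n * l)) with hW
  have hrect : P.real (⋃ p ∈ Pairs, {ω | η * l * Real.sqrt (p.1.card * p.2.card) ≤
      |∑ x ∈ p.1, ∑ y ∈ p.2, randMat h ω x y|}) ≤ (8 * d ^ 2 + 4) / n ^ 2 := by
    refine (measureReal_biUnion_finset_le _ _).trans ?_
    have b1 : ∀ p ∈ Pairs, P.real {ω | η * l * Real.sqrt (p.1.card * p.2.card) ≤
        |∑ x ∈ p.1, ∑ y ∈ p.2, randMat h ω x y|} ≤
        2 * ((if p.1.Nonempty then z ^ p.1.card else 0) *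
          (if p.2.Nonempty then z ^ p.2.card else 0) + W) := by
      intro p hp
      simp only [hPairs, mem_filter, mem_univ, true_and] at hp
      rw [if_pos hp.1, if_pos hp.2.1]
      exact H.rect_tail_le hL hη hr hB hn0 hl hv hc hcard p.1 p.2 hp.2.2.1 hp.2.2.2
    refine (sum_le_sum b1).trans ?_
    have b2 : ∑ p ∈ Pairs, 2 * ((if p.1.Nonempty then z ^ p.1.card else 0) *
          (if p.2.Nonempty then z ^ p.2.card else 0) + W) ≤
        ∑ p : Finset ι × Finset ι, 2 * ((if p.1.Nonempty then z ^ p.1.card else 0) *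
          (if p.2.Nonempty then z ^ p.2.card else 0) + W) := by
      refine sum_le_sum_of_subset_of_nonneg (filter_subset _ _) fun p _ _ => ?_
      have : 0 ≤ W := (Real.exp_pos _).le
      have : 0 ≤ (if p.1.Nonempty then z ^ p.1.card else 0) := by split_ifs <;> positivity
      have : 0 ≤ (if p.2.Nonempty then z ^ p.2.card else 0) := by split_ifs <;> positivity
      positivity
    refine b2.trans ?_
    have b3 := sum_pow_card_nonempty_le (ι := ι) z hz0 (hcz.trans hdn)
    set Q := ∑ S : Finset ι, (if S.Nonempty then z ^ S.card else 0) with hQ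
    have hQ0 : 0 ≤ Q := sum_nonneg fun S _ => by split_ifs <;> positivity
    have b4 : ∑ p : Finset ι × Finset ι, 2 * ((if p.1.Nonempty then z ^ p.1.card else 0) *
          (if p.2.Nonempty then z ^ p.2.card else 0) + W) =
        2 * (Q * Q + 4 ^ Fintype.card ι * W) := by
      rw [← mul_sum, sum_add_distrib, sum_const, nsmul_eq_mul, hQ, sum_mul_sum,
        ← univ_product_univ, sum_product]
      simp only [card_product, card_univ, Fintype.card_finset]
      congr 2
      rw [← mul_pow]
      norm_num
    rw [b4]
    -- The condition `d log 4 + 1 ≤ c l` turns the number of pairs times `W` into at most `exp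
    -- (-n)`.
    have b5 : (4 : ℝ) ^ Fintype.card ι * W ≤ 2 / n ^ 2 := by
      have a1 : (4 : ℝ) ^ Fintype.card ι ≤ Real.exp (d * n * Real.log 4) := by
        calc (4 : ℝ) ^ Fintype.card ι = Real.exp (Fintype.card ι * Real.log 4) := by
              rw [Real.exp_nat_mul, Real.exp_log (by norm_num)]
          _ ≤ _ := Real.exp_le_exp.2
              (mul_le_mul_of_nonneg_right hcard (Real.log_nonneg (by norm_num)))
      calc (4 : ℝ) ^ Fintype.card ι * W ≤ Real.exp (d * n * Real.log 4) * W :=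
            mul_le_mul_of_nonneg_right a1 (Real.exp_pos _).le
        _ = Real.exp (d * n * Real.log 4 - c * n * l) := by
            rw [hW, ← Real.exp_add]; ring_nf
        _ ≤ Real.exp (-n) := by
            apply Real.exp_le_exp.2
            have := mul_le_mul_of_nonneg_left hcl hn0.le
            linarith
        _ ≤ 2 / n ^ 2 := by
            rw [Real.exp_neg, ← one_div]
            have := Real.quadratic_le_exp_of_nonneg hn0.le
            rw [div_le_div_iff₀ (Real.exp_pos n) (by positivity)]
            linarith
    have b6 : Q ≤ 2 * (d / n ^ 2) := b3.trans (by linarith)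
    have b7 : Q * Q ≤ 4 * d ^ 2 / n ^ 2 := by
      calc Q * Q ≤ (2 * (d / n ^ 2)) * (2 * (d / n ^ 2)) := mul_le_mul b6 b6 hQ0 (by positivity)
        _ = 4 * d ^ 2 / n ^ 2 * (1 / n ^ 2) := by field_simp; ring
        _ ≤ 4 * d ^ 2 / n ^ 2 * 1 := by
            refine mul_le_mul_of_nonneg_left ?_ (by positivity)
            rw [div_le_one (by positivity)]
            nlinarith
        _ = _ := mul_one _
    have b8 : (8 * d ^ 2 + 4) / n ^ 2 = 2 * (4 * d ^ 2 / n ^ 2 + 2 / n ^ 2) := by ring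
    rw [b8]
    linarith
  have hsub : {ω | (∃ x, D * l ≤ ∑ y, |randMat h ω x y|) ∨ ∃ S T : Finset ι,
        S.Nonempty ∧ T.Nonempty ∧ (T.card : ℝ) ≤ r ^ 2 * S.card ∧ (S.card : ℝ) ≤ r ^ 2 * T.card ∧
        η * l * Real.sqrt (S.card * T.card) ≤ |∑ x ∈ S, ∑ y ∈ T, randMat h ω x y|} ⊆
      (⋃ x ∈ (univ : Finset ι), {ω | D * l ≤ ∑ y, |randMat h ω x y|}) ∪
      (⋃ p ∈ Pairs, {ω | η * l * Real.sqrt (p.1.card * p.2.card) ≤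
        |∑ x ∈ p.1, ∑ y ∈ p.2, randMat h ω x y|}) := by
    rintro ω (⟨x, hx⟩ | ⟨S, T, h1, h2, h3, h4, h5⟩)
    · left
      exact Set.mem_biUnion (mem_univ x) hx
    · right
      refine Set.mem_biUnion (x := (S, T)) ?_ h5
      simp [hPairs, h1, h2, h3, h4]
  refine (measureReal_mono hsub).trans ((measureReal_union_le _ _).trans ?_)
  refine (add_le_add hrow hrect).trans ?_
  rw [← add_div, div_le_div_iff₀ (by positivity) hn0, one_mul]
  have : d + (8 * d ^ 2 + 4) ≤ n := by linarith
  nlinarith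

end NoiseMatrix

/-- The quadratic form of a sparse noise matrix is `o(log n)` with high probability. -/
theorem exists_quadForm_noise_le (d B L ε : ℝ) (hd : 0 < d) (hB : 0 < B) (hL : 0 < L)
    (hε : 0 < ε) : ∃ N : ℕ, ∀ n : ℕ, N ≤ n → ∀ (ι E X : Type) [Fintype ι] [Fintype E]
      [MeasurableSpace X] (ν : E → Measure X) [∀ e, IsProbabilityMeasure (ν e)]
      (h : ι → ι → E → X → ℝ) (v : ℝ), IsNoise ν h L v → (Fintype.card ι : ℝ) ≤ d * n →
      v ≤ B * Real.log n / n →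
      (Measure.pi ν).real {ω | ¬ ∀ u : ι → ℝ,
        |bil (randMat h ω) u u| ≤ ε * Real.log n * ∑ x, u x ^ 2} ≤ 1 / n := by
  classical
  set D := Real.exp L * d * B + 3 with hD
  have hD0 : 0 < D := by positivity
  -- The final bound is `4 (η (2 γ + 1) / 2 + D / 2 ^ γ) log n`. First `γ` makes the off-diagonal
  -- part at most `ε / 2`, then `η` makes the near-diagonal part equal to `ε / 2`.
  obtain ⟨γ, hγ⟩ := pow_unbounded_of_one_lt (8 * D / ε) (one_lt_two : (1 : ℝ) < 2)
  set η := ε / (4 * (2 * γ + 1)) with hη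
  have hη0 : 0 < η := by positivity
  set r := D / η + 1 with hr
  have hr1 : 1 ≤ r := by rw [hr]; linarith [div_pos hD0 hη0]
  obtain ⟨c, hc0, hc⟩ := exists_chernoff_parameter (η / r) L B d (by positivity) hL hB hd
  obtain ⟨N, hN⟩ : ∃ N : ℕ, ∀ n : ℕ, N ≤ n → 1 ≤ (n : ℝ) ∧
      d * Real.log 4 + 1 ≤ c * Real.log n ∧ d + 8 * d ^ 2 + 4 ≤ (n : ℝ) := by
    have t1 := tendsto_natCast_atTop_atTop (R := ℝ)
    have t2 := (Real.tendsto_log_atTop.comp t1).const_mul_atTop hc0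
    have := (t1.eventually_ge_atTop 1).and
      ((t2.eventually_ge_atTop (d * Real.log 4 + 1)).and (t1.eventually_ge_atTop (d + 8 * d ^ 2 + 4)))
    exact Filter.eventually_atTop.1 this
  refine ⟨N, fun n hn ι E X _ _ _ ν _ h v H hcard hv => ?_⟩
  obtain ⟨n1, n2, n3⟩ := hN n hn
  set l := Real.log n with hl
  have hl0 : 0 ≤ l := Real.log_nonneg n1
  refine (measureReal_mono ?_).trans (H.bad_event_le hL hη0 hr1 hB hd n1 hl hv hD.ge hc n2 n3 hcard)
  intro ω hω
  by_contra hcon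
  apply hω
  simp only [Set.mem_ofPred_eq, not_or, not_exists, not_le, not_and] at hcon
  obtain ⟨hrow, hrect⟩ := hcon
  have hsymm : ∀ x y, randMat h ω x y = randMat h ω y x := fun x y => by
    simp only [randMat, Matrix.of_apply]
    exact sum_congr rfl fun e _ => H.symm x y e _
  have b2 : ∀ S T : Finset ι, |∑ x ∈ S, ∑ y ∈ T, randMat h ω x y| ≤ D * l * S.card := by
    intro S T
    refine (abs_sum_le_sum_abs _ _).trans ?_
    have : ∀ x ∈ S, |∑ y ∈ T, randMat h ω x y| ≤ D * l := fun x _ =>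
      (abs_sum_le_sum_abs _ _).trans ((sum_le_sum_of_subset_of_nonneg (subset_univ T)
        fun _ _ _ => abs_nonneg _).trans (hrow x).le)
    refine (sum_le_sum this).trans (le_of_eq ?_)
    simp; ring
  have b3 : ∀ S T : Finset ι, |∑ x ∈ S, ∑ y ∈ T, randMat h ω x y| ≤ D * l * T.card := by
    intro S T
    have e : ∑ x ∈ S, ∑ y ∈ T, randMat h ω x y = ∑ y ∈ T, ∑ x ∈ S, randMat h ω y x :=
      sum_comm.trans (sum_congr rfl fun y _ => sum_congr rfl fun x _ => hsymm x y)
    rw [e]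
    exact b2 T S
  -- For thin rectangles the row-sum bound already implies the discrepancy bound: `r s ≤ √(s t)`,
  -- and `r = D / η + 1` gives `D ≤ η r`.
  have key : ∀ s t : ℝ, 0 ≤ s → r ^ 2 * s < t → D * l * s ≤ η * l * Real.sqrt (s * t) := by
    intro s t hs hst
    have h1 : r * s ≤ Real.sqrt (s * t) := by
      apply Real.le_sqrt_of_sq_le
      nlinarith
    have h2 : D ≤ η * r := by
      rw [hr, mul_add, mul_div_cancel₀ _ hη0.ne']; linarith
    have h3 := mul_le_mul_of_nonneg_left h1 (mul_nonneg hη0.le hl0)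
    have h4 := mul_le_mul_of_nonneg_right h2 (mul_nonneg hl0 hs)
    linarith
  have b1 : ∀ S T : Finset ι, |∑ x ∈ S, ∑ y ∈ T, randMat h ω x y| ≤
      η * l * Real.sqrt (S.card * T.card) := by
    intro S T
    rcases S.eq_empty_or_nonempty with rfl | hS
    · simp
    rcases T.eq_empty_or_nonempty with rfl | hT
    · simp
    rcases le_or_gt (T.card : ℝ) (r ^ 2 * S.card) with h1 | h1
    · rcases le_or_gt (S.card : ℝ) (r ^ 2 * T.card) with h2 | h2
      · exact (hrect S T hS hT h1 h2).le
      · refine (b3 S T).trans ?_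
        rw [mul_comm (S.card : ℝ)]
        exact key _ _ (by positivity) h2
    · exact (b2 S T).trans (key _ _ (by positivity) h1)
  intro u
  have hq := quadForm_le_of_discrepancy (randMat h ω) (η * l) (D * l) γ (by positivity)
    (by positivity) b1 b2 b3 u
  refine hq.trans (mul_le_mul_of_nonneg_right ?_ (sum_nonneg fun _ _ => sq_nonneg _))
  have e1 : 4 * (η * l * (2 * γ + 1) / 2) = ε / 2 * l := by rw [hη]; field_simp
  have e2 : D * l / 2 ^ γ ≤ ε / 8 * l := by
    have : D / 2 ^ γ ≤ ε / 8 := by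
      rw [div_le_iff₀ (by positivity)]
      rw [div_lt_iff₀ hε] at hγ
      linarith
    calc D * l / 2 ^ γ = D / 2 ^ γ * l := by ring
      _ ≤ _ := mul_le_mul_of_nonneg_right this hl0
  linarith

end SGBM

/-! ### Second moment of the noise applied to the signal basis. -/

namespace SGBM

open MeasureTheory ProbabilityTheory Finset

section SecondMoment

variable {ι E X : Type*} [Fintype ι] [Fintype E] [MeasurableSpace X]
  {ν : E → Measure X} [∀ e, IsProbabilityMeasure (ν e)] {h : ι → ι → E → X → ℝ} {L v : ℝ}

theorem measurable_randMat_apply {ι : Type*} {h : ι → ι → E → X → ℝ} (hm : ∀ x y e, Measurable (h x y e)) (x y : ι) :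
    Measurable fun ω => randMat h ω x y :=
  Finset.measurable_sum _ fun e _ => (hm x y e).comp (measurable_pi_apply e)

/-- Each coordinate of `N u` is a sum of independent centred variables, so its second moment is the
sum of theirs. One contribution is at most `b L` in absolute value and at most `b` times its row
`ℓ¹` norm; multiplying the two bounds keeps a first moment. -/
theorem IsNoise.integral_sq_le (H : IsNoise ν h L v) (hL : 0 ≤ L) (u : ι → ℝ) {b : ℝ}
    (hu : ∀ y, |u y| ≤ b) (x : ι) :
    ∫ ω, (∑ y, randMat h ω x y * u y) ^ 2 ∂(Measure.pi ν) ≤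
      L * b ^ 2 * (Fintype.card ι * v) := by
  have hb : 0 ≤ b := (abs_nonneg _).trans (hu x)
  set g : E → X → ℝ := fun e z => ∑ y, h x y e z * u y with hg
  have hsum : ∀ ω : E → X, ∑ y, randMat h ω x y * u y = ∑ e, g e (ω e) := by
    intro ω
    simp only [randMat, Matrix.of_apply, hg, sum_mul]
    exact sum_comm
  have hmeas : ∀ e, Measurable (g e) := fun e =>
    Finset.measurable_sum _ fun y _ => (H.meas x y e).mul_const _
  have habs : ∀ e z, |g e z| ≤ b * ∑ y, |h x y e z| := by
    intro e z
    refine (abs_sum_le_sum_abs _ _).trans ?_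
    rw [mul_sum]
    refine sum_le_sum fun y _ => ?_
    rw [abs_mul, mul_comm]
    exact mul_le_mul_of_nonneg_right (hu y) (abs_nonneg _)
  have hrow : ∀ e z, ∑ y, |h x y e z| ≤ L := fun e z =>
    (single_le_sum (f := fun x => ∑ y, |h x y e z|)
      (fun _ _ => sum_nonneg fun _ _ => abs_nonneg _) (mem_univ x)).trans (H.bound e z)
  have hbd : ∀ e z, |g e z| ≤ b * L := fun e z =>
    (habs e z).trans (mul_le_mul_of_nonneg_left (hrow e z) hb)
  have hmean : ∀ e, ∫ z, g e z ∂(ν e) = 0 := by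
    intro e
    simp only [hg]
    rw [integral_finsetSum _ fun y _ => (H.integrable x y e).mul_const _]
    refine sum_eq_zero fun y _ => ?_
    rw [integral_mul_const, H.mean, zero_mul]
  simp only [hsum]
  rw [integral_sq_centered_sum ν g (b * L) hmeas hbd hmean]
  calc ∑ e, ∫ z, g e z ^ 2 ∂(ν e) ≤ ∑ e, L * b ^ 2 * ∑ y, ∫ z, |h x y e z| ∂(ν e) := by
        refine sum_le_sum fun e _ => ?_
        rw [← integral_finsetSum _ fun y _ => (H.integrable x y e).abs, ← integral_const_mul]
        refine integral_mono_of_nonneg (ae_of_all _ fun z => sq_nonneg _)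
          ((integrable_finsetSum _ fun y _ => (H.integrable x y e).abs).const_mul _)
          (ae_of_all _ fun z => ?_)
        show g e z ^ 2 ≤ L * b ^ 2 * ∑ y, |h x y e z|
        rw [← sq_abs, pow_two]
        calc |g e z| * |g e z| ≤ (b * L) * (b * ∑ y, |h x y e z|) :=
              mul_le_mul (hbd e z) (habs e z) (abs_nonneg _) (by positivity)
          _ = _ := by ring
    _ = L * b ^ 2 * ∑ y, ∑ e, ∫ z, |h x y e z| ∂(ν e) := by
        rw [← mul_sum, sum_comm]
    _ ≤ L * b ^ 2 * ∑ y : ι, v :=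
        mul_le_mul_of_nonneg_left (sum_le_sum fun y _ => H.abs_le x y) (by positivity)
    _ = _ := by simp

/-- Markov's inequality for `‖N V‖²`. For a delocalized `V` with few columns this is far smaller
than the squared norm bound on `N` allows, and it determines the eigenvector error. -/
theorem IsNoise.measureReal_sq_ge_le (H : IsNoise ν h L v) (hL : 0 ≤ L) {κ : Type*} [Fintype κ]
    (V : Matrix ι κ ℝ) {b t : ℝ} (hV : ∀ y k, |V y k| ≤ b) (ht : 0 < t) :
    (Measure.pi ν).real {ω | t ≤ ∑ x, ∑ k, (randMat h ω * V) x k ^ 2} ≤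
      Fintype.card ι * (Fintype.card κ * (L * b ^ 2 * (Fintype.card ι * v))) / t := by
  rw [le_div_iff₀ ht, mul_comm]
  have hmeas : ∀ x k, Measurable fun ω => (∑ y, randMat h ω x y * V y k) ^ 2 := fun x k =>
    (Finset.measurable_sum _ fun y _ => (measurable_randMat_apply H.meas x y).mul_const _).pow_const _
  have hbd : ∀ (ω : E → X) x y, |randMat h ω x y| ≤ Fintype.card E * L := by
    intro ω x y
    refine (abs_sum_le_sum_abs _ _).trans ((sum_le_sum fun e _ => H.entry_le x y e _).trans ?_)
    simp
  have hint : ∀ x k, Integrable (fun ω => (∑ y, randMat h ω x y * V y k) ^ 2)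
      (Measure.pi ν) := by
    intro x k
    refine integrable_of_abs_le _ (hmeas x k) ((∑ y : ι, Fintype.card E * L * b) ^ 2) fun ω => ?_
    rw [abs_pow]
    refine pow_le_pow_left₀ (abs_nonneg _) ((abs_sum_le_sum_abs _ _).trans ?_) 2
    refine sum_le_sum fun y _ => ?_
    rw [abs_mul]
    exact mul_le_mul (hbd ω x y) (hV y k) (abs_nonneg _) (by positivity)
  have hm := mul_meas_ge_le_integral_of_nonneg (μ := Measure.pi ν)
    (f := fun ω => ∑ x, ∑ k, (∑ y, randMat h ω x y * V y k) ^ 2)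
    (ae_of_all _ fun ω => sum_nonneg fun x _ => sum_nonneg fun k _ => sq_nonneg _)
    (integrable_finsetSum _ fun x _ => integrable_finsetSum _ fun k _ => hint x k) t
  refine hm.trans ?_
  rw [integral_finsetSum _ fun x _ => integrable_finsetSum _ fun k _ => hint x k]
  calc _ ≤ ∑ x : ι, ∑ k : κ, L * b ^ 2 * (Fintype.card ι * v) := by
        refine sum_le_sum fun x _ => ?_
        rw [integral_finsetSum _ fun k _ => hint x k]
        exact sum_le_sum fun k _ => H.integral_sq_le hL (fun y => V y k) (fun y => hV y k) x
    _ = _ := by simp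

end SecondMoment

/-! ### Perturbation of the leading eigenvectors. -/

section DavisKahan

open Matrix

variable {ι κ : Type*} [Fintype ι] [Fintype κ]

theorem bil_eq_dotProduct (M : Matrix ι ι ℝ) (u w : ι → ℝ) : bil M u w = u ⬝ᵥ M *ᵥ w := by
  simp only [bil, dotProduct, mulVec, mul_sum]
  exact sum_congr rfl fun x _ => sum_congr rfl fun y _ => by ring

theorem sum_sq_eq_dotProduct (u : ι → ℝ) : ∑ i, u i ^ 2 = u ⬝ᵥ u := by
  simp only [dotProduct, pow_two]

theorem sum_sq_eq_trace (G : Matrix ι κ ℝ) : ∑ x, ∑ k, G x k ^ 2 = (Gᵀ * G).trace := by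
  simp only [trace, Matrix.diag, mul_apply, transpose_apply]
  rw [sum_comm]
  exact sum_congr rfl fun _ _ => sum_congr rfl fun _ _ => pow_two _

theorem sum_sq_mul_of_transpose_mul_self [DecidableEq ι] (Q : Matrix ι ι ℝ) (hQ : Qᵀ * Q = 1)
    (F : Matrix ι κ ℝ) : ∑ x, ∑ k, (Q * F) x k ^ 2 = ∑ x, ∑ k, F x k ^ 2 := by
  rw [sum_sq_eq_trace, sum_sq_eq_trace, transpose_mul, Matrix.mul_assoc, ← Matrix.mul_assoc Qᵀ, hQ, Matrix.one_mul]

/-- An eigenvector basis for the leading eigenvalues of a perturbed low-rank matrix is, up to a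
nearly orthogonal change of basis, close to the basis `V` of the signal space. -/
theorem leadingEigs_perturbation [DecidableEq ι] [DecidableEq κ] {M : Matrix ι ι ℝ}
    {U : Matrix ι κ ℝ} (hU : IsLeadingEigs M U) {V : Matrix ι κ ℝ} (hV : Vᵀ * V = 1)
    {B : Matrix κ κ ℝ} {N : Matrix ι ι ℝ} {c₀ g : ℝ} (hg : 0 < g)
    (hM : M = c₀ • (1 : Matrix ι ι ℝ) + V * B * Vᵀ + N)
    (hB : ∀ w : κ → ℝ, g * ∑ k, w k ^ 2 ≤ w ⬝ᵥ B *ᵥ w)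
    (hN : ∀ u : ι → ℝ, bil N u u ≤ g / 2 * ∑ x, u x ^ 2) :
    ∃ (X : Matrix κ κ ℝ) (e : ℝ), e ≤ 4 / g ^ 2 * ∑ x, ∑ k, (N * V) x k ^ 2 ∧
      (∀ a : κ → ℝ, (1 - e) * ∑ k, a k ^ 2 ≤ ∑ j, (∑ k, a k * X k j) ^ 2) ∧
      ∑ x, ∑ j, (U x j - (V * X) x j) ^ 2 ≤ e := by
  classical
  obtain ⟨Q, lam, f, hQ, hMQ, rfl, hsel⟩ := hU
  have hQ1 : Q * Qᵀ = 1 := (mem_orthogonalGroup_iff ι ℝ).1 hQ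
  have hQ2 : Qᵀ * Q = 1 := (mem_orthogonalGroup_iff' ι ℝ).1 hQ
  set W := Qᵀ * V with hW
  have hWW : Wᵀ * W = 1 := by
    rw [hW, transpose_mul, transpose_transpose, Matrix.mul_assoc, ← Matrix.mul_assoc Q, hQ1,
      Matrix.one_mul, hV]
  set F := Qᵀ * (N * V) with hF
  have hFsum : ∑ x, ∑ k, F x k ^ 2 = ∑ x, ∑ k, (N * V) x k ^ 2 :=
    sum_sq_mul_of_transpose_mul_self Qᵀ (by rw [transpose_transpose, hQ1]) _
  -- The identity `M V = c₀ V + V B + N V`, written in the eigenbasis of `M`.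
  have heig : diagonal lam * W = c₀ • W + W * B + F := by
    have e1 : Qᵀ * (M * V) = diagonal lam * W := by
      rw [hMQ, hW]
      simp only [Matrix.mul_assoc]
      rw [← Matrix.mul_assoc Qᵀ Q, hQ2, Matrix.one_mul]
    rw [← e1, hM, Matrix.add_mul, Matrix.add_mul, Matrix.mul_add, Matrix.mul_add, hF, hW]
    congr 2
    · rw [Matrix.smul_mul, Matrix.one_mul, Matrix.mul_smul]
    · rw [Matrix.mul_assoc, Matrix.mul_assoc, hV, Matrix.mul_one, Matrix.mul_assoc]
  -- Courant–Fischer: otherwise `|κ| + 1` eigenvectors have eigenvalue above `c₀ + g / 2`. By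
  -- dimension count some nonzero combination of them is orthogonal to all columns of `V`; on it the
  -- signal vanishes and the form of `M` is at most `c₀ + g / 2`.
  have hlam : ∀ i, i ∉ Set.range f → lam i - c₀ ≤ g / 2 := by
    intro i₀ hi₀
    by_contra hcon
    push Not at hcon
    set Fo : Option κ → ι := fun o => o.elim i₀ f with hFo
    have hFinj : Function.Injective Fo := by
      rintro (_ | a) (_ | b) hab
      · rfl
      · exact absurd ⟨b, hab.symm⟩ hi₀
      · exact absurd ⟨a, hab⟩ hi₀
      · exact congrArg some (f.injective hab)
    have hFlam : ∀ o, lam i₀ ≤ lam (Fo o) := by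
      rintro (_ | a)
      · exact le_rfl
      · exact hsel a i₀ hi₀
    obtain ⟨c, hc0, hc⟩ : ∃ c : Option κ → ℝ, c ≠ 0 ∧ (W.submatrix Fo id)ᵀ *ᵥ c = 0 := by
      have hker : LinearMap.ker (W.submatrix Fo id)ᵀ.mulVecLin ≠ ⊥ :=
        LinearMap.ker_ne_bot_of_finrank_lt (by simp)
      obtain ⟨c, hc, hc0⟩ := (Submodule.ne_bot_iff _).1 hker
      exact ⟨c, hc0, by simpa using hc⟩
    set y : ι → ℝ := Function.extend Fo c 0 with hy
    have hyF : ∀ o, y (Fo o) = c o := fun o => hFinj.extend_apply _ _ _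
    have hy0 : ∀ i, i ∉ Set.range Fo → y i = 0 := fun i hi => by
      rw [hy, Function.extend_apply' _ _ _ (fun ⟨o, ho⟩ => hi ⟨o, ho⟩)]; rfl
    have hWy : Wᵀ *ᵥ y = 0 := by
      rw [← hc]
      ext k
      simp only [mulVec, dotProduct, transpose_apply, submatrix_apply, id]
      symm
      refine Fintype.sum_of_injective Fo hFinj _ _ (fun i hi => by rw [hy0 i hi, mul_zero])
        fun o => by rw [hyF]
    set x := Q *ᵥ y with hx
    have hVx : Vᵀ *ᵥ x = 0 := by
      rw [hx, mulVec_mulVec, ← hWy, hW, transpose_mul, transpose_transpose]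
    have hxy : ∑ i, x i ^ 2 = ∑ i, y i ^ 2 := by
      rw [sum_sq_eq_dotProduct, sum_sq_eq_dotProduct, hx, dotProduct_mulVec, vecMul_mulVec, hQ2, vecMul_one]
    have hq1 : x ⬝ᵥ M *ᵥ x = ∑ i, lam i * y i ^ 2 := by
      rw [hMQ, hx, mulVec_mulVec, Matrix.mul_assoc, hQ2, Matrix.mul_one, dotProduct_mulVec,
        vecMul_mulVec, ← Matrix.mul_assoc, hQ2, Matrix.one_mul]
      simp only [dotProduct, vecMul_diagonal]
      exact sum_congr rfl fun i _ => by ring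
    have hq2 : x ⬝ᵥ M *ᵥ x ≤ (c₀ + g / 2) * ∑ i, y i ^ 2 := by
      rw [hM, add_mulVec, add_mulVec, ← mulVec_mulVec, hVx, mulVec_zero, add_zero, dotProduct_add,
        smul_mulVec, one_mulVec, dotProduct_smul, ← bil_eq_dotProduct N, ← hxy, ← sum_sq_eq_dotProduct,
        smul_eq_mul]
      have := hN x
      linarith
    have hq3 : lam i₀ * ∑ i, y i ^ 2 ≤ ∑ i, lam i * y i ^ 2 := by
      rw [mul_sum]
      refine sum_le_sum fun i _ => ?_
      by_cases hi : i ∈ Set.range Fo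
      · obtain ⟨o, rfl⟩ := hi
        exact mul_le_mul_of_nonneg_right (hFlam o) (sq_nonneg _)
      · rw [hy0 i hi]; simp
    have hpos : 0 < ∑ i, y i ^ 2 := by
      obtain ⟨o, ho⟩ := Function.ne_iff.1 hc0
      refine sum_pos' (fun i _ => sq_nonneg _) ⟨Fo o, mem_univ _, ?_⟩
      rw [hyF]
      have : c o ≠ 0 := ho
      positivity
    rw [hq1] at hq2
    nlinarith
  -- Row `i` of the eigenvector identity is paired with `W i`. The matrix `B` contributes at least
  -- `g` while `lam i - c₀ ≤ g / 2`, so `F i` must pay for the difference; Young's inequality with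
  -- weights `g / 4` and `1 / g` yields the constant.
  have hrow : ∀ i, i ∉ Set.range f → ∑ k, W i k ^ 2 ≤ 4 / g ^ 2 * ∑ k, F i k ^ 2 := by
    intro i hi
    have e1 : ∀ k, lam i * W i k = c₀ * W i k + ∑ l, W i l * B l k + F i k := by
      intro k
      have := congrFun (congrFun heig i) k
      rw [diagonal_mul] at this
      rw [this]
      simp [mul_apply]
    have e2 : (lam i - c₀) * ∑ k, W i k ^ 2 =
        (W i) ⬝ᵥ B *ᵥ (W i) + ∑ k, W i k * F i k := by
      have e3 : (W i) ⬝ᵥ B *ᵥ (W i) = ∑ k, (∑ l, W i l * B l k) * W i k := by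
        rw [dotProduct_mulVec]; rfl
      rw [e3, ← sum_add_distrib, mul_sum]
      refine sum_congr rfl fun k _ => ?_
      have := e1 k
      linear_combination (W i k) * this
    have e4 := hB (W i)
    have e5 := mul_le_mul_of_nonneg_right (hlam i hi)
      (sum_nonneg fun k (_ : k ∈ univ) => sq_nonneg (W i k))
    have e6 : -(∑ k, W i k * F i k) ≤ g / 4 * ∑ k, W i k ^ 2 + 1 / g * ∑ k, F i k ^ 2 := by
      rw [mul_sum, mul_sum, ← sum_add_distrib, ← sum_neg_distrib]
      refine sum_le_sum fun k _ => ?_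
      have : g / 4 * W i k ^ 2 + 1 / g * F i k ^ 2 + W i k * F i k =
          1 / g * (g / 2 * W i k + F i k) ^ 2 := by field_simp; ring
      have h2 : 0 ≤ 1 / g * (g / 2 * W i k + F i k) ^ 2 := by positivity
      linarith
    have e7 : g / 4 * ∑ k, W i k ^ 2 ≤ 1 / g * ∑ k, F i k ^ 2 := by linarith
    have e8 : 4 / g ^ 2 * ∑ k, F i k ^ 2 = 4 / g * (1 / g * ∑ k, F i k ^ 2) := by
      field_simp
    rw [e8]
    have e9 := mul_le_mul_of_nonneg_left e7 (by positivity : 0 ≤ 4 / g)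
    have e10 : 4 / g * (g / 4 * ∑ k, W i k ^ 2) = ∑ k, W i k ^ 2 := by field_simp
    linarith
  set sel : Finset ι := univ.filter fun i => i ∉ Set.range f with hselset
  set e := ∑ i ∈ sel, ∑ k, W i k ^ 2 with he
  have hsplit : ∀ G : ι → ℝ, ∑ i, G i = ∑ j, G (f j) + ∑ i ∈ sel, G i := by
    intro G
    rw [hselset, sum_filter]
    have : ∑ j, G (f j) = ∑ i, (if i ∈ Set.range f then G i else 0) :=
      Fintype.sum_of_injective f f.injective _ _ (fun i hi => by rw [if_neg hi])
        fun j => by rw [if_pos ⟨j, rfl⟩]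
    rw [this, ← sum_add_distrib]
    refine sum_congr rfl fun i _ => ?_
    by_cases hi : i ∈ Set.range f <;> simp [hi]
  have hX : ∀ k j, (Vᵀ * Q.submatrix id f) k j = W (f j) k := by
    intro k j
    simp only [hW, mul_apply, transpose_apply, submatrix_apply, id]
    exact sum_congr rfl fun i _ => mul_comm _ _
  refine ⟨Vᵀ * Q.submatrix id f, e, ?_, ?_, ?_⟩
  · calc e ≤ ∑ i ∈ sel, 4 / g ^ 2 * ∑ k, F i k ^ 2 :=
          sum_le_sum fun i hi => hrow i (mem_filter.1 hi).2
      _ ≤ ∑ i, 4 / g ^ 2 * ∑ k, F i k ^ 2 :=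
          sum_le_sum_of_subset_of_nonneg (subset_univ _) fun i _ _ =>
            mul_nonneg (by positivity) (sum_nonneg fun k _ => sq_nonneg _)
      _ = _ := by rw [← mul_sum, hFsum]
  · intro a
    simp only [hX]
    have e1 : ∑ i, (∑ k, a k * W i k) ^ 2 = ∑ k, a k ^ 2 := by
      have e2 : ∀ i, ∑ k, a k * W i k = (W *ᵥ a) i := fun i => by
        simp only [mulVec, dotProduct]
        exact sum_congr rfl fun k _ => mul_comm _ _
      simp only [e2]
      rw [sum_sq_eq_dotProduct, sum_sq_eq_dotProduct, dotProduct_mulVec, vecMul_mulVec, hWW, vecMul_one]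
    rw [hsplit] at e1
    have e3 : ∑ i ∈ sel, (∑ k, a k * W i k) ^ 2 ≤ e * ∑ k, a k ^ 2 := by
      rw [he, sum_mul]
      refine sum_le_sum fun i _ => ?_
      rw [mul_comm]
      exact sum_mul_sq_le_sq_mul_sq univ a (W i)
    linarith
  · set U := Q.submatrix id f with hUdef
    have hUU : Uᵀ * U = 1 := by
      have : Uᵀ * U = (Qᵀ * Q).submatrix f f := by
        rw [hUdef]; ext a b; simp [mul_apply]
      rw [this, hQ2, submatrix_one_embedding]
    have e0 : ∑ x, ∑ j, (U x j - (V * (Vᵀ * U)) x j) ^ 2 =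
        ((U - V * (Vᵀ * U))ᵀ * (U - V * (Vᵀ * U))).trace := sum_sq_eq_trace (U - V * (Vᵀ * U))
    -- With `X = Vᵀ U` the squared residual is `|κ| - ‖Vᵀ U‖²`, which is exactly the mass `e` of `W`
    -- in the rows not selected. The same mass measures how far `X` is from an isometry.
    have e1 : (U - V * (Vᵀ * U))ᵀ * (U - V * (Vᵀ * U)) = 1 - (Vᵀ * U)ᵀ * (Vᵀ * U) := by
      simp only [transpose_sub, Matrix.sub_mul, Matrix.mul_sub, transpose_mul,
        transpose_transpose, Matrix.mul_assoc, hUU]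
      rw [← Matrix.mul_assoc Vᵀ V, hV, Matrix.one_mul]
      abel
    have e2 : ((Vᵀ * U)ᵀ * (Vᵀ * U)).trace = ∑ j, ∑ k, W (f j) k ^ 2 := by
      rw [← sum_sq_eq_trace, sum_comm]
      simp only [hX]
    have e3 : (1 : Matrix κ κ ℝ).trace = ∑ i, ∑ k, W i k ^ 2 := by
      rw [← hWW, sum_sq_eq_trace]
    rw [e0, e1, trace_sub, e2, e3, hsplit]
    linarith

end DavisKahan

end SGBM

/-! ### Greedy clustering and the balanced projection. -/

namespace SGBM

open Finset

section Clustering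

theorem rowDist_eq_dist {n : ℕ} {κ : Type*} [Fintype κ] (W : Matrix (Fin n) κ ℝ) (u v : Fin n) :
    rowDist W u v = dist (WithLp.toLp 2 (W u)) (WithLp.toLp 2 (W v)) := by
  rw [EuclideanSpace.dist_eq]
  simp only [rowDist, Real.dist_eq, sq_abs]

theorem rowDist_comm {n : ℕ} {κ : Type*} [Fintype κ] (W : Matrix (Fin n) κ ℝ) (u v : Fin n) :
    rowDist W u v = rowDist W v u := by
  rw [rowDist_eq_dist, rowDist_eq_dist, dist_comm]

theorem rowDist_triangle {n : ℕ} {κ : Type*} [Fintype κ] (W : Matrix (Fin n) κ ℝ) (u v w : Fin n) :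
    rowDist W u w ≤ rowDist W u v + rowDist W v w := by
  simp only [rowDist_eq_dist]
  exact dist_triangle _ _ _

variable {n K m : ℕ}

theorem IsBalanced.card_eq {C : Fin n → Fin K} (hC : IsBalanced m C) : n = K * m := by
  have h := card_eq_sum_card_fiberwise (f := C) (s := univ) (t := univ) fun _ _ => mem_univ _
  rw [card_univ, Fintype.card_fin] at h
  rw [h, sum_congr rfl fun k _ => hC k]
  simp

/-- Greedy clustering recovers the clusters up to few errors if all but few rows are close to
the centres of well-separated true clusters. -/
theorem IsGreedyClustering.exists_perm {κ : Type*} [Fintype κ] {W : Matrix (Fin n) κ ℝ} {r : ℝ}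
    {σ : Fin n → Fin K} (hσ : IsGreedyClustering W r σ) {C : Fin n → Fin K} (hC : IsBalanced m C)
    (good : Finset (Fin n)) {b : ℕ} (hb : goodᶜ.card ≤ b) (hbm : 4 * b < m)
    (hclose : ∀ u ∈ good, ∀ v ∈ good, C u = C v → rowDist W u v < r)
    (hfar : ∀ u ∈ good, ∀ v ∈ good, C u ≠ C v → 2 * r ≤ rowDist W u v) :
    ∃ π : Equiv.Perm (Fin K), (univ.filter fun v => σ v ≠ π (C v)).card ≤ 2 * K * b := by
  classical
  obtain ⟨t, S, Chat, hS, ht, hChat, hσ1, -⟩ := hσ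
  have hball : ∀ i v, v ∈ Chat i ↔ v ∈ S i ∧ rowDist W (t i) v < r := by
    intro i v
    rw [hChat i, rowBall, mem_filter]
  have hpure : ∀ i, ∀ u ∈ Chat i ∩ good, ∀ v ∈ Chat i ∩ good, C u = C v := by
    intro i u hu v hv
    rw [mem_inter] at hu hv
    by_contra hne
    have h1 := hfar u hu.2 v hv.2 hne
    have h2 := rowDist_triangle W u (t i) v
    rw [rowDist_comm W u (t i)] at h2
    linarith [((hball i u).1 hu.1).2, ((hball i v).1 hv.1).2]
  set c : Fin K → Fin K := fun i =>
    if h : (Chat i ∩ good).Nonempty then C h.choose else i with hcdef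
  have hc : ∀ i, ∀ u ∈ Chat i ∩ good, C u = c i := by
    intro i u hu
    have hne : (Chat i ∩ good).Nonempty := ⟨u, hu⟩
    simp only [hcdef, dif_pos hne]
    exact hpure i u hu _ hne.choose_spec
  have hbad : ∀ T : Finset (Fin n), T.card ≤ (T ∩ good).card + b := by
    intro T
    have h1 : T.card = (T ∩ good).card + (T \ good).card := (card_inter_add_card_sdiff T good).symm
    have h2 : (T \ good).card ≤ goodᶜ.card := card_le_card fun x hx => by
      simp only [mem_sdiff] at hx
      simpa using hx.2
    omega
  -- Before round `i` fewer than `K` true clusters are represented, so the good nodes of some true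
  -- cluster `k` all remain. They lie in a single ball, and the greedy choice does at least as well.
  have hbig : ∀ i, m ≤ (Chat i).card + b := by
    intro i
    obtain ⟨k, hk⟩ : ∃ k, k ∉ (univ.filter fun j => j < i).image c := by
      by_contra hall
      push Not at hall
      have h1 : (univ : Finset (Fin K)) ⊆ (univ.filter fun j => j < i).image c :=
        fun k _ => hall k
      have h2 := (card_le_card h1).trans card_image_le
      have h3 : (univ.filter fun j => j < i).card = (i : ℕ) := by
        have : (univ.filter fun j => j < i) = Iio i := by ext; simp
        rw [this, Fin.card_Iio]
      rw [h3, card_univ, Fintype.card_fin] at h2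
      exact absurd i.2 (by omega)
    set G := (univ.filter fun v => C v = k) ∩ good with hG
    have hGcard : m ≤ G.card + b := by
      have := hbad (univ.filter fun v => C v = k)
      rwa [hC k] at this
    have hGS : ∀ v ∈ G, v ∈ S i := by
      intro v hv
      rw [hG, mem_inter, mem_filter] at hv
      rw [hS i, mem_filter]
      refine ⟨mem_univ _, fun j hj hvj => hk ?_⟩
      rw [mem_image]
      refine ⟨j, by simpa using hj, ?_⟩
      rw [← hc j v (mem_inter.2 ⟨hvj, hv.2⟩)]
      exact hv.1.2
    have hGne : G.Nonempty := card_pos.1 (by omega)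
    obtain ⟨u, hu⟩ := hGne
    have hmax := (ht i ⟨u, hGS u hu⟩).2 u (hGS u hu)
    rw [← hChat i] at hmax
    have hsub : G ⊆ rowBall W r (S i) u := by
      intro v hv
      rw [rowBall, mem_filter]
      refine ⟨hGS v hv, ?_⟩
      rw [hG, mem_inter, mem_filter] at hu hv
      exact hclose u hu.2 v hv.2 (hu.1.2.trans hv.1.2.symm)
    have := card_le_card hsub
    omega
  have hbig' : ∀ i, m ≤ (Chat i ∩ good).card + 2 * b := by
    intro i
    have := hbig i
    have := hbad (Chat i)
    omega
  have hdisj' : ∀ i j, i < j → Disjoint (Chat i) (Chat j) := by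
    intro i j hij
    rw [Finset.disjoint_left]
    intro v hvi hvj
    have := ((hball j v).1 hvj).1
    rw [hS j, mem_filter] at this
    exact this.2 i hij hvi
  have hdisj : ∀ i j, i ≠ j → Disjoint (Chat i ∩ good) (Chat j ∩ good) := by
    intro i j hij
    rcases lt_or_gt_of_ne hij with h | h
    · exact (hdisj' i j h).mono inter_subset_left inter_subset_left
    · exact (hdisj' j i h).symm.mono inter_subset_left inter_subset_left
  -- Two greedy clusters representing the same true cluster would together hold at least `2 (m - 2
  -- b)` of its `m` nodes, which `4 b < m` excludes.
  have hinj : Function.Injective c := by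
    intro i j hij
    by_contra hne
    have h1 : (Chat i ∩ good) ∪ (Chat j ∩ good) ⊆ univ.filter fun v => C v = c i := by
      intro v hv
      rw [mem_filter]
      refine ⟨mem_univ _, ?_⟩
      rcases mem_union.1 hv with h | h
      · exact hc i v h
      · rw [hij]; exact hc j v h
    have h2 := card_le_card h1
    rw [card_union_of_disjoint (hdisj i j hne), hC] at h2
    have := hbig' i
    have := hbig' j
    omega
  set e : Equiv.Perm (Fin K) := Equiv.ofBijective c (Finite.injective_iff_bijective.1 hinj)
  refine ⟨e.symm, ?_⟩
  have hsub : (univ.filter fun v => σ v ≠ e.symm (C v)) ⊆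
      (univ.biUnion fun i => Chat i ∩ good)ᶜ := by
    intro v hv
    rw [mem_compl, mem_biUnion]
    rintro ⟨i, -, hi⟩
    apply (mem_filter.1 hv).2
    rw [hσ1 i v (mem_inter.1 hi).1, hc i v hi]
    exact (e.symm_apply_apply i).symm
  refine (card_le_card hsub).trans ?_
  rw [card_compl, card_biUnion fun i _ j _ hij => hdisj i j hij, Fintype.card_fin]
  have h1 : ∑ i : Fin K, m ≤ ∑ i : Fin K, ((Chat i ∩ good).card + 2 * b) :=
    sum_le_sum fun i _ => hbig' i
  rw [sum_add_distrib] at h1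
  simp only [sum_const, card_univ, Fintype.card_fin, smul_eq_mul] at h1
  have h2 := hC.card_eq
  have h3 : K * (2 * b) = 2 * K * b := by ring
  omega

theorem frob_sq {ι κ : Type*} [Fintype ι] [Fintype κ] (M : Matrix ι κ ℝ) :
    frob M ^ 2 = ∑ i, ∑ j, M i j ^ 2 :=
  Real.sq_sqrt (sum_nonneg fun _ _ => sum_nonneg fun _ _ => sq_nonneg _)

theorem frob_nonneg {ι κ : Type*} [Fintype ι] [Fintype κ] (M : Matrix ι κ ℝ) : 0 ≤ frob M :=
  Real.sqrt_nonneg _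

theorem frob_le_iff {ι κ : Type*} [Fintype ι] [Fintype κ] (M N : Matrix ι κ ℝ) :
    frob M ≤ frob N ↔ ∑ i, ∑ j, M i j ^ 2 ≤ ∑ i, ∑ j, N i j ^ 2 := by
  rw [← frob_sq, ← frob_sq]
  exact (pow_le_pow_iff_left₀ (frob_nonneg M) (frob_nonneg N) two_ne_zero).symm

theorem frob_sq_clusterMatrix_sub (σ τ : Fin n → Fin K) :
    frob (clusterMatrix σ - clusterMatrix τ) ^ 2 =
      2 * ((univ.filter fun v => σ v ≠ τ v).card : ℝ) := by
  rw [frob_sq, card_filter]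
  push_cast
  rw [mul_sum]
  refine sum_congr rfl fun v _ => ?_
  simp only [Matrix.sub_apply, clusterMatrix, Matrix.of_apply]
  by_cases h : σ v = τ v
  · simp [h]
  · have : ∀ k, ((if σ v = k then (1 : ℝ) else 0) - if τ v = k then 1 else 0) ^ 2 =
        (if σ v = k then (1 : ℝ) else 0) + if τ v = k then 1 else 0 := by
      intro k
      by_cases h1 : σ v = k
      · have h2 : ¬ τ v = k := fun h2 => h (h1.trans h2.symm)
        simp [h1, h2]
      · by_cases h2 : τ v = k <;> simp [h1, h2]
    simp only [this, sum_add_distrib, sum_ite_eq, mem_univ, if_true, if_pos h]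
    norm_num

theorem exists_eq_clusterMatrix {H : Matrix (Fin n) (Fin K) ℝ}
    (hH : H ∈ clusteringMatrices n m K) : ∃ σ : Fin n → Fin K, IsBalanced m σ ∧
      H = clusterMatrix σ := by
  obtain ⟨h01, hrow, hcol⟩ := hH
  have h1 : ∀ i, ∃ k, H i k = 1 := by
    intro i
    by_contra hall
    push Not at hall
    have : ∑ k, H i k = 0 := sum_eq_zero fun k _ => (h01 i k).resolve_right (hall k)
    rw [hrow i] at this
    exact one_ne_zero this
  choose σ hσ using h1
  have hHσ : H = clusterMatrix σ := by
    ext i k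
    simp only [clusterMatrix, Matrix.of_apply]
    by_cases h : σ i = k
    · rw [if_pos h, ← h, hσ]
    · rw [if_neg h]
      refine (h01 i k).resolve_right fun h1 => ?_
      have h2 : ∑ l ∈ {σ i, k}, H i l ≤ ∑ l, H i l :=
        sum_le_sum_of_subset_of_nonneg (subset_univ _) fun l _ _ => by
          rcases h01 i l with h | h <;> simp [h]
      rw [sum_pair h, hrow i, hσ, h1] at h2
      norm_num at h2
  refine ⟨σ, fun k => ?_, hHσ⟩
  have := hcol k
  simp only [hHσ, clusterMatrix, Matrix.of_apply] at this
  rw [sum_boole] at this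
  exact_mod_cast this

theorem clusterMatrix_mem {σ : Fin n → Fin K} (hσ : IsBalanced m σ) :
    clusterMatrix σ ∈ clusteringMatrices n m K := by
  refine ⟨fun i k => ?_, fun i => ?_, fun k => ?_⟩
  · simp only [clusterMatrix, Matrix.of_apply]
    split_ifs <;> simp
  · simp [clusterMatrix]
  · simp only [clusterMatrix, Matrix.of_apply]
    rw [sum_boole]
    exact_mod_cast hσ k

theorem IsBalanced.comp_perm {C : Fin n → Fin K} (hC : IsBalanced m C)
    (π : Equiv.Perm (Fin K)) : IsBalanced m fun v => π (C v) := by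
  intro k
  rw [← hC (π.symm k)]
  congr 1
  ext v
  simp [Equiv.eq_symm_apply]

/-- Projection onto the balanced clusterings multiplies the number of errors by at most `4`. -/
theorem IsProjH.exists_card_le {σ C : Fin n → Fin K} (hC : IsBalanced m C)
    {H : Matrix (Fin n) (Fin K) ℝ} (hH : IsProjH m (clusterMatrix σ) H)
    (π : Equiv.Perm (Fin K)) {b : ℕ} (hb : (univ.filter fun v => σ v ≠ π (C v)).card ≤ b) :
    ∃ τ : Fin n → Fin K, IsBalanced m τ ∧ H = clusterMatrix τ ∧
      (univ.filter fun v => τ v ≠ π (C v)).card ≤ 4 * b := by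
  obtain ⟨τ, hτ, rfl⟩ := exists_eq_clusterMatrix hH.1
  refine ⟨τ, hτ, rfl, ?_⟩
  -- The relabelled truth competes in the projection, so `τ` is no farther from `σ` than `π ∘ C` is.
  -- The triangle inequality then gives at most `2 b` errors.
  have h1 := hH.2 _ (clusterMatrix_mem (hC.comp_perm π))
  rw [frob_le_iff, ← frob_sq, ← frob_sq, frob_sq_clusterMatrix_sub, frob_sq_clusterMatrix_sub] at h1
  have h2 : (univ.filter fun v => σ v ≠ τ v).card ≤ (univ.filter fun v => σ v ≠ π (C v)).card := by
    have : ((univ.filter fun v => σ v ≠ τ v).card : ℝ) ≤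
      (univ.filter fun v => σ v ≠ π (C v)).card := by linarith
    exact_mod_cast this
  have h3 : (univ.filter fun v => τ v ≠ π (C v)) ⊆
      (univ.filter fun v => σ v ≠ τ v) ∪ univ.filter fun v => σ v ≠ π (C v) := by
    intro v hv
    simp only [mem_union, mem_filter, mem_univ, true_and] at hv ⊢
    by_contra hcon
    push Not at hcon
    exact hv (hcon.1.symm.trans hcon.2)
  have h4 := (card_le_card h3).trans (card_union_le _ _)
  omega

end Clustering

end SGBM

/-! ### From eigenvector error to clusters and group elements. -/

namespace SGBM

open Finset

section Recovery

variable {n K m d : ℕ}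

/-- The near-isometry applied to the difference of two unit vectors: the rows of `X`, which are the
cluster centres up to scale, are well separated. -/
theorem sum_sub_mul_sq_ge {κ : Type*} [Fintype κ] [DecidableEq κ] {X : Matrix κ κ ℝ} {e : ℝ}
    (hX : ∀ a : κ → ℝ, (1 - e) * ∑ k, a k ^ 2 ≤ ∑ j, (∑ k, a k * X k j) ^ 2) {k l : κ}
    (hkl : k ≠ l) : (1 - e) * 2 ≤ ∑ j, (X k j - X l j) ^ 2 := by
  have h := hX (fun i => (if i = k then 1 else 0) - (if i = l then 1 else 0))
  have h1 : ∑ i, ((if i = k then (1 : ℝ) else 0) - (if i = l then 1 else 0)) ^ 2 = 2 := by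
    have : ∀ i, ((if i = k then (1 : ℝ) else 0) - (if i = l then 1 else 0)) ^ 2 =
        (if i = k then (1 : ℝ) else 0) + (if i = l then 1 else 0) := by
      intro i
      by_cases h1 : i = k
      · have h2 : ¬ i = l := fun h2 => hkl (h1.symm.trans h2)
        simp [h1, hkl]
      · by_cases h2 : i = l <;> simp [h1, h2, hkl.symm]
    simp only [this, sum_add_distrib, sum_ite_eq', mem_univ, if_true]
    norm_num
  rw [h1] at h
  simpa [sub_mul, sum_sub_distrib] using h

/-- Greedy clustering of a small perturbation of a rotated cluster indicator matrix makes few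
errors. -/
theorem exists_perm_of_perturbation {C : Fin n → Fin K} (hC : IsBalanced m C) (hm : 0 < m)
    {W : Matrix (Fin n) (Fin K) ℝ} {X : Matrix (Fin K) (Fin K) ℝ} {e μ : ℝ}
    (hX : ∀ a : Fin K → ℝ, (1 - e) * ∑ k, a k ^ 2 ≤ ∑ j, (∑ k, a k * X k j) ^ 2)
    (hE : ∑ v, ∑ j, (W v j - (((Real.sqrt m)⁻¹ • clusterMatrix C) * X) v j) ^ 2 ≤ e)
    (hμ : 0 < μ) (hμ2 : μ ≤ 1 / 2) (he : e ≤ 1 / 8) (heμ : 64 * e < μ ^ 2) {σ : Fin n → Fin K}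
    (hσ : IsGreedyClustering W (μ * Real.sqrt ((K : ℝ) / n)) σ) :
    ∃ (π : Equiv.Perm (Fin K)) (b : ℕ), (univ.filter fun v => σ v ≠ π (C v)).card ≤ b ∧
      (b : ℝ) ≤ 32 * K * m * e / μ ^ 2 := by
  classical
  set s := Real.sqrt m with hs
  have hs0 : 0 < s := Real.sqrt_pos.2 (by exact_mod_cast hm)
  have hss : s ^ 2 = m := Real.sq_sqrt (by positivity)
  have hn := hC.card_eq
  rcases Nat.eq_zero_or_pos K with hK0 | hK0
  · subst hK0
    have : n = 0 := by simpa using hn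
    subst this
    exact ⟨1, 0, by simp, by simp⟩
  have hr : μ * Real.sqrt ((K : ℝ) / n) = μ / s := by
    have : (K : ℝ) / n = 1 / (m : ℝ) := by
      rw [hn]; push_cast
      have : (K : ℝ) ≠ 0 := by positivity
      field_simp
    rw [this, Real.sqrt_div zero_le_one, Real.sqrt_one, ← hs]; ring
  rw [hr] at hσ
  set Er : Fin n → EuclideanSpace ℝ (Fin K) := fun v =>
    WithLp.toLp 2 fun j => W v j - (((Real.sqrt m)⁻¹ • clusterMatrix C) * X) v j with hEr
  set Xr : Fin K → EuclideanSpace ℝ (Fin K) := fun k => WithLp.toLp 2 (X k) with hXr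
  have hWr : ∀ v, WithLp.toLp 2 (W v) = s⁻¹ • Xr (C v) + Er v := by
    intro v
    ext j
    simp only [hEr, hXr, PiLp.add_apply, PiLp.smul_apply, smul_eq_mul, Matrix.mul_apply,
      Matrix.smul_apply, clusterMatrix, Matrix.of_apply]
    simp [hs]
  have hErn : ∀ v, ‖Er v‖ ^ 2 = ∑ j, (W v j - (((Real.sqrt m)⁻¹ • clusterMatrix C) * X) v j) ^ 2 := by
    intro v
    rw [EuclideanSpace.norm_sq_eq]
    simp [hEr]
  -- A quarter of the radius `μ / s`: two such errors use up half of it. By Markov's inequality at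
  -- most `16 m e / μ²` nodes fail.
  set good : Finset (Fin n) := univ.filter fun v => ‖Er v‖ ≤ μ / (4 * s) with hgood
  set b := goodᶜ.card with hb
  have hbe : (b : ℝ) * (μ ^ 2 / 16) ≤ m * e := by
    have h1 : ∑ v ∈ goodᶜ, (μ / (4 * s)) ^ 2 ≤ e := by
      refine le_trans ?_ hE
      calc ∑ v ∈ goodᶜ, (μ / (4 * s)) ^ 2 ≤ ∑ v ∈ goodᶜ, ‖Er v‖ ^ 2 := by
            refine sum_le_sum fun v hv => ?_
            have : μ / (4 * s) < ‖Er v‖ := by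
              by_contra hcon
              exact (mem_compl.1 hv) (by rw [hgood, mem_filter]; exact ⟨mem_univ _, not_lt.1 hcon⟩)
            exact pow_le_pow_left₀ (by positivity) this.le 2
        _ ≤ ∑ v, ‖Er v‖ ^ 2 := sum_le_sum_of_subset_of_nonneg (subset_univ _) fun _ _ _ =>
            sq_nonneg _
        _ = _ := sum_congr rfl fun v _ => hErn v
    rw [sum_const, nsmul_eq_mul, ← hb] at h1
    have h2 : (b : ℝ) * (μ / (4 * s)) ^ 2 * m = b * (μ ^ 2 / 16) := by
      rw [div_pow, mul_pow, hss]
      have : (m : ℝ) ≠ 0 := by positivity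
      field_simp
      norm_num
    rw [← h2, mul_comm (m : ℝ)]
    exact mul_le_mul_of_nonneg_right h1 (by positivity)
  have hbm : 4 * b < m := by
    have h1 : (m : ℝ) * e * 64 < m * μ ^ 2 := by
      have : (0 : ℝ) < m := by exact_mod_cast hm
      nlinarith
    have h2 : (4 * b : ℝ) * μ ^ 2 < m * μ ^ 2 := by linarith
    have h3 := lt_of_mul_lt_mul_right h2 (sq_nonneg μ)
    exact_mod_cast h3
  have hclose : ∀ u ∈ good, ∀ v ∈ good, C u = C v → rowDist W u v < μ / s := by
    intro u hu v hv huv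
    rw [hgood, mem_filter] at hu hv
    rw [rowDist_eq_dist, dist_eq_norm, hWr, hWr, huv, add_sub_add_left_eq_sub]
    have h1 := norm_sub_le (Er u) (Er v)
    have h2 : μ / (4 * s) + μ / (4 * s) = μ / s / 2 := by field_simp; norm_num
    have h3 : 0 < μ / s := by positivity
    linarith [hu.2, hv.2]
  have hfar : ∀ u ∈ good, ∀ v ∈ good, C u ≠ C v → 2 * (μ / s) ≤ rowDist W u v := by
    intro u hu v hv huv
    rw [hgood, mem_filter] at hu hv
    rw [rowDist_eq_dist, dist_eq_norm, hWr, hWr]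
    -- The squared distance of two rows of `X` is at least `2 (1 - e) ≥ 7 / 4`, which exceeds `(5 /
    -- 4)²`; and `5 / 4` leaves room for the separation `2 μ` plus the errors `μ / 2` when `μ ≤ 1 /
    -- 2`.
    have h1 : s⁻¹ * (5 / 4) ≤ ‖s⁻¹ • (Xr (C u) - Xr (C v))‖ := by
      rw [norm_smul, Real.norm_eq_abs, abs_of_pos (inv_pos.2 hs0)]
      refine mul_le_mul_of_nonneg_left ?_ (inv_pos.2 hs0).le
      refine (pow_le_pow_iff_left₀ (by norm_num) (norm_nonneg _) two_ne_zero).1 ?_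
      rw [EuclideanSpace.norm_sq_eq]
      have := sum_sub_mul_sq_ge hX huv
      simp only [hXr, PiLp.sub_apply, Real.norm_eq_abs, sq_abs]
      norm_num
      linarith
    have h2 : s⁻¹ • (Xr (C u) - Xr (C v)) = (s⁻¹ • Xr (C u) + Er u - (s⁻¹ • Xr (C v) + Er v)) -
        (Er u - Er v) := by rw [smul_sub]; abel
    have h3 := norm_sub_le (s⁻¹ • Xr (C u) + Er u - (s⁻¹ • Xr (C v) + Er v)) (Er u - Er v)
    rw [← h2] at h3
    have h4 := norm_sub_le (Er u) (Er v)
    have h5 : μ / (4 * s) + μ / (4 * s) = s⁻¹ * (μ / 2) := by field_simp; norm_num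
    have h6 : 2 * (μ / s) = s⁻¹ * (2 * μ) := by field_simp
    have h7 : s⁻¹ * (2 * μ) + s⁻¹ * (μ / 2) ≤ s⁻¹ * (5 / 4) := by
      rw [← mul_add]
      exact mul_le_mul_of_nonneg_left (by linarith) (inv_pos.2 hs0).le
    linarith [hu.2, hv.2]
  obtain ⟨π, hπ⟩ := hσ.exists_perm hC good (b := b) le_rfl hbm hclose hfar
  refine ⟨π, 2 * K * b, hπ, ?_⟩
  push_cast
  rw [le_div_iff₀ (by positivity)]
  have := mul_le_mul_of_nonneg_left hbe (by positivity : (0 : ℝ) ≤ 32 * K)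
  linarith

theorem frob_eq_norm {ι κ : Type*} [Fintype ι] [Fintype κ] (M : Matrix ι κ ℝ) :
    frob M = ‖(WithLp.toLp 2 fun p : ι × κ => M p.1 p.2 : EuclideanSpace ℝ (ι × κ))‖ := by
  rw [EuclideanSpace.norm_eq, frob]
  simp [Fintype.sum_prod_type]

theorem frob_sub_le {ι κ : Type*} [Fintype ι] [Fintype κ] (M N : Matrix ι κ ℝ) :
    frob (M - N) ≤ frob M + frob N := by
  simp only [frob_eq_norm]
  exact norm_sub_le (WithLp.toLp 2 fun p : ι × κ => M p.1 p.2 : EuclideanSpace ℝ (ι × κ))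
    (WithLp.toLp 2 fun p : ι × κ => N p.1 p.2)

theorem frob_orthogonal_mul {κ : Type*} [Fintype κ] {Q : Matrix (Fin d) (Fin d) ℝ}
    (hQ : Q ∈ Matrix.orthogonalGroup (Fin d) ℝ) (M : Matrix (Fin d) κ ℝ) :
    frob (Q * M) = frob M := by
  rw [frob, frob, sum_sq_mul_of_transpose_mul_self Q ((Matrix.mem_orthogonalGroup_iff' _ ℝ).1 hQ)]

theorem transpose_mem_orthogonalGroup {Q : Matrix (Fin d) (Fin d) ℝ}
    (hQ : Q ∈ Matrix.orthogonalGroup (Fin d) ℝ) :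
    Q.transpose ∈ Matrix.orthogonalGroup (Fin d) ℝ :=
  (Matrix.mem_orthogonalGroup_iff _ ℝ).2 ((Matrix.mem_orthogonalGroup_iff' _ ℝ).1 hQ)

theorem frob_mul_orthogonal {Q : Matrix (Fin d) (Fin d) ℝ}
    (hQ : Q ∈ Matrix.orthogonalGroup (Fin d) ℝ) (M : Matrix (Fin d) (Fin d) ℝ) :
    frob (M * Q) = frob M := by
  have ht : ∀ N : Matrix (Fin d) (Fin d) ℝ, frob N.transpose = frob N := fun N => by
    rw [frob, frob, sum_comm]; rfl
  rw [← ht, Matrix.transpose_mul, frob_orthogonal_mul, ht]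
  exact transpose_mem_orthogonalGroup hQ

theorem frob_sq_orthogonal {Q : Matrix (Fin d) (Fin d) ℝ}
    (hQ : Q ∈ Matrix.orthogonalGroup (Fin d) ℝ) : frob Q ^ 2 = d := by
  rw [frob_sq, sum_sq_eq_trace, (Matrix.mem_orthogonalGroup_iff' _ ℝ).1 hQ]
  simp

theorem toMat_mem {𝒢 : GroupKind} (g : grp d 𝒢) :
    toMat g ∈ Matrix.orthogonalGroup (Fin d) ℝ := (g : Matrix.orthogonalGroup (Fin d) ℝ).2

/-- The rotated and relabelled ground truth, as an entangled pair. -/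
theorem estErr_le {𝒢 : GroupKind} (C : Fin n → Fin K) (R : Fin n → grp d 𝒢) (V : VMat n K d)
    (U : Fin K → Matrix (Fin d) (Fin d) ℝ) (hU : ∀ k, U k ∈ Matrix.orthogonalGroup (Fin d) ℝ)
    (π : Equiv.Perm (Fin K)) :
    estErr (groundTruth C R) V ≤
      frob (V - entangle (fun v => toMat (R v) * U (C v)) (clusterMatrix fun v => π (C v))) := by
  have hmul : groundTruth C R * (bdiag U * Matrix.kronecker (π.permMatrix ℝ)
      (1 : Matrix (Fin d) (Fin d) ℝ)) =
      entangle (fun v => toMat (R v) * U (C v)) (clusterMatrix fun v => π (C v)) := by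
    have h1 : groundTruth C R * bdiag U =
        entangle (fun v => toMat (R v) * U (C v)) (clusterMatrix C) := by
      ext ⟨v, a⟩ ⟨k, b⟩
      simp only [groundTruth, entangle, bdiag, clusterMatrix, Matrix.mul_apply, Matrix.of_apply,
        Fintype.sum_prod_type]
      rw [sum_eq_single (C v) (fun l _ hl => by simp [Ne.symm hl]) (by simp)]
      by_cases h : C v = k <;> simp [h]
    rw [← Matrix.mul_assoc, h1]
    ext ⟨v, a⟩ ⟨k, b⟩
    simp only [entangle, clusterMatrix, Matrix.mul_apply, Matrix.of_apply, Matrix.kronecker,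
      Matrix.kroneckerMap_apply, Fintype.sum_prod_type, Equiv.Perm.permMatrix, Equiv.toPEquiv_apply,
      PEquiv.toMatrix_apply, Matrix.one_apply]
    rw [sum_eq_single (C v) (fun l _ hl => by simp [Ne.symm hl]) (by simp)]
    rw [sum_eq_single b (fun l _ hl => by simp [hl]) (by simp)]
    simp [eq_comm]
  rw [← hmul]
  refine ciInf_le (f := fun Q : blockPerms K d => frob (V - groundTruth C R *
    (Q : Matrix (Fin K × Fin d) (Fin K × Fin d) ℝ))) ⟨0, ?_⟩ ⟨_, U, π, hU, rfl⟩
  rintro _ ⟨Q, rfl⟩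
  exact frob_nonneg _

/-- A node with differing labels has its two orthogonal blocks in disjoint columns, so each
contributes its full squared norm `d`. -/
theorem frob_sq_entangle_sub (R R' : Fin n → Matrix (Fin d) (Fin d) ℝ)
    (hR : ∀ v, R v ∈ Matrix.orthogonalGroup (Fin d) ℝ)
    (hR' : ∀ v, R' v ∈ Matrix.orthogonalGroup (Fin d) ℝ) (σ τ : Fin n → Fin K) :
    frob (entangle R (clusterMatrix σ) - entangle R' (clusterMatrix τ)) ^ 2 =
      ∑ v, if σ v = τ v then frob (R v - R' v) ^ 2 else 2 * (d : ℝ) := by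
  rw [frob_sq, Fintype.sum_prod_type]
  refine sum_congr rfl fun v _ => ?_
  simp only [Fintype.sum_prod_type, Matrix.sub_apply, entangle, clusterMatrix, Matrix.of_apply]
  split_ifs with h
  · rw [frob_sq]
    refine sum_congr rfl fun a _ => ?_
    rw [sum_eq_single (σ v) (fun l _ hl => by simp [Ne.symm hl, ← h]) (by simp)]
    simp [h]
  · have h1 := frob_sq_orthogonal (hR v)
    have h2 := frob_sq_orthogonal (hR' v)
    rw [frob_sq] at h1 h2
    rw [two_mul]
    nth_rewrite 1 [← h1]
    rw [← h2, ← sum_add_distrib]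
    refine sum_congr rfl fun a _ => ?_
    have h3 : ∀ k, ∑ b, (R v a b * (if σ v = k then 1 else 0) - R' v a b * if τ v = k then 1 else 0) ^ 2
        = (if σ v = k then ∑ b, R v a b ^ 2 else 0) + (if τ v = k then ∑ b, R' v a b ^ 2 else 0) := by
      intro k
      by_cases h1 : σ v = k
      · have h2 : ¬ τ v = k := fun h2 => h (h1.trans h2.symm)
        simp [h1, h2]
      · by_cases h2 : τ v = k <;> simp [h1, h2]
    simp only [h3, sum_add_distrib, sum_ite_eq, mem_univ, if_true]

/-- Block-row error of the eigenvector matrix `U` with respect to `V* X / √m`. -/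
noncomputable def rowErr {𝒢 : GroupKind} (C : Fin n → Fin K) (R : Fin n → grp d 𝒢) (m : ℕ)
    (U : VMat n K d) (X : Matrix (Fin K × Fin d) (Fin K × Fin d) ℝ) (v : Fin n) :
    Matrix (Fin d) (Fin K × Fin d) ℝ :=
  blockRow (U - ((Real.sqrt m)⁻¹ • groundTruth C R) * X) v

theorem blockRow_eq {𝒢 : GroupKind} (C : Fin n → Fin K) (R : Fin n → grp d 𝒢)
    (U : VMat n K d) (X : Matrix (Fin K × Fin d) (Fin K × Fin d) ℝ) (v : Fin n) :
    blockRow U v = (Real.sqrt m)⁻¹ • (toMat (R v) * Matrix.of fun a j => X (C v, a) j) +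
      rowErr C R m U X v := by
  ext a j
  simp only [rowErr, blockRow, Matrix.add_apply, Matrix.smul_apply, Matrix.sub_apply,
    Matrix.of_apply, Matrix.smul_mul, smul_eq_mul]
  have : (groundTruth C R * X) (v, a) j =
      (toMat (R v) * (Matrix.of fun a j => X (C v, a) j : Matrix (Fin d) (Fin K × Fin d) ℝ)) a j := by
    simp only [groundTruth, entangle, clusterMatrix, Matrix.mul_apply, Matrix.of_apply,
      Fintype.sum_prod_type]
    rw [sum_eq_single (C v) (fun l _ hl => by simp [Ne.symm hl]) (by simp)]
    simp
  rw [this]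
  ring

/-- Error of one group estimate obtained by aligning the block row `v` to that of the pivot `t`. -/
theorem frob_sq_sub_le {𝒢 : GroupKind} {C : Fin n → Fin K} {R : Fin n → grp d 𝒢} (hm : 0 < m)
    {U : VMat n K d} {X : Matrix (Fin K × Fin d) (Fin K × Fin d) ℝ} {e : ℝ} (he : e ≤ 1 / 2)
    (hX : ∀ a : Fin K × Fin d → ℝ, (1 - e) * ∑ k, a k ^ 2 ≤ ∑ j, (∑ k, a k * X k j) ^ 2)
    {v t : Fin n} (hvt : C v = C t) {Q : Matrix (Fin d) (Fin d) ℝ}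
    (hQ : Q ∈ Matrix.orthogonalGroup (Fin d) ℝ)
    (hmin : ∀ R' ∈ Matrix.orthogonalGroup (Fin d) ℝ,
      frob (blockRow U v - Q * blockRow U t) ≤ frob (blockRow U v - R' * blockRow U t)) :
    frob (Q - toMat (R v) * (toMat (R t)).transpose) ^ 2 ≤
      16 * m * (frob (rowErr C R m U X v) ^ 2 + frob (rowErr C R m U X t) ^ 2) := by
  have hm0 : (0 : ℝ) < m := by exact_mod_cast hm
  set s := Real.sqrt m with hs
  have hs0 : 0 < s := Real.sqrt_pos.2 hm0
  have hss : s ^ 2 = m := Real.sq_sqrt hm0.le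
  set Y : Matrix (Fin d) (Fin K × Fin d) ℝ := Matrix.of fun a j => X (C v, a) j with hY
  set Ev := rowErr C R m U X v
  set Et := rowErr C R m U X t
  have hv : blockRow U v = s⁻¹ • (toMat (R v) * Y) + Ev := blockRow_eq C R U X v
  have ht : blockRow U t = s⁻¹ • (toMat (R t) * Y) + Et := by
    rw [hY, hvt]; exact blockRow_eq C R U X t
  have hRt := toMat_mem (R t)
  have hRtt : (toMat (R t)).transpose * toMat (R t) = 1 := (Matrix.mem_orthogonalGroup_iff' _ ℝ).1 hRt
  -- The true ratio `T` competes with the minimizer `Q`. Its misfit consists of the two row errors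
  -- only, which bounds the misfit of `Q` and hence the difference of `Q` and `T` acting on the
  -- signal.
  set T := toMat (R v) * (toMat (R t)).transpose with hT
  have hTmem : T ∈ Matrix.orthogonalGroup (Fin d) ℝ := mul_mem (toMat_mem (R v)) (transpose_mem_orthogonalGroup hRt)
  have hTR : T * toMat (R t) = toMat (R v) := by
    rw [hT, Matrix.mul_assoc, hRtt, Matrix.mul_one]
  have e1 : blockRow U v - T * blockRow U t = Ev - T * Et := by
    rw [hv, ht, Matrix.mul_add, Matrix.mul_smul, ← Matrix.mul_assoc, hTR]
    abel
  have e2 : s⁻¹ • ((toMat (R v) - Q * toMat (R t)) * Y) =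
      (blockRow U v - Q * blockRow U t) - (Ev - Q * Et) := by
    rw [hv, ht, Matrix.mul_add, Matrix.mul_smul, ← Matrix.mul_assoc, Matrix.sub_mul, smul_sub]
    abel
  have e3 : frob (s⁻¹ • ((toMat (R v) - Q * toMat (R t)) * Y)) ≤ 2 * (frob Ev + frob Et) := by
    rw [e2]
    have h1 := frob_sub_le (blockRow U v - Q * blockRow U t) (Ev - Q * Et)
    have h2 := hmin T hTmem
    rw [e1] at h2
    have h3 := frob_sub_le Ev (T * Et)
    have h4 := frob_sub_le Ev (Q * Et)
    rw [frob_orthogonal_mul hTmem] at h3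
    rw [frob_orthogonal_mul hQ] at h4
    linarith
  set G := toMat (R v) - Q * toMat (R t) with hG
  have e4 : frob (Q - T) = frob G := by
    rw [← frob_mul_orthogonal hRt, Matrix.sub_mul, hTR, hG]
    rw [frob, frob]
    congr 1
    refine sum_congr rfl fun a _ => sum_congr rfl fun b _ => ?_
    simp only [Matrix.sub_apply]; ring
  have e5 : (1 - e) * frob G ^ 2 ≤ frob (G * Y) ^ 2 := by
    rw [frob_sq, frob_sq, mul_sum]
    refine sum_le_sum fun a _ => ?_
    -- Padding a row of `G` by zeros lets the near-isometry of `X` act on the block of rows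
    -- belonging to the cluster of `v`.
    have h1 := hX (fun k => if k.1 = C v then G a k.2 else 0)
    have h2 : ∑ k : Fin K × Fin d, (if k.1 = C v then G a k.2 else 0) ^ 2 = ∑ c, G a c ^ 2 := by
      rw [Fintype.sum_prod_type, sum_eq_single (C v) (fun l _ hl => by simp [hl]) (by simp)]
      simp
    rw [h2] at h1
    refine h1.trans (le_of_eq ?_)
    refine sum_congr rfl fun j _ => ?_
    rw [Fintype.sum_prod_type, sum_eq_single (C v) (fun l _ hl => by simp [hl]) (by simp)]
    simp [hY, Matrix.mul_apply]
  have e6 : frob (G * Y) ^ 2 = m * frob (s⁻¹ • (G * Y)) ^ 2 := by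
    rw [frob_sq, frob_sq, mul_sum]
    refine sum_congr rfl fun a _ => ?_
    rw [mul_sum]
    refine sum_congr rfl fun j _ => ?_
    rw [Matrix.smul_apply, smul_eq_mul, mul_pow, inv_pow, hss]
    field_simp
  have e7 : frob (s⁻¹ • (G * Y)) ^ 2 ≤ 8 * (frob Ev ^ 2 + frob Et ^ 2) := by
    have := pow_le_pow_left₀ (frob_nonneg _) e3 2
    nlinarith [sq_nonneg (frob Ev - frob Et)]
  rw [e4]
  have e8 : 1 / 2 * frob G ^ 2 ≤ (1 - e) * frob G ^ 2 :=
    mul_le_mul_of_nonneg_right (by linarith) (sq_nonneg _)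
  have e9 := mul_le_mul_of_nonneg_left e7 hm0.le
  linarith

/-- Quality of the output of the spectral algorithm for good pivots. -/
theorem estErr_sq_le_of_pivots {𝒢 : GroupKind} {C : Fin n → Fin K} (hC : IsBalanced m C)
    {R : Fin n → grp d 𝒢} (hm : 0 < m)
    {U : VMat n K d} {X : Matrix (Fin K × Fin d) (Fin K × Fin d) ℝ} {e : ℝ} (he : e ≤ 1 / 2)
    (hX : ∀ a : Fin K × Fin d → ℝ, (1 - e) * ∑ k, a k ^ 2 ≤ ∑ j, (∑ k, a k * X k j) ^ 2)
    (hE : ∑ v, frob (rowErr C R m U X v) ^ 2 ≤ e)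
    {τ : Fin n → Fin K} {π : Equiv.Perm (Fin K)} {b : ℕ}
    (hb : (univ.filter fun v => τ v ≠ π (C v)).card ≤ b)
    {t : Fin K → Fin n} (ht : ∀ k, π (C (t k)) = k) {s : ℝ}
    (hts : ∀ k, m * frob (rowErr C R m U X (t k)) ^ 2 ≤ s)
    {Q : Fin n → Matrix (Fin d) (Fin d) ℝ}
    (hQ : ∀ v, Q v ∈ Matrix.orthogonalGroup (Fin d) ℝ)
    (hmin : ∀ v, ∀ R' ∈ Matrix.orthogonalGroup (Fin d) ℝ,
      frob (blockRow U v - Q v * blockRow U (t (τ v))) ≤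
        frob (blockRow U v - R' * blockRow U (t (τ v)))) :
    estErr (groundTruth C R) (entangle Q (clusterMatrix τ)) ^ 2 ≤
      m * (16 * e + 16 * K * s) + 2 * d * b := by
  have hs0 : ∀ k : Fin K, 0 ≤ s := fun k => (by positivity : (0 : ℝ) ≤ _).trans (hts k)
  -- The alignment estimates `R v` times the transposed group element of the pivot. That common
  -- factor within a cluster is absorbed into the rotation allowed by the error.
  have h1 := estErr_le C R (entangle Q (clusterMatrix τ))
    (fun k => (toMat (R (t (π k)))).transpose) (fun k => transpose_mem_orthogonalGroup (toMat_mem _)) π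
  have h0 : 0 ≤ estErr (groundTruth C R) (entangle Q (clusterMatrix τ)) :=
    Real.iInf_nonneg fun _ => frob_nonneg _
  refine (pow_le_pow_left₀ h0 h1 2).trans ?_
  rw [frob_sq_entangle_sub _ _ hQ (fun v => mul_mem (toMat_mem _) (transpose_mem_orthogonalGroup (toMat_mem _)))]
  have h2 : ∀ v, (if τ v = π (C v) then
        frob (Q v - toMat (R v) * (toMat (R (t (π (C v))))).transpose) ^ 2 else 2 * (d : ℝ)) ≤
      (16 * m * frob (rowErr C R m U X v) ^ 2 + 16 * s) +
        (if τ v ≠ π (C v) then 2 * (d : ℝ) else 0) := by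
    intro v
    have hp : 0 ≤ 16 * m * frob (rowErr C R m U X v) ^ 2 + 16 * s := by
      have := hs0 (C v)
      positivity
    by_cases h : τ v = π (C v)
    · rw [if_pos h, if_neg (by simpa using h), add_zero]
      have hvt : C v = C (t (τ v)) := by
        apply π.injective
        rw [ht, h]
      have := frob_sq_sub_le (R := R) hm he hX hvt (hQ v) (hmin v)
      rw [← h]
      refine this.trans ?_
      have := hts (τ v)
      linarith
    · rw [if_neg h, if_pos h]
      linarith
  refine (sum_le_sum fun v _ => h2 v).trans ?_
  rw [sum_add_distrib, sum_add_distrib, ← mul_sum, ← sum_filter, sum_const, sum_const, card_univ,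
    Fintype.card_fin, nsmul_eq_mul, nsmul_eq_mul]
  have h3 : (n : ℝ) = K * m := by exact_mod_cast hC.card_eq
  have h4 : ((univ.filter fun v => τ v ≠ π (C v)).card : ℝ) * (2 * d) ≤ b * (2 * d) :=
    mul_le_mul_of_nonneg_right (by exact_mod_cast hb) (by positivity)
  have h5 := mul_le_mul_of_nonneg_left hE (by positivity : (0 : ℝ) ≤ 16 * m)
  rw [h3]
  linarith

end Recovery

end SGBM

/-! ### Random pivots. -/

namespace SGBM

open Finset
open scoped ENNReal

section Pivots

variable {n K m d : ℕ} {μ : ℝ}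

/-- Uniform pivots avoid a small set of nodes with high probability. -/
theorem SpectralClustering.le_toInitializer (alg : SpectralClustering n m K d μ) (hm : 0 < m)
    {A : Obs n d} {τ : Fin n → Fin K} (hτ : IsBalanced m τ) (hH : alg.H₀ A = clusterMatrix τ)
    (bad : Finset (Fin n)) (S : Set (VMat n K d))
    (hS : ∀ t : Fin K → Fin n, (∀ k, τ (t k) = k) → (∀ k, t k ∉ bad) →
      entangle (alg.R₀ A t) (alg.H₀ A) ∈ S) :
    ENNReal.ofReal (1 - bad.card / m) ≤ (alg.toInitializer A).toOuterMeasure S := by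
  classical
  have hpiv : alg.pivots A = Fintype.piFinset fun k => univ.filter fun v => τ v = k := by
    ext t
    simp only [pivots, hH, clusterMatrix, Matrix.of_apply, mem_filter, mem_univ, true_and,
      Fintype.mem_piFinset]
    refine forall_congr' fun k => ?_
    split_ifs with h <;> simp [h]
  have hcard : (alg.pivots A).card = m ^ K := by
    rw [hpiv, Fintype.card_piFinset, prod_congr rfl fun k _ => hτ k, prod_const, card_univ,
      Fintype.card_fin]
  have hne : (alg.pivots A).Nonempty := card_pos.1 (by rw [hcard]; exact Nat.pow_pos hm)
  -- The admissible pivots form a product of the estimated clusters, so constraining one coordinate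
  -- replaces one factor `m` by the number of bad nodes in that cluster. Summing over `k` gives
  -- failure probability at most `|bad| / m`.
  have hbad : ∀ k, ((alg.pivots A).filter fun t => t k ∈ bad).card * m =
      (bad.filter fun v => τ v = k).card * m ^ K := by
    intro k
    have h1 : ((alg.pivots A).filter fun t => t k ∈ bad) = Fintype.piFinset fun l =>
        if l = k then bad.filter fun v => τ v = k else univ.filter fun v => τ v = l := by
      ext t
      simp only [hpiv, mem_filter, Fintype.mem_piFinset, mem_univ, true_and]
      constructor
      · rintro ⟨h1, h2⟩ l
        split_ifs with hl
        · subst hl; exact mem_filter.2 ⟨h2, h1 l⟩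
        · exact mem_filter.2 ⟨mem_univ _, h1 l⟩
      · intro h
        refine ⟨fun l => ?_, ?_⟩
        · have := h l
          split_ifs at this with hl
          · subst hl; exact (mem_filter.1 this).2
          · exact (mem_filter.1 this).2
        · have := h k
          rw [if_pos rfl] at this
          exact (mem_filter.1 this).1
    have h2 : ∀ l ∈ univ.erase k, (if l = k then bad.filter fun v => τ v = k else
        univ.filter fun v => τ v = l).card = m := fun l hl => by
      rw [if_neg (mem_erase.1 hl).1, hτ]
    rw [h1, Fintype.card_piFinset, ← mul_prod_erase univ _ (mem_univ k), if_pos rfl,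
      prod_congr rfl h2, prod_const, card_erase_of_mem (mem_univ k), card_univ, Fintype.card_fin,
      mul_assoc, ← pow_succ, Nat.sub_add_cancel k.pos]
  have hbad2 : ((alg.pivots A).filter fun t => ∃ k, t k ∈ bad).card * m ≤ bad.card * m ^ K := by
    have h1 : ((alg.pivots A).filter fun t => ∃ k, t k ∈ bad) ⊆
        univ.biUnion fun k => (alg.pivots A).filter fun t => t k ∈ bad := by
      intro t ht
      rw [mem_filter] at ht
      obtain ⟨h, k, hk⟩ := ht
      exact mem_biUnion.2 ⟨k, mem_univ _, mem_filter.2 ⟨h, hk⟩⟩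
    have h2 := (card_le_card h1).trans card_biUnion_le
    have h3 := card_eq_sum_card_fiberwise (f := τ) (s := bad) (t := univ) fun _ _ => mem_univ _
    calc _ ≤ (∑ k, ((alg.pivots A).filter fun t => t k ∈ bad).card) * m :=
          Nat.mul_le_mul_right _ h2
      _ = bad.card * m ^ K := by
          rw [sum_mul, sum_congr rfl fun k _ => hbad k, ← sum_mul, ← h3]
  unfold toInitializer
  rw [dif_pos hne, PMF.toOuterMeasure_map_apply, PMF.toOuterMeasure_uniformOfFinset_apply]
  set G := (alg.pivots A).filter fun t => t ∈ (fun t => entangle (alg.R₀ A t) (alg.H₀ A)) ⁻¹' S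
  have hG : (alg.pivots A).card ≤ G.card +
      ((alg.pivots A).filter fun t => ∃ k, t k ∈ bad).card := by
    rw [← card_filter_add_card_filter_not (s := alg.pivots A) (fun t => ∃ k, t k ∈ bad), add_comm]
    refine Nat.add_le_add_right (card_le_card ?_) _
    intro t ht
    rw [mem_filter] at ht
    refine mem_filter.2 ⟨ht.1, hS t (fun k => ?_) (fun k hk => ht.2 ⟨k, hk⟩)⟩
    have := ht.1
    rw [hpiv, Fintype.mem_piFinset] at this
    exact (mem_filter.1 (this k)).2
  have hpos : (0 : ℝ) < (alg.pivots A).card := by exact_mod_cast hne.card_pos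
  have hm0 : (0 : ℝ) < m := by exact_mod_cast hm
  have hreal : 1 - (bad.card : ℝ) / m ≤ (G.card : ℝ) / (alg.pivots A).card := by
    rw [le_div_iff₀ hpos]
    have h1 : ((alg.pivots A).card : ℝ) ≤ G.card +
      ((alg.pivots A).filter fun t => ∃ k, t k ∈ bad).card := by exact_mod_cast hG
    have h2 : (((alg.pivots A).filter fun t => ∃ k, t k ∈ bad).card : ℝ) * m ≤
        bad.card * (alg.pivots A).card := by rw [hcard]; exact_mod_cast hbad2
    have h3 : (((alg.pivots A).filter fun t => ∃ k, t k ∈ bad).card : ℝ) ≤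
        bad.card / m * (alg.pivots A).card := by
      rw [div_mul_eq_mul_div, le_div_iff₀ hm0]; exact h2
    linarith
  refine (ENNReal.ofReal_le_ofReal hreal).trans (le_of_eq ?_)
  rw [ENNReal.ofReal_div_of_pos hpos, ENNReal.ofReal_natCast, ENNReal.ofReal_natCast]

end Pivots

end SGBM

/-! ### The Haar mean. -/

namespace SGBM

open MeasureTheory ProbabilityTheory Finset

section Haar

variable {d : ℕ} {𝒢 : GroupKind}

instance : IsProbabilityMeasure (unif d 𝒢) :=
  ⟨by have := Measure.haarMeasure_self (G := grp d 𝒢) (K₀ := ⊤)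
      simpa [unif] using this⟩

instance : (unif d 𝒢).IsMulLeftInvariant := by
  unfold unif; infer_instance

theorem continuous_toMat_apply (a b : Fin d) : Continuous fun g : grp d 𝒢 => toMat g a b := by
  have h1 : Continuous fun g : grp d 𝒢 => (g : Matrix.orthogonalGroup (Fin d) ℝ) :=
    continuous_subtype_val
  have h2 : Continuous fun g : Matrix.orthogonalGroup (Fin d) ℝ =>
    (g : Matrix (Fin d) (Fin d) ℝ) := continuous_subtype_val
  exact (h2.comp h1).matrix_elem a b

theorem measurable_toMat_apply (a b : Fin d) : Measurable fun g : grp d 𝒢 => toMat g a b :=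
  (continuous_toMat_apply a b).measurable

theorem abs_apply_le_one_of_mem_orthogonalGroup {Q : Matrix (Fin d) (Fin d) ℝ}
    (hQ : Q ∈ Matrix.orthogonalGroup (Fin d) ℝ) (a b : Fin d) : |Q a b| ≤ 1 := by
  have h1 : Q * Q.transpose = 1 := (Matrix.mem_orthogonalGroup_iff _ ℝ).1 hQ
  have h2 := congrFun (congrFun h1 a) a
  rw [Matrix.mul_apply, Matrix.one_apply_eq] at h2
  have h3 := single_le_sum (f := fun c => Q a c * Q.transpose c a)
    (fun c _ => mul_self_nonneg (Q a c)) (mem_univ b)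
  rw [h2] at h3
  have h4 : Q a b ^ 2 ≤ 1 := by rw [pow_two]; exact h3
  exact (sq_le_one_iff_abs_le_one _).1 h4

/-- `1` for `𝒮𝒪(1)`, the only case in which the Haar mean does not vanish, and `0` otherwise. -/
noncomputable def haarMean (d : ℕ) : GroupKind → ℝ
  | .orthogonal => 0
  | .rotation => if d = 1 then 1 else 0

theorem haarMean_nonneg : 0 ≤ haarMean d 𝒢 := by
  cases 𝒢 <;> simp only [haarMean] <;> [exact le_rfl; (split_ifs <;> norm_num)]

theorem haarMean_le_one : haarMean d 𝒢 ≤ 1 := by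
  cases 𝒢 <;> simp only [haarMean] <;> [norm_num; (split_ifs <;> norm_num)]

theorem toMat_eq_one (h : haarMean d 𝒢 ≠ 0) (g : grp d 𝒢) : toMat g = 1 := by
  cases 𝒢 with
  | orthogonal => exact absurd rfl h
  | rotation =>
    have hd : d = 1 := by
      by_contra hd
      exact h (by simp [haarMean, hd])
    subst hd
    have h1 : (toMat g).det = 1 := g.2
    ext i j
    rw [Matrix.det_unique] at h1
    rw [Subsingleton.elim i default, Subsingleton.elim j default, h1]
    simp

theorem diagonal_mem_orthogonalGroup (s : Fin d → ℝ) (hs : ∀ a, s a * s a = 1) :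
    Matrix.diagonal s ∈ Matrix.orthogonalGroup (Fin d) ℝ := by
  refine (Matrix.mem_orthogonalGroup_iff _ ℝ).2 ?_
  rw [Matrix.diagonal_transpose, Matrix.diagonal_mul_diagonal]
  simp [hs]

theorem integral_toMat_eq_zero_of_reflection (g : grp d 𝒢) (s : Fin d → ℝ)
    (hg : toMat g = Matrix.diagonal s) (a b : Fin d) (hs : s a = -1) :
    ∫ x, toMat x a b ∂(unif d 𝒢) = 0 := by
  have h1 := integral_mul_left_eq_self (μ := unif d 𝒢) (fun x => toMat x a b) g
  have h2 : ∀ x, toMat (g * x) a b = -toMat x a b := by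
    intro x
    have : toMat (g * x) = toMat g * toMat x := rfl
    rw [this, hg, Matrix.diagonal_mul, hs]
    ring
  simp only [h2, integral_neg] at h1
  linarith

/-- Left translation by a diagonal sign matrix with entry `-1` at `a` flips the sign of the entry,
so its mean vanishes. In `𝒪(d)` this matrix is `-1`; in `𝒮𝒪(d)` two signs must be flipped, which
requires `d ≠ 1`. The group `𝒮𝒪(1)` is trivial. -/
theorem integral_toMat (a b : Fin d) :
    ∫ x, toMat x a b ∂(unif d 𝒢) = haarMean d 𝒢 * (1 : Matrix (Fin d) (Fin d) ℝ) a b := by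
  by_cases h : haarMean d 𝒢 = 0
  · rw [h, zero_mul]
    cases 𝒢 with
    | orthogonal =>
      set s : Fin d → ℝ := fun _ => -1
      exact integral_toMat_eq_zero_of_reflection
        (⟨⟨_, diagonal_mem_orthogonalGroup s fun _ => by norm_num [s]⟩, trivial⟩ :
          grp d .orthogonal) s rfl a b rfl
    | rotation =>
      have hd : d ≠ 1 := by
        intro hd
        simp [haarMean, hd] at h
      obtain ⟨a', ha'⟩ : ∃ a', a' ≠ a := by
        have : Nontrivial (Fin d) := Fin.nontrivial_iff_two_le.2 (by have := a.pos; omega)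
        exact exists_ne a
      set s : Fin d → ℝ := fun c => if c = a ∨ c = a' then -1 else 1 with hs
      have hdet : (Matrix.diagonal s).det = 1 := by
        rw [Matrix.det_diagonal, hs, prod_ite, prod_const, prod_const_one, mul_one]
        have : (univ.filter fun c => c = a ∨ c = a') = {a, a'} := by ext; simp
        rw [this, card_pair ha'.symm]
        norm_num
      have hss : ∀ c, s c * s c = 1 := fun c => by
        simp only [hs]; split_ifs <;> norm_num
      exact integral_toMat_eq_zero_of_reflection
        (⟨⟨_, diagonal_mem_orthogonalGroup s hss⟩, hdet⟩ : grp d .rotation) s rfl a b (by simp [hs])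
  · have h1 : haarMean d 𝒢 = 1 := by
      cases 𝒢 with
      | orthogonal => exact absurd rfl h
      | rotation =>
        by_cases hd : d = 1
        · simp [haarMean, hd]
        · exact absurd (by simp [haarMean, hd]) h
    simp only [toMat_eq_one h, h1, one_mul]
    simp

end Haar

/-! ### Random matrices driven by independent pairs. -/

section NoiseModel

variable {ι X : Type*} [MeasurableSpace X] {n : ℕ}

/-- The centred contributions of a symmetric random matrix whose entry `(x, y)` is
`φ x y (ω (pr x, pr y))` for `pr x < pr y`, and whose entries vanish for `pr x = pr y`. -/
noncomputable def pairNoise (ν : Fin n × Fin n → Measure X) (pr : ι → Fin n) (φ : ι → ι → X → ℝ)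
    (x y : ι) (e : Fin n × Fin n) (z : X) : ℝ :=
  if pr x < pr y then
    if e = (pr x, pr y) then φ x y z - ∫ w, φ x y w ∂(ν (pr x, pr y)) else 0
  else if pr y < pr x then
    if e = (pr y, pr x) then φ y x z - ∫ w, φ y x w ∂(ν (pr y, pr x)) else 0
  else 0

theorem randMat_pairNoise (ν : Fin n × Fin n → Measure X) (pr : ι → Fin n) (φ : ι → ι → X → ℝ)
    (ω : Fin n × Fin n → X) (x y : ι) :
    randMat (pairNoise ν pr φ) ω x y =
      if pr x < pr y then φ x y (ω (pr x, pr y)) - ∫ w, φ x y w ∂(ν (pr x, pr y))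
      else if pr y < pr x then φ y x (ω (pr y, pr x)) - ∫ w, φ y x w ∂(ν (pr y, pr x))
      else 0 := by
  simp only [randMat, Matrix.of_apply, pairNoise]
  split_ifs <;> simp

/-- A pair affects at most `δ²` entries and their mirror images, each by at most `2` after centring;
this gives `4 δ²`. Centring at most doubles the absolute moment, which gives `2 P`. -/
theorem isNoise_pairNoise [Fintype ι] (ν : Fin n × Fin n → Measure X) [∀ e, IsProbabilityMeasure (ν e)]
    (pr : ι → Fin n) (φ : ι → ι → X → ℝ) (δ : ℕ)
    (hδ : ∀ i, (univ.filter fun x => pr x = i).card ≤ δ) (hm : ∀ x y, Measurable (φ x y))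
    (hb : ∀ x y z, |φ x y z| ≤ 1) {P : ℝ} (hP : ∀ x y, ∫ z, |φ x y z| ∂(ν (pr x, pr y)) ≤ P)
    (hP0 : 0 ≤ P) : IsNoise ν (pairNoise ν pr φ) (4 * δ ^ 2) (2 * P) := by
  have hint : ∀ x y e, Integrable (φ x y) (ν e) := fun x y e =>
    integrable_of_abs_le _ (hm x y) 1 (hb x y)
  have hmean : ∀ x y e, |∫ w, φ x y w ∂(ν e)| ≤ 1 := fun x y e => by
    refine (abs_integral_le_integral_abs).trans ?_
    calc ∫ w, |φ x y w| ∂(ν e) ≤ ∫ _, (1 : ℝ) ∂(ν e) :=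
          integral_mono (hint x y e).abs (integrable_const _) fun z => hb x y z
      _ = 1 := by simp
  have habs : ∀ x y, ∫ z, |φ x y z - ∫ w, φ x y w ∂(ν (pr x, pr y))| ∂(ν (pr x, pr y)) ≤ 2 * P := by
    intro x y
    set M := ∫ w, φ x y w ∂(ν (pr x, pr y))
    have hM : |M| ≤ P := (abs_integral_le_integral_abs).trans (hP x y)
    calc ∫ z, |φ x y z - M| ∂(ν (pr x, pr y)) ≤ ∫ z, (|φ x y z| + |M|) ∂(ν (pr x, pr y)) :=
          integral_mono ((hint x y _).sub (integrable_const _)).abs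
            ((hint x y _).abs.add (integrable_const _)) fun z => abs_sub _ _
      _ = ∫ z, |φ x y z| ∂(ν (pr x, pr y)) + |M| := by
          rw [integral_add (hint x y _).abs (integrable_const _)]; simp
      _ ≤ 2 * P := by linarith [hP x y]
  have hcen : ∀ x y e, ∫ z, (φ x y z - ∫ w, φ x y w ∂(ν e)) ∂(ν e) = 0 := fun x y e => by
    rw [integral_sub (hint x y e) (integrable_const _)]; simp
  refine ⟨?_, ?_, ?_, ?_, ?_⟩
  · intro x y e
    unfold pairNoise
    split_ifs
    · exact (hm x y).sub_const _
    · exact measurable_const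
    · exact (hm y x).sub_const _
    · exact measurable_const
    · exact measurable_const
  · intro e z
    have hpt : ∀ x y, |pairNoise ν pr φ x y e z| ≤
        2 * ((if pr x = e.1 then 1 else 0) * (if pr y = e.2 then 1 else 0)) +
        2 * ((if pr x = e.2 then 1 else 0) * (if pr y = e.1 then 1 else 0)) := by
      intro x y
      have h2 : ∀ x y e', |φ x y z - ∫ w, φ x y w ∂(ν e')| ≤ 2 := fun x y e' =>
        (abs_sub _ _).trans (by linarith [hb x y z, hmean x y e'])
      unfold pairNoise
      have h0 : (0 : ℝ) ≤ 2 * ((if pr x = e.1 then 1 else 0) * (if pr y = e.2 then 1 else 0)) := by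
        split_ifs <;> norm_num
      have h0' : (0 : ℝ) ≤ 2 * ((if pr x = e.2 then 1 else 0) * (if pr y = e.1 then 1 else 0)) := by
        split_ifs <;> norm_num
      by_cases h1 : pr x < pr y
      · rw [if_pos h1]
        by_cases h3 : e = (pr x, pr y)
        · rw [if_pos h3]
          subst h3
          rw [if_pos (rfl : pr x = pr x), if_pos (rfl : pr y = pr y)]
          linarith [h2 x y (pr x, pr y)]
        · rw [if_neg h3, abs_zero]
          exact add_nonneg h0 h0'
      · rw [if_neg h1]
        by_cases h3 : pr y < pr x ∧ e = (pr y, pr x)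
        · rw [if_pos h3.1, if_pos h3.2]
          obtain ⟨-, rfl⟩ := h3
          rw [if_pos (rfl : pr x = pr x), if_pos (rfl : pr y = pr y)]
          linarith [h2 y x (pr y, pr x)]
        · rw [← ite_and, if_neg h3, abs_zero]
          exact add_nonneg h0 h0'
    refine (sum_le_sum fun x _ => sum_le_sum fun y _ => hpt x y).trans ?_
    simp only [sum_add_distrib, ← mul_sum, ← sum_mul, sum_boole]
    have hc : ∀ i, ((univ.filter fun x => pr x = i).card : ℝ) ≤ δ := fun i => by
      exact_mod_cast hδ i
    have h1 := mul_le_mul (hc e.1) (hc e.2) (by positivity) (by positivity)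
    have h2 := mul_le_mul (hc e.2) (hc e.1) (by positivity) (by positivity)
    linarith
  · intro x y e
    unfold pairNoise
    split_ifs with h1 h2 h1 h2
    · rw [h2]; exact hcen x y _
    · simp
    · rw [h2]; exact hcen y x _
    · simp
    · simp
  · intro x y
    unfold pairNoise
    by_cases h1 : pr x < pr y
    · simp only [if_pos h1]
      rw [sum_eq_single (pr x, pr y) (fun e _ he => by simp [he]) (by simp)]
      simpa using habs x y
    · by_cases h2 : pr y < pr x
      · simp only [if_neg h1, if_pos h2]
        rw [sum_eq_single (pr y, pr x) (fun e _ he => by simp [he]) (by simp)]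
        simpa using habs y x
      · simp [if_neg h1, if_neg h2, hP0]
  · intro x y e z
    unfold pairNoise
    rcases lt_trichotomy (pr x) (pr y) with h | h | h
    · simp [h, h.not_gt]
    · simp [h]
    · simp [h, h.not_gt]

end NoiseModel

end SGBM

/-! ### Signal and noise of the observation and of its adjacency matrix. -/

namespace SGBM

open MeasureTheory ProbabilityTheory Finset

section Model

variable {n K m d : ℕ} {𝒢 : GroupKind}

/-- The law of the edge indicator and of the outlier of one pair. -/
noncomputable def edgeMeasure (d : ℕ) (𝒢 : GroupKind) (p q : ℝ) (C : Fin n → Fin K)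
    (e : Fin n × Fin n) : Measure (Bool × grp d 𝒢) :=
  (bernoulliMeasure true false
    (Set.projIcc (0 : ℝ) 1 zero_le_one (if C e.1 = C e.2 then p else q))).prod (unif d 𝒢)

theorem sampleMeasure_eq (p q : ℝ) (C : Fin n → Fin K) :
    sampleMeasure d 𝒢 p q C = Measure.pi (edgeMeasure d 𝒢 p q C) := rfl

instance (p q : ℝ) (C : Fin n → Fin K) (e : Fin n × Fin n) :
    IsProbabilityMeasure (edgeMeasure d 𝒢 p q C e) := by
  unfold edgeMeasure; infer_instance

instance (p q : ℝ) (C : Fin n → Fin K) : IsProbabilityMeasure (sampleMeasure d 𝒢 p q C) := by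
  rw [sampleMeasure_eq]; infer_instance

theorem integral_edgeMeasure {p q : ℝ} (hp0 : 0 ≤ p) (hp1 : p ≤ 1) (hq0 : 0 ≤ q) (hq1 : q ≤ 1)
    (C : Fin n → Fin K) (e : Fin n × Fin n) {ψ : grp d 𝒢 → ℝ} (hψ : Measurable ψ)
    (hb : ∀ g, |ψ g| ≤ 1) :
    ∫ z, (if z.1 = true then ψ z.2 else 0) ∂(edgeMeasure d 𝒢 p q C e) =
      (if C e.1 = C e.2 then p else q) * ∫ g, ψ g ∂(unif d 𝒢) := by
  have hmem : (if C e.1 = C e.2 then p else q) ∈ Set.Icc (0 : ℝ) 1 := by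
    split_ifs <;> exact ⟨‹_›, ‹_›⟩
  have hmeas : Measurable fun z : Bool × grp d 𝒢 => if z.1 = true then ψ z.2 else 0 :=
    Measurable.ite (measurable_fst (measurableSet_singleton true)) (hψ.comp measurable_snd)
      measurable_const
  have hbd : ∀ z : Bool × grp d 𝒢, |if z.1 = true then ψ z.2 else 0| ≤ 1 := fun z => by
    split_ifs
    · exact hb _
    · simp
  unfold edgeMeasure
  rw [integral_prod _ (integrable_of_abs_le _ hmeas 1 hbd), integral_bernoulliMeasure,
    Set.projIcc_of_mem _ hmem]
  simp

/-- The entry of the observation that the randomness `z` of the pair `(x.1, y.1)` produces. -/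
noncomputable def blockEntry (C : Fin n → Fin K) (R : Fin n → grp d 𝒢) (x y : Fin n × Fin d)
    (z : Bool × grp d 𝒢) : ℝ :=
  if z.1 = true then
    (if C x.1 = C y.1 then (toMat (R x.1) * (toMat (R y.1)).transpose) x.2 y.2
      else toMat z.2 x.2 y.2)
  else 0

/-- The entry of the adjacency matrix. -/
def edgeEntry (_ _ : Fin n) (z : Bool × grp d 𝒢) : ℝ := if z.1 = true then 1 else 0

theorem mul_transpose_mem (g h : grp d 𝒢) :
    toMat g * (toMat h).transpose ∈ Matrix.orthogonalGroup (Fin d) ℝ :=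
  mul_mem (toMat_mem g) (transpose_mem_orthogonalGroup (toMat_mem h))

theorem measurable_blockEntry (C : Fin n → Fin K) (R : Fin n → grp d 𝒢) (x y : Fin n × Fin d) :
    Measurable (blockEntry C R x y) := by
  unfold blockEntry
  refine Measurable.ite (measurable_fst (measurableSet_singleton true)) ?_ measurable_const
  split_ifs
  · exact measurable_const
  · exact (measurable_toMat_apply _ _).comp measurable_snd

theorem abs_blockEntry_le (C : Fin n → Fin K) (R : Fin n → grp d 𝒢) (x y : Fin n × Fin d)
    (z : Bool × grp d 𝒢) : |blockEntry C R x y z| ≤ if z.1 = true then 1 else 0 := by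
  unfold blockEntry
  split_ifs
  · exact abs_apply_le_one_of_mem_orthogonalGroup (mul_transpose_mem _ _) _ _
  · exact abs_apply_le_one_of_mem_orthogonalGroup (toMat_mem _) _ _
  · simp

/-- Across clusters too the mean may be written with `R_i R_jᵀ`: either `haarMean` vanishes, or
every group element is the identity. This places the whole mean in the span of the ground truth. -/
theorem integral_blockEntry {p q : ℝ} (hp0 : 0 ≤ p) (hp1 : p ≤ 1) (hq0 : 0 ≤ q) (hq1 : q ≤ 1)
    (C : Fin n → Fin K) (R : Fin n → grp d 𝒢) (x y : Fin n × Fin d) :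
    ∫ z, blockEntry C R x y z ∂(edgeMeasure d 𝒢 p q C (x.1, y.1)) =
      (if C x.1 = C y.1 then p else q * haarMean d 𝒢) *
        (toMat (R x.1) * (toMat (R y.1)).transpose) x.2 y.2 := by
  unfold blockEntry
  have hψ : Measurable fun g : grp d 𝒢 => if C x.1 = C y.1 then
      (toMat (R x.1) * (toMat (R y.1)).transpose) x.2 y.2 else toMat g x.2 y.2 := by
    split_ifs
    · exact measurable_const
    · exact measurable_toMat_apply _ _
  have hb : ∀ g : grp d 𝒢, |if C x.1 = C y.1 then
      (toMat (R x.1) * (toMat (R y.1)).transpose) x.2 y.2 else toMat g x.2 y.2| ≤ 1 := by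
    intro g
    split_ifs
    · exact abs_apply_le_one_of_mem_orthogonalGroup (mul_transpose_mem _ _) _ _
    · exact abs_apply_le_one_of_mem_orthogonalGroup (toMat_mem _) _ _
  rw [integral_edgeMeasure hp0 hp1 hq0 hq1 C (x.1, y.1) hψ hb]
  by_cases h : C x.1 = C y.1
  · simp [h]
  · simp only [h, if_false, integral_toMat]
    by_cases h0 : haarMean d 𝒢 = 0
    · simp [h0]
    · simp only [toMat_eq_one h0]
      simp [mul_assoc]

theorem integral_edgeEntry {p q : ℝ} (hp0 : 0 ≤ p) (hp1 : p ≤ 1) (hq0 : 0 ≤ q) (hq1 : q ≤ 1)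
    (C : Fin n → Fin K) (i j : Fin n) :
    ∫ z, edgeEntry (d := d) (𝒢 := 𝒢) i j z ∂(edgeMeasure d 𝒢 p q C (i, j)) =
      if C i = C j then p else q := by
  unfold edgeEntry
  have := integral_edgeMeasure (d := d) (𝒢 := 𝒢) hp0 hp1 hq0 hq1 C (i, j)
    (ψ := fun _ => 1) measurable_const (by simp)
  rw [this]; simp

theorem measurable_edgeEntry (i j : Fin n) : Measurable (edgeEntry (d := d) (𝒢 := 𝒢) i j) :=
  Measurable.ite (measurable_fst (measurableSet_singleton true)) measurable_const measurable_const

/-- The noise part of the observation. -/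
noncomputable abbrev blockNoise (p q : ℝ) (C : Fin n → Fin K) (R : Fin n → grp d 𝒢) :
    Fin n × Fin d → Fin n × Fin d → Fin n × Fin n → Bool × grp d 𝒢 → ℝ :=
  pairNoise (edgeMeasure d 𝒢 p q C) Prod.fst (blockEntry C R)

/-- The noise part of the adjacency matrix. -/
noncomputable abbrev edgeNoise (d : ℕ) (𝒢 : GroupKind) (p q : ℝ) (C : Fin n → Fin K) :
    Fin n → Fin n → Fin n × Fin n → Bool × grp d 𝒢 → ℝ :=
  pairNoise (edgeMeasure d 𝒢 p q C) id edgeEntry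

theorem integral_abs_edgeEntry_le {p q P : ℝ} (hp0 : 0 ≤ p) (hp1 : p ≤ 1) (hq0 : 0 ≤ q)
    (hq1 : q ≤ 1) (hp : p ≤ P) (hq : q ≤ P) (C : Fin n → Fin K) (i j : Fin n) :
    ∫ z, (if z.1 = true then (1 : ℝ) else 0) ∂(edgeMeasure d 𝒢 p q C (i, j)) ≤ P := by
  have := integral_edgeEntry (d := d) (𝒢 := 𝒢) hp0 hp1 hq0 hq1 C i j
  unfold edgeEntry at this
  rw [this]
  split_ifs <;> assumption

theorem isNoise_blockNoise {p q P : ℝ} (hp0 : 0 ≤ p) (hp1 : p ≤ 1) (hq0 : 0 ≤ q) (hq1 : q ≤ 1)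
    (hp : p ≤ P) (hq : q ≤ P) (C : Fin n → Fin K) (R : Fin n → grp d 𝒢) :
    IsNoise (edgeMeasure d 𝒢 p q C) (blockNoise p q C R) (4 * (d : ℝ) ^ 2) (2 * P) := by
  refine isNoise_pairNoise _ _ _ d (fun i => ?_) (measurable_blockEntry C R)
    (fun x y z => (abs_blockEntry_le C R x y z).trans (by split_ifs <;> norm_num))
    (fun x y => ?_) (hp0.trans hp)
  · refine (card_le_card_of_injOn Prod.snd (t := (univ : Finset (Fin d))) (fun _ _ => mem_univ _)
      ?_).trans (by simp)
    intro x hx y hy hxy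
    have hx' := (mem_filter.1 (mem_coe.1 hx)).2
    have hy' := (mem_filter.1 (mem_coe.1 hy)).2
    exact Prod.ext (hx'.trans hy'.symm) hxy
  · refine le_trans ?_ (integral_abs_edgeEntry_le (d := d) (𝒢 := 𝒢) hp0 hp1 hq0 hq1 hp hq C x.1 y.1)
    refine integral_mono_of_nonneg (ae_of_all _ fun z => abs_nonneg _) ?_
      (ae_of_all _ fun z => abs_blockEntry_le C R x y z)
    exact integrable_of_abs_le _ (measurable_edgeEntry x.1 y.1) 1 fun z => by
      split_ifs <;> norm_num

theorem isNoise_edgeNoise {p q P : ℝ} (hp0 : 0 ≤ p) (hp1 : p ≤ 1) (hq0 : 0 ≤ q) (hq1 : q ≤ 1)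
    (hp : p ≤ P) (hq : q ≤ P) (C : Fin n → Fin K) :
    IsNoise (edgeMeasure d 𝒢 p q C) (edgeNoise d 𝒢 p q C) 4 (2 * P) := by
  have h := isNoise_pairNoise (edgeMeasure d 𝒢 p q C) id edgeEntry 1 (fun i => ?_)
    measurable_edgeEntry (fun x y z => by unfold edgeEntry; split_ifs <;> norm_num) (P := P)
    (fun x y => ?_) (hp0.trans hp)
  · simpa using h
  · exact card_le_one.2 fun x hx y hy => by
      rw [mem_filter] at hx hy; exact hx.2.trans hy.2.symm
  · refine le_trans (le_of_eq ?_)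
      (integral_abs_edgeEntry_le (d := d) (𝒢 := 𝒢) hp0 hp1 hq0 hq1 hp hq C x y)
    refine integral_congr_ae (ae_of_all _ fun z => ?_)
    show |edgeEntry x y z| = if z.1 = true then 1 else 0
    by_cases hz : z.1 = true <;> simp [edgeEntry, hz]

/-- The normalized ground truth. -/
noncomputable abbrev signalBasis (m : ℕ) (C : Fin n → Fin K) (R : Fin n → grp d 𝒢) : VMat n K d :=
  (Real.sqrt m)⁻¹ • groundTruth C R

/-- The coefficient matrix of the signal in the basis `signalBasis`. -/
def signalCoeff (K d m : ℕ) (p q : ℝ) : Matrix (Fin K × Fin d) (Fin K × Fin d) ℝ :=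
  Matrix.of fun k l => if k.2 = l.2 then (m : ℝ) * (if k.1 = l.1 then p else q) else 0

theorem signalBasis_apply (C : Fin n → Fin K) (R : Fin n → grp d 𝒢) (x : Fin n × Fin d)
    (k : Fin K × Fin d) : signalBasis m C R x k =
      (Real.sqrt m)⁻¹ * (toMat (R x.1) x.2 k.2 * if C x.1 = k.1 then 1 else 0) := by
  simp [signalBasis, groundTruth, entangle, clusterMatrix]

theorem abs_signalBasis_le (C : Fin n → Fin K) (R : Fin n → grp d 𝒢) (x : Fin n × Fin d)
    (k : Fin K × Fin d) : |signalBasis m C R x k| ≤ (Real.sqrt m)⁻¹ := by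
  rw [signalBasis_apply, abs_mul, abs_of_nonneg (by positivity : (0 : ℝ) ≤ (Real.sqrt m)⁻¹)]
  refine mul_le_of_le_one_right (by positivity) ?_
  have := abs_apply_le_one_of_mem_orthogonalGroup (toMat_mem (R x.1)) x.2 k.2
  split_ifs <;> simp [this]

theorem signalBasis_transpose_mul {C : Fin n → Fin K} (hC : IsBalanced m C) (hm : 0 < m)
    (R : Fin n → grp d 𝒢) : (signalBasis m C R).transpose * signalBasis m C R = 1 := by
  have hm0 : (0 : ℝ) < m := by exact_mod_cast hm
  ext ⟨k, a⟩ ⟨l, b⟩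
  simp only [Matrix.mul_apply, Matrix.transpose_apply, signalBasis_apply, Fintype.sum_prod_type]
  have hRR : ∀ v, ∑ c, toMat (R v) c a * toMat (R v) c b = (1 : Matrix (Fin d) (Fin d) ℝ) a b := by
    intro v
    have h : (toMat (R v)).transpose * toMat (R v) = 1 :=
      (Matrix.mem_orthogonalGroup_iff' _ ℝ).1 (toMat_mem (R v))
    rw [← h, Matrix.mul_apply]; rfl
  have hs : (Real.sqrt m)⁻¹ * (Real.sqrt m)⁻¹ = (m : ℝ)⁻¹ := by
    rw [← mul_inv, Real.mul_self_sqrt hm0.le]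
  have h1 : ∀ v, ∑ c, (Real.sqrt m)⁻¹ * (toMat (R v) c a * if C v = k then 1 else 0) *
      ((Real.sqrt m)⁻¹ * (toMat (R v) c b * if C v = l then 1 else 0)) =
      (m : ℝ)⁻¹ * (1 : Matrix (Fin d) (Fin d) ℝ) a b *
        if k = l then (if C v = k then 1 else 0) else 0 := by
    intro v
    rw [← hRR v, ← hs, mul_sum, sum_mul]
    refine sum_congr rfl fun c _ => ?_
    by_cases h1 : C v = k
    · by_cases h2 : k = l
      · simp [h1, h2]; ring
      · simp [h1, h2]
    · by_cases h2 : k = l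
      · subst h2; simp [h1]
      · simp [h1, h2]
  simp only [h1, ← mul_sum]
  by_cases h2 : k = l
  · subst h2
    simp only [if_true]
    rw [sum_boole, hC k]
    by_cases h3 : a = b
    · subst h3; simp [hm0.ne']
    · simp [h3]
  · simp [h2, Matrix.one_apply]

theorem signal_apply (hm : 0 < m) (C : Fin n → Fin K) (R : Fin n → grp d 𝒢) (p q : ℝ)
    (x y : Fin n × Fin d) :
    (signalBasis m C R * signalCoeff K d m p q * (signalBasis m C R).transpose) x y =
      (if C x.1 = C y.1 then p else q) *
        (toMat (R x.1) * (toMat (R y.1)).transpose) x.2 y.2 := by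
  have hm0 : (0 : ℝ) < m := by exact_mod_cast hm
  have hs : (Real.sqrt m)⁻¹ * (Real.sqrt m)⁻¹ * (m : ℝ) = 1 := by
    rw [← mul_inv, Real.mul_self_sqrt hm0.le, inv_mul_cancel₀ hm0.ne']
  have h1 : ∀ k : Fin K × Fin d, (signalBasis m C R * signalCoeff K d m p q) x k =
      (Real.sqrt m)⁻¹ * (m : ℝ) * (if C x.1 = k.1 then p else q) * toMat (R x.1) x.2 k.2 := by
    intro k
    simp only [Matrix.mul_apply, signalBasis_apply, signalCoeff, Matrix.of_apply,
      Fintype.sum_prod_type]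
    rw [sum_eq_single (C x.1) (fun l _ hl => by simp [Ne.symm hl]) (by simp)]
    rw [sum_eq_single k.2 (fun l _ hl => by simp [hl]) (by simp)]
    simp only [if_true, mul_one]; ring
  simp only [Matrix.mul_apply (M := signalBasis m C R * signalCoeff K d m p q), h1,
    Matrix.transpose_apply, signalBasis_apply, Fintype.sum_prod_type]
  rw [sum_eq_single (C y.1) (fun l _ hl => by simp [Ne.symm hl]) (by simp), Matrix.mul_apply,
    mul_sum]
  refine sum_congr rfl fun c _ => ?_
  rw [Matrix.transpose_apply]
  simp only [if_true]
  linear_combination ((if C x.1 = C y.1 then p else q) * toMat (R x.1) x.2 c *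
    toMat (R y.1) y.2 c) * hs

/-- The coefficient matrix is `m ((p - q) I + q J) ⊗ I_d` with the all-ones matrix `J`, which is
positive semidefinite. -/
theorem signalCoeff_ge {p q : ℝ} (hq : 0 ≤ q) (w : Fin K × Fin d → ℝ) :
    (m : ℝ) * (p - q) * ∑ k, w k ^ 2 ≤ dotProduct w ((signalCoeff K d m p q).mulVec w) := by
  have h1 : ∀ k a, (signalCoeff K d m p q).mulVec w (k, a) =
      m * ((p - q) * w (k, a) + q * ∑ l, w (l, a)) := by
    intro k a
    simp only [Matrix.mulVec, dotProduct, signalCoeff, Matrix.of_apply, Fintype.sum_prod_type]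
    have : ∀ l, ∑ b, (if a = b then (m : ℝ) * (if k = l then p else q) else 0) * w (l, b) =
        m * ((if k = l then (p - q) * w (l, a) else 0) + q * w (l, a)) := by
      intro l
      rw [sum_eq_single a (fun b _ hb => by simp [Ne.symm hb]) (by simp)]
      rw [if_pos rfl]
      by_cases h : k = l
      · rw [if_pos h, if_pos h]; ring
      · rw [if_neg h, if_neg h]; ring
    simp only [this, ← mul_sum, sum_add_distrib, sum_ite_eq, mem_univ, if_true]
  have h2 : dotProduct w ((signalCoeff K d m p q).mulVec w) =
      m * (p - q) * ∑ k, w k ^ 2 + m * q * ∑ a, (∑ k, w (k, a)) ^ 2 := by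
    simp only [dotProduct, Fintype.sum_prod_type, h1]
    have h3 : ∑ a, (∑ k, w (k, a)) ^ 2 = ∑ k, ∑ a, w (k, a) * ∑ l, w (l, a) := by
      rw [sum_comm]
      refine sum_congr rfl fun a _ => ?_
      rw [pow_two, sum_mul]
    rw [h3, mul_sum, mul_sum, ← sum_add_distrib]
    refine sum_congr rfl fun k _ => ?_
    rw [mul_sum, mul_sum, ← sum_add_distrib]
    exact sum_congr rfl fun a _ => by ring
  rw [h2]
  have : 0 ≤ (m : ℝ) * q * ∑ a, (∑ k, w (k, a)) ^ 2 := by positivity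
  linarith

/-- The observation splits into a multiple of the identity, the low-rank signal and the noise. -/
theorem observation_eq (hm : 0 < m) {p q : ℝ} (hp0 : 0 ≤ p) (hp1 : p ≤ 1) (hq0 : 0 ≤ q)
    (hq1 : q ≤ 1) (C : Fin n → Fin K) (R : Fin n → grp d 𝒢) (ω : Sample n d 𝒢) :
    observation C R ω = (1 - p) • (1 : Obs n d) +
      signalBasis m C R * signalCoeff K d m p (q * haarMean d 𝒢) * (signalBasis m C R).transpose +
      randMat (blockNoise p q C R) ω := by
  ext ⟨i, a⟩ ⟨j, b⟩
  rw [Matrix.add_apply, Matrix.add_apply, signal_apply hm, randMat_pairNoise,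
    integral_blockEntry hp0 hp1 hq0 hq1, integral_blockEntry hp0 hp1 hq0 hq1]
  simp only [observation, Matrix.of_apply, Matrix.smul_apply, smul_eq_mul]
  have hu : ∀ i j a b, upperBlock C R ω i j a b = blockEntry C R (i, a) (j, b) (ω (i, j)) := by
    intro i j a b
    simp only [upperBlock, blockEntry]
    split_ifs <;> rfl
  rcases lt_trichotomy i j with h | h | h
  · have hne : ((i, a) : Fin n × Fin d) ≠ (j, b) := fun h' => h.ne (congrArg Prod.fst h')
    rw [if_pos h, if_pos h, hu, Matrix.one_apply_ne hne]
    ring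
  · subst h
    -- The signal contributes `p` times the identity to a diagonal block, and the term `(1 - p) • 1`
    -- supplies the remainder.
    have h1 : toMat (R i) * (toMat (R i)).transpose = 1 :=
      (Matrix.mem_orthogonalGroup_iff _ ℝ).1 (toMat_mem (R i))
    simp only [lt_irrefl, if_false, if_true, h1, Matrix.one_apply, Prod.mk.injEq, true_and]
    split_ifs <;> ring
  · have hne : ((i, a) : Fin n × Fin d) ≠ (j, b) := fun h' => h.ne' (congrArg Prod.fst h')
    have h1 : (toMat (R j) * (toMat (R i)).transpose) b a =
        (toMat (R i) * (toMat (R j)).transpose) a b := by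
      rw [← Matrix.transpose_apply (toMat (R j) * (toMat (R i)).transpose), Matrix.transpose_mul,
        Matrix.transpose_transpose]
    have h2 : (if C j = C i then p else q * haarMean d 𝒢) =
        if C i = C j then p else q * haarMean d 𝒢 := by simp only [eq_comm]
    rw [if_neg h.not_gt, if_pos h, if_neg h.not_gt, if_pos h, hu, Matrix.one_apply_ne hne]
    simp only [h1, h2]
    ring

theorem observation_isSymm (C : Fin n → Fin K) (R : Fin n → grp d 𝒢) (ω : Sample n d 𝒢) :
    (observation C R ω).IsSymm := by
  ext ⟨i, a⟩ ⟨j, b⟩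
  simp only [Matrix.transpose_apply, observation, Matrix.of_apply]
  rcases lt_trichotomy i j with h | h | h
  · rw [if_neg h.not_gt, if_pos h, if_pos h]
  · subst h
    simp only [lt_irrefl, if_false, Matrix.one_apply, eq_comm]
  · rw [if_pos h, if_neg h.not_gt, if_pos h]

/-- The normalized cluster indicators. -/
noncomputable abbrev clusterBasis (m : ℕ) (C : Fin n → Fin K) : Matrix (Fin n) (Fin K) ℝ :=
  (Real.sqrt m)⁻¹ • clusterMatrix C

/-- The coefficient matrix of the mean adjacency matrix in the basis `clusterBasis`. -/
def clusterCoeff (K m : ℕ) (p q : ℝ) : Matrix (Fin K) (Fin K) ℝ :=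
  Matrix.of fun k l => (m : ℝ) * (if k = l then p else q)

theorem clusterBasis_transpose_mul {C : Fin n → Fin K} (hC : IsBalanced m C) (hm : 0 < m) :
    (clusterBasis m C).transpose * clusterBasis m C = 1 := by
  have hm0 : (0 : ℝ) < m := by exact_mod_cast hm
  ext k l
  simp only [Matrix.mul_apply, Matrix.transpose_apply, clusterBasis, clusterMatrix,
    Matrix.smul_apply, Matrix.of_apply, smul_eq_mul]
  have hs : (Real.sqrt m)⁻¹ * (Real.sqrt m)⁻¹ = (m : ℝ)⁻¹ := by
    rw [← mul_inv, Real.mul_self_sqrt hm0.le]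
  have h1 : ∀ v, (Real.sqrt m)⁻¹ * (if C v = k then (1 : ℝ) else 0) *
      ((Real.sqrt m)⁻¹ * (if C v = l then 1 else 0)) =
      (m : ℝ)⁻¹ * if k = l then (if C v = k then 1 else 0) else 0 := by
    intro v
    rw [← hs]
    by_cases h1 : C v = k
    · by_cases h2 : k = l <;> simp [h1, h2]
    · by_cases h2 : k = l
      · subst h2; simp [h1]
      · simp [h1, h2]
  simp only [h1, ← mul_sum]
  by_cases h2 : k = l
  · subst h2
    simp only [if_true]
    rw [sum_boole, hC k]
    simp [hm0.ne']
  · simp [h2]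

theorem clusterSignal_apply (hm : 0 < m) (C : Fin n → Fin K) (p q : ℝ) (x y : Fin n) :
    (clusterBasis m C * clusterCoeff K m p q * (clusterBasis m C).transpose) x y =
      if C x = C y then p else q := by
  have hm0 : (0 : ℝ) < m := by exact_mod_cast hm
  have hs : (Real.sqrt m)⁻¹ * (Real.sqrt m)⁻¹ * (m : ℝ) = 1 := by
    rw [← mul_inv, Real.mul_self_sqrt hm0.le, inv_mul_cancel₀ hm0.ne']
  simp only [Matrix.mul_apply, clusterBasis, clusterCoeff, clusterMatrix, Matrix.smul_apply,
    Matrix.of_apply, smul_eq_mul, Matrix.transpose_apply]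
  rw [sum_eq_single (C y) (fun l _ hl => by simp [Ne.symm hl]) (by simp),
    sum_eq_single (C x) (fun l _ hl => by simp [Ne.symm hl]) (by simp)]
  simp only [if_true]
  linear_combination (if C x = C y then p else q) * hs

theorem clusterCoeff_ge {p q : ℝ} (hq : 0 ≤ q) (w : Fin K → ℝ) :
    (m : ℝ) * (p - q) * ∑ k, w k ^ 2 ≤ dotProduct w ((clusterCoeff K m p q).mulVec w) := by
  have h1 : ∀ k, (clusterCoeff K m p q).mulVec w k = m * ((p - q) * w k + q * ∑ l, w l) := by
    intro k
    simp only [Matrix.mulVec, dotProduct, clusterCoeff, Matrix.of_apply]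
    have : ∀ l, (m : ℝ) * (if k = l then p else q) * w l =
        m * ((if k = l then (p - q) * w l else 0) + q * w l) := by
      intro l
      split_ifs <;> ring
    simp only [this, ← mul_sum, sum_add_distrib, sum_ite_eq, mem_univ, if_true]
  have h2 : dotProduct w ((clusterCoeff K m p q).mulVec w) =
      m * (p - q) * ∑ k, w k ^ 2 + m * q * (∑ k, w k) ^ 2 := by
    simp only [dotProduct, h1]
    have h3 : (∑ k, w k) ^ 2 = ∑ k, w k * ∑ l, w l := by rw [pow_two, sum_mul]
    rw [h3, mul_sum univ (fun k => w k ^ 2), mul_sum univ (fun k => w k * ∑ l, w l), ← sum_add_distrib]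
    exact sum_congr rfl fun k _ => by ring
  rw [h2]
  have : 0 ≤ (m : ℝ) * q * (∑ k, w k) ^ 2 := by positivity
  linarith

theorem orthogonalGroup_ne_zero (hd : 1 ≤ d) {Q : Matrix (Fin d) (Fin d) ℝ}
    (hQ : Q ∈ Matrix.orthogonalGroup (Fin d) ℝ) : Q ≠ 0 := by
  rintro rfl
  have := frob_sq_orthogonal hQ
  rw [frob_sq] at this
  simp only [Matrix.zero_apply, ne_eq, OfNat.ofNat_ne_zero, not_false_eq_true, zero_pow,
    sum_const_zero] at this
  have : d = 0 := by exact_mod_cast this.symm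
  omega

/-- For `d ≥ 1` orthogonal matrices are nonzero, so a block vanishes exactly when its edge is
absent. The adjacency matrix is therefore a stochastic block model with self-loops, whatever the
group. -/
theorem adjacency_eq (hd : 1 ≤ d) (hm : 0 < m) {p q : ℝ} (hp0 : 0 ≤ p) (hp1 : p ≤ 1) (hq0 : 0 ≤ q)
    (hq1 : q ≤ 1) (C : Fin n → Fin K) (R : Fin n → grp d 𝒢) (ω : Sample n d 𝒢) :
    adjacency (observation C R ω) = (1 - p) • (1 : Matrix (Fin n) (Fin n) ℝ) +
      clusterBasis m C * clusterCoeff K m p q * (clusterBasis m C).transpose +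
      randMat (edgeNoise d 𝒢 p q C) ω := by
  ext i j
  rw [Matrix.add_apply, Matrix.add_apply, clusterSignal_apply hm, randMat_pairNoise]
  simp only [id, integral_edgeEntry hp0 hp1 hq0 hq1]
  simp only [adjacency, Matrix.of_apply, Matrix.smul_apply, smul_eq_mul]
  have hub : ∀ i j, upperBlock C R ω i j = 0 ↔ ¬ (ω (i, j)).1 = true := by
    intro i j
    unfold upperBlock
    split_ifs with h1 h2
    · simpa [h1] using orthogonalGroup_ne_zero hd (mul_transpose_mem (R i) (R j))
    · simpa [h1] using orthogonalGroup_ne_zero hd (toMat_mem (ω (i, j)).2)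
    · simp [h1]
  rcases lt_trichotomy i j with h | h | h
  · have hb : blk (observation C R ω) i j = upperBlock C R ω i j := by
      ext a b; simp [blk, observation, h]
    rw [if_pos h, Matrix.one_apply_ne h.ne]
    simp only [hb, hub, edgeEntry]
    by_cases h1 : (ω (i, j)).1 = true <;> simp [h1]
  · subst h
    have hb : blk (observation C R ω) i i = 1 := by
      ext a b; simp [blk, observation]
    have h1 : (1 : Matrix (Fin d) (Fin d) ℝ) ≠ 0 := orthogonalGroup_ne_zero hd (one_mem _)
    simp [hb, h1]
  · have hb : blk (observation C R ω) i j = (upperBlock C R ω j i).transpose := by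
      ext a b; simp [blk, observation, h, h.not_gt]
    have h0 : (upperBlock C R ω j i).transpose = 0 ↔ upperBlock C R ω j i = 0 :=
      Matrix.transpose_eq_zero
    rw [if_neg h.not_gt, if_pos h, Matrix.one_apply_ne h.ne']
    have h2 : (if C j = C i then p else q) = if C i = C j then p else q := by
      simp only [eq_comm]
    simp only [hb, h0, hub, edgeEntry, h2]
    by_cases h1 : (ω (j, i)).1 = true <;> simp [h1]

end Model

end SGBM

/-! ### Spectral clustering under small noise. -/

namespace SGBM

open MeasureTheory ProbabilityTheory Finset

section Spectral

variable {n K m d : ℕ} {𝒢 : GroupKind}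

/-- Spectral clustering succeeds for most pivots once the noise is small relative to the
signal. -/
theorem SpectralClustering.le_toInitializer_of_noise_le (hd : 1 ≤ d) (hm : 0 < m) {μ : ℝ}
    (alg : SpectralClustering n m K d μ) (hμ : 0 < μ) (hμ2 : μ ≤ 1 / 2) {p q g t e s ρ : ℝ}
    (hp0 : 0 ≤ p) (hp1 : p ≤ 1) (hq0 : 0 ≤ q) (hq1 : q ≤ 1) (hg : 0 < g) (hpq : g ≤ m * (p - q))
    {C : Fin n → Fin K} (hC : IsBalanced m C) (R : Fin n → grp d 𝒢) (ω : Sample n d 𝒢)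
    (hN : ∀ u, |bil (randMat (blockNoise p q C R) ω) u u| ≤ g / 2 * ∑ x, u x ^ 2)
    (hN' : ∀ u, |bil (randMat (edgeNoise d 𝒢 p q C) ω) u u| ≤ g / 2 * ∑ x, u x ^ 2)
    (ht : ∑ x, ∑ k, (randMat (blockNoise p q C R) ω * signalBasis m C R) x k ^ 2 ≤ t)
    (ht' : ∑ x, ∑ k, (randMat (edgeNoise d 𝒢 p q C) ω * clusterBasis m C) x k ^ 2 ≤ t)
    (hte : 4 / g ^ 2 * t ≤ e) (he : e ≤ 1 / 8) (heμ : 64 * e < μ ^ 2) (hs : 0 < s) (hρ : 0 < ρ)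
    (hfin : 16 * e + 16 * K * s + 2 * d * (128 * K * e / μ ^ 2) ≤ 1 / ρ ^ 2) :
    ENNReal.ofReal (1 - (128 * K * e / μ ^ 2 + e / s)) ≤
      (alg.toInitializer (observation C R ω)).toOuterMeasure
        {V | V ∈ feasible n m K d ∧ estErr (groundTruth C R) V ≤ Real.sqrt m / ρ} := by
  classical
  have hm0 : (0 : ℝ) < m := by exact_mod_cast hm
  set A := observation C R ω with hA
  have hAs : A.IsSymm := observation_isSymm C R ω
  obtain ⟨W, σ, hW, hσ, hH⟩ := alg.H₀_spec A hAs
  -- The gap of the adjacency matrix serves the observation too: its cross-cluster mean `q *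
  -- haarMean` is no larger than `q`.
  have hpq' : g ≤ m * (p - q * haarMean d 𝒢) := hpq.trans
    (mul_le_mul_of_nonneg_left
      (sub_le_sub_left (mul_le_of_le_one_right hq0 (haarMean_le_one)) _) hm0.le)
  have hg4 : (0 : ℝ) ≤ 4 / g ^ 2 := by positivity
  obtain ⟨Y, e₁, he₁, hY, hYE⟩ := leadingEigs_perturbation hW (clusterBasis_transpose_mul hC hm) hg
    (adjacency_eq hd hm hp0 hp1 hq0 hq1 C R ω)
    (fun w => (mul_le_mul_of_nonneg_right hpq (by positivity)).trans (clusterCoeff_ge hq0 w))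
    (fun u => (le_abs_self _).trans (hN' u))
  obtain ⟨X, e₂, he₂, hX, hXE⟩ := leadingEigs_perturbation (alg.U_spec A hAs)
    (signalBasis_transpose_mul hC hm R) hg (observation_eq hm hp0 hp1 hq0 hq1 C R ω)
    (fun w => (mul_le_mul_of_nonneg_right hpq' (by positivity)).trans
      (signalCoeff_ge (mul_nonneg hq0 (haarMean_nonneg)) w))
    (fun u => (le_abs_self _).trans (hN u))
  have he₁' : e₁ ≤ e := (he₁.trans (mul_le_mul_of_nonneg_left ht' hg4)).trans hte
  have he₂' : e₂ ≤ e := (he₂.trans (mul_le_mul_of_nonneg_left ht hg4)).trans hte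
  have he0 : 0 ≤ e := le_trans (by positivity) (hYE.trans he₁')
  have hY' : ∀ a : Fin K → ℝ, (1 - e) * ∑ k, a k ^ 2 ≤ ∑ j, (∑ k, a k * Y k j) ^ 2 := fun a =>
    (mul_le_mul_of_nonneg_right (sub_le_sub_left he₁' 1) (by positivity)).trans (hY a)
  have hX' : ∀ a : Fin K × Fin d → ℝ, (1 - e) * ∑ k, a k ^ 2 ≤ ∑ j, (∑ k, a k * X k j) ^ 2 :=
    fun a => (mul_le_mul_of_nonneg_right (sub_le_sub_left he₂' 1) (by positivity)).trans (hX a)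
  obtain ⟨π, b, hb, hbe⟩ := exists_perm_of_perturbation hC hm hY' (hYE.trans he₁') hμ hμ2 he heμ hσ
  obtain ⟨τ, hτ, hHτ, hτb⟩ := hH.exists_card_le hC π hb
  have hE : ∑ v, frob (rowErr C R m (alg.U A) X v) ^ 2 ≤ e := by
    refine le_trans (le_of_eq ?_) (hXE.trans he₂')
    rw [Fintype.sum_prod_type]
    refine sum_congr rfl fun v _ => ?_
    rw [frob_sq]
    rfl
  have hKe : (0 : ℝ) ≤ K * e / μ ^ 2 := by positivity
  -- A pivot must be correctly clustered and have a small row error. Both exceptional sets are small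
  -- fractions of `m`, the second by Markov's inequality.
  set bad₁ := univ.filter fun v => τ v ≠ π (C v)
  set bad₂ := univ.filter fun v => s < m * frob (rowErr C R m (alg.U A) X v) ^ 2
  have h1 : (bad₁.card : ℝ) ≤ m * (128 * K * e / μ ^ 2) := by
    have : (bad₁.card : ℝ) ≤ 4 * b := by exact_mod_cast hτb
    refine this.trans ((mul_le_mul_of_nonneg_left hbe (by norm_num)).trans (le_of_eq ?_))
    ring
  have h2 : (bad₂.card : ℝ) ≤ m * (e / s) := by
    rw [← mul_div_assoc, le_div_iff₀ hs, ← nsmul_eq_mul]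
    refine (card_nsmul_le_sum bad₂ _ s fun v hv => (mem_filter.1 hv).2.le).trans ?_
    rw [← mul_sum]
    refine mul_le_mul_of_nonneg_left (le_trans ?_ hE) hm0.le
    exact sum_le_sum_of_subset_of_nonneg (subset_univ _) fun _ _ _ => sq_nonneg _
  have hcard : ((bad₁ ∪ bad₂).card : ℝ) / m ≤ 128 * K * e / μ ^ 2 + e / s := by
    rw [div_le_iff₀ hm0]
    have : ((bad₁ ∪ bad₂).card : ℝ) ≤ bad₁.card + bad₂.card := by
      exact_mod_cast card_union_le _ _
    linarith
  refine (ENNReal.ofReal_le_ofReal (sub_le_sub_left hcard 1)).trans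
    (alg.le_toInitializer hm hτ hHτ (bad₁ ∪ bad₂) _ fun t htk htb => ?_)
  have hone : ∀ v, alg.H₀ A v (τ v) = 1 := fun v => by simp [hHτ, clusterMatrix]
  have hspec := alg.R₀_spec A hAs t (fun k => by simp [hHτ, clusterMatrix, htk])
  rw [hHτ]
  refine ⟨⟨_, _, fun v => (hspec _ v (hone v)).1, clusterMatrix_mem hτ, rfl⟩, ?_⟩
  have hest := estErr_sq_le_of_pivots (b := bad₁.card) (s := s) hC hm (he.trans (by norm_num)) hX' hE
    le_rfl (t := t) (fun k => by
      by_contra h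
      exact htb k (mem_union_left _ (mem_filter.2 ⟨mem_univ _, fun h' => h (by rw [← h', htk])⟩)))
    (fun k => by
      by_contra h
      exact htb k (mem_union_right _ (mem_filter.2 ⟨mem_univ _, not_le.1 h⟩)))
    (fun v => (hspec _ v (hone v)).1) (fun v R' hR' => (hspec _ v (hone v)).2 R' hR')
  refine abs_le_of_sq_le_sq' ?_ (by positivity) |>.2
  refine hest.trans ?_
  rw [div_pow, Real.sq_sqrt hm0.le]
  have h3 : 2 * (d : ℝ) * bad₁.card ≤ 2 * d * (m * (128 * K * e / μ ^ 2)) :=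
    mul_le_mul_of_nonneg_left h1 (by positivity)
  have h4 := mul_le_mul_of_nonneg_left hfin hm0.le
  rw [mul_one_div] at h4
  linarith

end Spectral

end SGBM

/-! ### Success probability of spectral clustering. -/

namespace SGBM

open MeasureTheory ProbabilityTheory Finset Filter
open scoped ENNReal

section Spectral

variable {n K m d : ℕ} {𝒢 : GroupKind}

/-- Reduces a success probability to a bound valid off a bad event, through `(1 - ε) (1 - x) ≥ 1 -
(ε + x)`. -/
theorem ofReal_le_successProb {α β : ℝ} {C : Fin n → Fin K} {R : Fin n → grp d 𝒢}
    {alg : Initializer n K d} {S : Set (VMat n K d)} {bad : Set (Sample n d 𝒢)} {ε x : ℝ}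
    (hbad : (sampleMeasure d 𝒢 (α * Real.log n / n) (β * Real.log n / n) C).real bad ≤ ε)
    (hx : 0 ≤ x)
    (h : ∀ ω, ω ∉ bad → ENNReal.ofReal (1 - x) ≤ (alg (observation C R ω)).toOuterMeasure S) :
    ENNReal.ofReal (1 - (ε + x)) ≤ successProb α β C R alg S := by
  unfold successProb
  set P := sampleMeasure d 𝒢 (α * Real.log n / n) (β * Real.log n / n) C
  have hε : 0 ≤ ε := measureReal_nonneg.trans hbad
  by_cases hx1 : 1 ≤ x
  · rw [ENNReal.ofReal_of_nonpos (by linarith)]; exact zero_le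
  push Not at hx1
  -- The bad event is enlarged to a measurable hull of the same measure; no measurability of the
  -- algorithm is then needed.
  have hT : MeasurableSet (toMeasurable P bad)ᶜ := (measurableSet_toMeasurable P bad).compl
  have h1 : ENNReal.ofReal (1 - x) * P (toMeasurable P bad)ᶜ ≤
      ∫⁻ ω, (alg (observation C R ω)).toOuterMeasure S ∂P := by
    rw [← setLIntegral_const]
    refine (setLIntegral_mono' hT fun ω hω => h ω fun hb => hω (subset_toMeasurable P bad hb)).trans
      (setLIntegral_le_lintegral _ _)
  refine le_trans ?_ h1
  have h2 : P (toMeasurable P bad)ᶜ = ENNReal.ofReal (1 - P.real bad) := by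
    rw [prob_compl_eq_one_sub (measurableSet_toMeasurable P bad), measure_toMeasurable,
      ENNReal.ofReal_sub _ measureReal_nonneg, ENNReal.ofReal_one, ofReal_measureReal]
  rw [h2, ← ENNReal.ofReal_mul (by linarith)]
  refine ENNReal.ofReal_le_ofReal ?_
  have h3 : P.real bad ≤ 1 := measureReal_le_one
  nlinarith [mul_nonneg hx (measureReal_nonneg (μ := P) (s := bad))]

theorem exists_log_large (b M : ℝ) : ∃ N : ℕ, ∀ n : ℕ, N ≤ n → 2 ≤ n ∧ 1 ≤ Real.log n ∧
    Real.log n ≤ n ∧ b * Real.log n / n ≤ 1 ∧ M ≤ Real.log n ^ (1 / 4 : ℝ) := by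
  have hlog : Tendsto (fun n : ℕ => Real.log n) atTop atTop :=
    Real.tendsto_log_atTop.comp tendsto_natCast_atTop_atTop
  have h1 : ∀ᶠ n : ℕ in atTop, M ≤ Real.log n ^ (1 / 4 : ℝ) :=
    ((tendsto_rpow_atTop (by norm_num : (0 : ℝ) < 1 / 4)).comp hlog).eventually_ge_atTop M
  have h2 : ∀ᶠ n : ℕ in atTop, |b| * Real.log n ≤ n := by
    have h : Tendsto (fun n : ℕ => Real.log n / n) atTop (nhds 0) :=
      (Real.isLittleO_log_id_atTop.tendsto_div_nhds_zero).comp tendsto_natCast_atTop_atTop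
    have h' := h.const_mul |b|
    rw [mul_zero] at h'
    filter_upwards [h'.eventually_le_const one_pos, eventually_gt_atTop 0] with n hn hn0
    have : (0 : ℝ) < n := by exact_mod_cast hn0
    rwa [← mul_div_assoc, div_le_one this] at hn
  obtain ⟨N, hN⟩ := eventually_atTop.1 ((eventually_ge_atTop 2).and
    ((hlog.eventually_ge_atTop 1).and (h1.and h2)))
  refine ⟨N, fun n hn => ?_⟩
  obtain ⟨h3, h4, h5, h6⟩ := hN n hn
  have hn0 : (0 : ℝ) < n := by exact_mod_cast (by omega : 0 < n)
  refine ⟨h3, h4, (Real.log_le_sub_one_of_pos hn0).trans (by linarith), ?_, h5⟩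
  rw [div_le_one hn0]
  exact (mul_le_mul_of_nonneg_right (le_abs_self b) (by linarith)).trans h6

/-- Everything is measured by `r = (log n)^(1/4)`. The gap is of order `r⁴`, and `‖N V‖²` is below
`r⁶` outside probability `F / r²`, so the eigenvector error is `e = E / r²`. All failure
probabilities add up to at most `T / r² ≤ 1 / r`, whence the exponent `1 / 4`. -/
theorem spectral_clustering_success (d K : ℕ) (hd : 1 ≤ d) (hK : 1 ≤ K) (𝒢 : GroupKind)
    (μ ρ a b δ : ℝ) (hμ : 0 < μ) (hμ2 : μ ≤ 1 / 2) (hρ : 0 < ρ) (ha : 0 < a) (hδ : 0 < δ) :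
    ∃ c : ℝ, 0 < c ∧ ∃ N : ℕ, ∀ n m : ℕ, N ≤ n → n = K * m →
      ∀ α β : ℝ, α ∈ Set.Icc a b → β ∈ Set.Icc a b → β + δ ≤ α →
      ∀ (C : Fin n → Fin K) (R : Fin n → grp d 𝒢), IsBalanced m C →
      ∀ alg : SpectralClustering n m K d μ,
        ENNReal.ofReal (1 - Real.log n ^ (-c)) ≤
          successProb α β C R alg.toInitializer
            {V | V ∈ feasible n m K d ∧ estErr (groundTruth C R) V ≤ Real.sqrt m / ρ} := by
  by_cases hb : b < a
  · exact ⟨1, one_pos, 0, fun n m _ _ α β hα => absurd (hα.1.trans hα.2) (not_le.2 hb)⟩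
  push Not at hb
  have hb0 : 0 < b := ha.trans_le hb
  have hK0 : (0 : ℝ) < K := by exact_mod_cast hK
  have hd0 : (0 : ℝ) < d := by exact_mod_cast hd
  have hd1 : (1 : ℝ) ≤ d := by exact_mod_cast hd
  -- The accuracy `δ / (2 K)` times `log n` is half of the spectral gap `δ log n / K`.
  obtain ⟨N₁, hN₁⟩ := exists_quadForm_noise_le d (2 * b) (4 * (d : ℝ) ^ 2) (δ / (2 * K)) hd0
    (by positivity) (by positivity) (by positivity)
  obtain ⟨N₂, hN₂⟩ := exists_quadForm_noise_le 1 (2 * b) 4 (δ / (2 * K)) one_pos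
    (by positivity) (by positivity) (by positivity)
  -- `E / r²` is `4 / g²` times `r⁶` for `g = δ r⁴ / K`.
  set E := 4 * (K : ℝ) ^ 2 / δ ^ 2 with hE
  have hE0 : 0 < E := by positivity
  -- The pivot error `16 K s` takes a quarter of the budget `1 / ρ²`; the terms proportional to `e`
  -- may use the other three quarters once `Z ≤ r²`.
  set s := 1 / (64 * K * ρ ^ 2) with hs
  have hs0 : 0 < s := by positivity
  set F := 8 * (K : ℝ) ^ 2 * d ^ 5 * b with hF
  have hF0 : 0 < F := by positivity
  set T := 2 + 2 * F + (128 * K * E / μ ^ 2 + E / s) with hT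
  set Z := 4 / 3 * ρ ^ 2 * (16 * E + 2 * d * (128 * K * E / μ ^ 2)) with hZ
  obtain ⟨N₃, hN₃⟩ := exists_log_large b (1 + T + 8 * E + 64 * E / μ ^ 2 + Z)
  refine ⟨1 / 4, by norm_num, max N₁ (max N₂ N₃), fun n m hn hnm α β hα hβ hαβ C R hC alg => ?_⟩
  obtain ⟨hn2, hl1, hln, hbl, hM⟩ := hN₃ n (by omega)
  set l := Real.log n with hl
  have hl0 : 0 < l := by linarith
  have hn0 : (0 : ℝ) < n := by exact_mod_cast (by omega : 0 < n)
  have hm : 0 < m := by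
    rcases Nat.eq_zero_or_pos m with rfl | h
    · simp at hnm; omega
    · exact h
  have hm0 : (0 : ℝ) < m := by exact_mod_cast hm
  have hnm' : (n : ℝ) = K * m := by exact_mod_cast hnm
  set r := l ^ (1 / 4 : ℝ) with hr
  have hT0 : 0 < T := by positivity
  have hZ0 : 0 < Z := by positivity
  have hr1 : 1 ≤ r := by
    have : (0 : ℝ) < 8 * E + 64 * E / μ ^ 2 := by positivity
    linarith
  have hr0 : 0 < r := by linarith
  have hsq : Real.sqrt l = r ^ 2 := by
    rw [hr, ← Real.rpow_natCast, ← Real.rpow_mul hl0.le, Real.sqrt_eq_rpow]; norm_num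
  have hl4 : l = r ^ 4 := by
    rw [← Real.sq_sqrt hl0.le, hsq]; ring
  have hrr : r ≤ r ^ 2 := by nlinarith
  have hμp : 0 < 64 * E / μ ^ 2 := by positivity
  have hMT : T ≤ r := by linarith
  have hM8 : 8 * E ≤ r ^ 2 := by linarith
  have hMμ : 64 * E / μ ^ 2 < r ^ 2 := by linarith
  have hMZ : Z ≤ r ^ 2 := by linarith
  set p := α * l / n with hp
  set q := β * l / n with hq
  set P := b * l / n with hP
  have hpP : p ≤ P := by
    rw [hp, hP]; gcongr; exact hα.2
  have hqP : q ≤ P := by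
    rw [hq, hP]; gcongr; exact hβ.2
  have hp0 : 0 ≤ p := div_nonneg (mul_nonneg (ha.le.trans hα.1) hl0.le) hn0.le
  have hq0 : 0 ≤ q := div_nonneg (mul_nonneg (ha.le.trans hβ.1) hl0.le) hn0.le
  have hp1 : p ≤ 1 := hpP.trans hbl
  have hq1 : q ≤ 1 := hqP.trans hbl
  have hnb := isNoise_blockNoise hp0 hp1 hq0 hq1 hpP hqP C R
  have hne := isNoise_edgeNoise (d := d) (𝒢 := 𝒢) hp0 hp1 hq0 hq1 hpP hqP C
  have hv : 2 * P ≤ 2 * b * l / n := le_of_eq (by rw [hP]; ring)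
  have hP1 := hN₁ n (by omega) (Fin n × Fin d) (Fin n × Fin n) (Bool × grp d 𝒢)
    (edgeMeasure d 𝒢 p q C) (blockNoise p q C R) (2 * P) hnb (by simp [mul_comm]) hv
  have hP2 := hN₂ n (by omega) (Fin n) (Fin n × Fin n) (Bool × grp d 𝒢)
    (edgeMeasure d 𝒢 p q C) (edgeNoise d 𝒢 p q C) (2 * P) hne (by simp) hv
  have ht0 : 0 < r ^ 6 := by positivity
  have hP3 := hnb.measureReal_sq_ge_le (by positivity) (signalBasis m C R)
    (abs_signalBasis_le C R) ht0
  have hcb : ∀ y k, |clusterBasis m C y k| ≤ (Real.sqrt m)⁻¹ := by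
    intro y k
    simp only [clusterBasis, clusterMatrix, Matrix.smul_apply, Matrix.of_apply, smul_eq_mul]
    split_ifs <;> simp [abs_of_nonneg, Real.sqrt_nonneg]
  have hP4 := hne.measureReal_sq_ge_le (by norm_num) (clusterBasis m C) hcb ht0
  have hs2 : ((Real.sqrt m)⁻¹) ^ 2 = (m : ℝ)⁻¹ := by rw [inv_pow, Real.sq_sqrt hm0.le]
  have hP3' : (Measure.pi (edgeMeasure d 𝒢 p q C)).real {ω | r ^ 6 ≤ ∑ x, ∑ k,
      (randMat (blockNoise p q C R) ω * signalBasis m C R) x k ^ 2} ≤ F / r ^ 2 := by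
    refine hP3.trans (le_of_eq ?_)
    simp only [Fintype.card_prod, Fintype.card_fin, Nat.cast_mul]
    rw [hs2, hP, hl4, hnm', hF]
    field_simp
    ring
  have hP4' : (Measure.pi (edgeMeasure d 𝒢 p q C)).real {ω | r ^ 6 ≤ ∑ x, ∑ k,
      (randMat (edgeNoise d 𝒢 p q C) ω * clusterBasis m C) x k ^ 2} ≤ F / r ^ 2 := by
    refine hP4.trans (le_trans (le_of_eq (?_ : _ = 8 * (K : ℝ) ^ 2 * 1 * b / r ^ 2)) ?_)
    · simp only [Fintype.card_fin]
      rw [hs2, hP, hl4, hnm']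
      field_simp
      ring
    · rw [hF]; gcongr; exact one_le_pow₀ hd1
  set bad := ({ω | ¬ ∀ u : Fin n × Fin d → ℝ,
      |bil (randMat (blockNoise p q C R) ω) u u| ≤ δ / (2 * K) * l * ∑ x, u x ^ 2} ∪
    {ω | ¬ ∀ u : Fin n → ℝ,
      |bil (randMat (edgeNoise d 𝒢 p q C) ω) u u| ≤ δ / (2 * K) * l * ∑ x, u x ^ 2}) ∪
    ({ω | r ^ 6 ≤ ∑ x, ∑ k, (randMat (blockNoise p q C R) ω * signalBasis m C R) x k ^ 2} ∪
     {ω | r ^ 6 ≤ ∑ x, ∑ k, (randMat (edgeNoise d 𝒢 p q C) ω * clusterBasis m C) x k ^ 2})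
    with hbad
  have hbadP : (sampleMeasure d 𝒢 p q C).real bad ≤ 2 / n + 2 * F / r ^ 2 := by
    rw [sampleMeasure_eq]
    refine (measureReal_union_le _ _).trans ((add_le_add ((measureReal_union_le _ _).trans
      (add_le_add hP1 hP2)) ((measureReal_union_le _ _).trans (add_le_add hP3' hP4'))).trans
      (le_of_eq ?_))
    ring
  set e := E / r ^ 2 with he
  refine le_trans ?_ (ofReal_le_successProb (x := 128 * K * e / μ ^ 2 + e / s) hbadP (by positivity)
    fun ω hω => ?_)
  · refine ENNReal.ofReal_le_ofReal (sub_le_sub_left ?_ 1)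
    have h1 : (2 : ℝ) / n ≤ 2 / r ^ 2 := by
      have : r ^ 2 ≤ r ^ 4 := pow_le_pow_right₀ hr1 (by norm_num)
      gcongr
      linarith
    have h2 : 2 / r ^ 2 + 2 * F / r ^ 2 + (128 * K * e / μ ^ 2 + e / s) = T / r ^ 2 := by
      rw [hT, he]; ring
    have h3 : T / r ^ 2 ≤ l ^ (-(1 / 4) : ℝ) := by
      rw [Real.rpow_neg hl0.le, ← hr, div_le_iff₀ (by positivity), pow_two, ← mul_assoc,
        inv_mul_cancel₀ hr0.ne', one_mul]
      exact hMT
    linarith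
  · rw [hbad] at hω
    simp only [Set.mem_union, Set.mem_ofPred_eq, not_or, not_not, not_le] at hω
    obtain ⟨⟨h1, h2⟩, h3, h4⟩ := hω
    have hg : δ / (2 * K) * l = δ * l / K / 2 := by ring
    rw [hg] at h1 h2
    refine alg.le_toInitializer_of_noise_le hd hm hμ hμ2 hp0 hp1 hq0 hq1
      (g := δ * l / K) (by positivity) ?_ hC R ω h1 h2 h3.le h4.le ?_ ?_ ?_ hs0 hρ ?_
    · rw [hp, hq, hnm']
      have : (m : ℝ) * (α * l / (K * m) - β * l / (K * m)) = (α - β) * l / K := by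
        field_simp
      rw [this]
      gcongr
      linarith
    · rw [he, hE, hl4]
      refine le_of_eq ?_
      field_simp
    · rw [he, div_le_iff₀ (by positivity)]; linarith
    · rw [he, ← mul_div_assoc, div_lt_iff₀ (by positivity)]
      rw [div_lt_iff₀ (by positivity)] at hMμ
      linarith
    · have h5 : 16 * e + 16 * K * s + 2 * d * (128 * K * e / μ ^ 2) =
          3 / 4 * (Z / r ^ 2) / ρ ^ 2 + 1 / 4 / ρ ^ 2 := by
        rw [he, hZ, hs]; field_simp; ring
      have h6 : Z / r ^ 2 ≤ 1 := by rw [div_le_one (by positivity)]; exact hMZ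
      rw [h5, ← add_div]
      gcongr
      linarith

end Spectral

end SGBM

/-! ### Overlap with the ground truth controls the estimation error. -/

namespace SGBM

open Finset

section Overlap

variable {n K m d : ℕ} {𝒢 : GroupKind}

/-- The Frobenius inner product. -/
def frobInner {ι κ : Type*} [Fintype ι] [Fintype κ] (M N : Matrix ι κ ℝ) : ℝ :=
  ∑ i, ∑ j, M i j * N i j

theorem frobInner_self {ι κ : Type*} [Fintype ι] [Fintype κ] (M : Matrix ι κ ℝ) :
    frobInner M M = frob M ^ 2 := by
  rw [frob_sq]
  exact sum_congr rfl fun i _ => sum_congr rfl fun j _ => (pow_two _).symm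

theorem frobInner_sum_right {ι κ α : Type*} [Fintype ι] [Fintype κ] (s : Finset α)
    (M : Matrix ι κ ℝ) (G : α → Matrix ι κ ℝ) :
    frobInner M (∑ x ∈ s, G x) = ∑ x ∈ s, frobInner M (G x) := by
  simp only [frobInner, Matrix.sum_apply, mul_sum]
  exact (sum_congr rfl fun i _ => sum_comm).trans sum_comm

theorem frobInner_comm {ι κ : Type*} [Fintype ι] [Fintype κ] (M N : Matrix ι κ ℝ) :
    frobInner M N = frobInner N M :=
  sum_congr rfl fun _ _ => sum_congr rfl fun _ _ => mul_comm _ _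

theorem frob_sq_sum {ι κ α : Type*} [Fintype ι] [Fintype κ] (s : Finset α)
    (G : α → Matrix ι κ ℝ) :
    frob (∑ x ∈ s, G x) ^ 2 = ∑ x ∈ s, ∑ y ∈ s, frobInner (G y) (G x) := by
  rw [← frobInner_self, frobInner_sum_right]
  refine sum_congr rfl fun x _ => ?_
  rw [frobInner_comm, frobInner_sum_right]
  exact sum_congr rfl fun y _ => frobInner_comm _ _

theorem frob_sq_sub {ι κ : Type*} [Fintype ι] [Fintype κ] (M N : Matrix ι κ ℝ) :
    frob (M - N) ^ 2 = frob M ^ 2 + frob N ^ 2 - 2 * frobInner M N := by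
  simp only [frob_sq, frobInner, mul_sum, ← sum_add_distrib, ← sum_sub_distrib, Matrix.sub_apply]
  exact sum_congr rfl fun i _ => sum_congr rfl fun j _ => by ring

theorem frobInner_le_of_mem_orthogonalGroup {M N : Matrix (Fin d) (Fin d) ℝ}
    (hM : M ∈ Matrix.orthogonalGroup (Fin d) ℝ) (hN : N ∈ Matrix.orthogonalGroup (Fin d) ℝ) :
    frobInner M N ≤ d := by
  have := frob_sq_sub M N
  rw [frob_sq_orthogonal hM, frob_sq_orthogonal hN] at this
  nlinarith [sq_nonneg (frob (M - N))]

theorem frob_sq_sum_le_of_mem_orthogonalGroup {α : Type*} (s : Finset α)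
    {G : α → Matrix (Fin d) (Fin d) ℝ} (hG : ∀ x, G x ∈ Matrix.orthogonalGroup (Fin d) ℝ) :
    frob (∑ x ∈ s, G x) ^ 2 ≤ d * (s.card : ℝ) ^ 2 := by
  rw [frob_sq_sum]
  refine (sum_le_sum fun x _ => sum_le_sum fun y _ =>
    frobInner_le_of_mem_orthogonalGroup (hG y) (hG x)).trans (le_of_eq ?_)
  simp only [sum_const, nsmul_eq_mul]
  ring

/-- A large sum of orthogonal matrices is well correlated with one of the summands. -/
theorem exists_frobInner_ge {α : Type*} {s : Finset α} (hs : s.Nonempty)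
    (G : α → Matrix (Fin d) (Fin d) ℝ) :
    ∃ x ∈ s, frob (∑ x ∈ s, G x) ^ 2 ≤ s.card * ∑ y ∈ s, frobInner (G y) (G x) := by
  by_contra! h
  have h1 := sum_lt_sum_of_nonempty hs h
  rw [← mul_sum, ← frob_sq_sum, sum_const, nsmul_eq_mul] at h1
  exact lt_irrefl _ h1

/-- Two nearly aligned balanced clusterings agree up to a permutation on most nodes. -/
theorem exists_perm_of_overlap {C τ : Fin n → Fin K} (hC : IsBalanced m C) (hτ : IsBalanced m τ)
    (hm : 0 < m) {κ : ℝ} (hκ : κ < 1 / 2)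
    (h : ∀ k, (1 - κ) * (m : ℝ) ^ 2 ≤
      ∑ l, ((univ.filter fun i => C i = k ∧ τ i = l).card : ℝ) ^ 2) :
    ∃ π : Equiv.Perm (Fin K), ∀ k,
      (1 - κ) * (m : ℝ) ≤ (univ.filter fun i => C i = k ∧ τ i = π k).card := by
  have hm0 : (0 : ℝ) < m := by exact_mod_cast hm
  have hrow : ∀ k, ∑ l, ((univ.filter fun i => C i = k ∧ τ i = l).card : ℝ) = m := by
    intro k
    rw [← hC k, card_eq_sum_card_fiberwise (f := τ) (t := univ) fun _ _ => mem_coe.2 (mem_univ _)]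
    push_cast
    simp only [filter_filter]
  have hmax : ∀ k, ∃ l, (1 - κ) * (m : ℝ) ≤ (univ.filter fun i => C i = k ∧ τ i = l).card := by
    intro k
    obtain ⟨l, -, hl⟩ := exists_max_image (univ : Finset (Fin K))
      (fun l => ((univ.filter fun i => C i = k ∧ τ i = l).card : ℝ)) ⟨k, mem_univ k⟩
    refine ⟨l, ?_⟩
    -- The cell sizes of a row sum to `m`, so their squares sum to at most `m` times the largest;
    -- hence the largest is at least `(1 - κ) m`.
    have h1 : ∑ l, ((univ.filter fun i => C i = k ∧ τ i = l).card : ℝ) ^ 2 ≤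
        ((univ.filter fun i => C i = k ∧ τ i = l).card : ℝ) * m := by
      rw [← hrow k, mul_sum]
      refine sum_le_sum fun l' _ => ?_
      rw [pow_two]
      exact mul_le_mul_of_nonneg_right (hl l' (mem_univ _)) (Nat.cast_nonneg _)
    have h2 := (h k).trans h1
    nlinarith
  choose f hf using hmax
  have hinj : Function.Injective f := by
    intro k k' hkk
    by_contra hne
    have h1 : (univ.filter fun i => C i = k ∧ τ i = f k).card +
        (univ.filter fun i => C i = k' ∧ τ i = f k').card ≤ m := by
      rw [← card_union_of_disjoint, ← hτ (f k)]
      · refine card_le_card fun i hi => ?_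
        rw [mem_union, mem_filter, mem_filter] at hi
        rw [mem_filter]
        rcases hi with hi | hi
        · exact ⟨mem_univ _, hi.2.2⟩
        · exact ⟨mem_univ _, hi.2.2.trans hkk.symm⟩
      · rw [disjoint_left]
        intro i hi hi'
        exact hne ((mem_filter.1 hi).2.1.symm.trans (mem_filter.1 hi').2.1)
    have h2 : ((univ.filter fun i => C i = k ∧ τ i = f k).card : ℝ) +
        (univ.filter fun i => C i = k' ∧ τ i = f k').card ≤ m := by exact_mod_cast h1
    have := hf k
    have := hf k'
    nlinarith
  exact ⟨Equiv.ofBijective f (Finite.injective_iff_bijective.1 hinj), hf⟩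

/-- If `V*ᵀ V` is nearly as large as possible, then `V` is close to `V*` up to the symmetries. -/
theorem estErr_sq_le_of_overlap (hd : 1 ≤ d) (hm : 0 < m) {C τ : Fin n → Fin K}
    (hC : IsBalanced m C) (hτ : IsBalanced m τ) (R : Fin n → grp d 𝒢)
    {R' : Fin n → Matrix (Fin d) (Fin d) ℝ}
    (hR' : ∀ v, R' v ∈ Matrix.orthogonalGroup (Fin d) ℝ) {κ : ℝ} (hκ : K * κ < 1 / 2)
    (h : (1 - κ) * (K * d * (m : ℝ) ^ 2) ≤ ∑ k, ∑ l,
      frob (∑ i ∈ univ.filter fun i => C i = k ∧ τ i = l, (toMat (R i)).transpose * R' i) ^ 2) :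
    estErr (groundTruth C R) (entangle R' (clusterMatrix τ)) ^ 2 ≤ 4 * K ^ 2 * κ * d * m := by
  have hm0 : (0 : ℝ) < m := by exact_mod_cast hm
  have hd0 : (0 : ℝ) < d := by exact_mod_cast hd
  set G : Fin n → Matrix (Fin d) (Fin d) ℝ := fun i => (toMat (R i)).transpose * R' i with hG
  have hGmem : ∀ i, G i ∈ Matrix.orthogonalGroup (Fin d) ℝ := fun i =>
    mul_mem (transpose_mem_orthogonalGroup (toMat_mem _)) (hR' i)
  set cell : Fin K → Fin K → Finset (Fin n) := fun k l => univ.filter fun i => C i = k ∧ τ i = l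
    with hcell
  have hrow : ∀ k, ∑ l, ((cell k l).card : ℝ) = m := by
    intro k
    rw [← hC k, card_eq_sum_card_fiberwise (f := τ) (t := univ) fun _ _ => mem_coe.2 (mem_univ _)]
    push_cast
    simp only [hcell, filter_filter]
  have hle : ∀ k l, ((cell k l).card : ℝ) ≤ m := fun k l => by
    rw [← hrow k]
    exact single_le_sum (f := fun l => ((cell k l).card : ℝ)) (fun _ _ => Nat.cast_nonneg _)
      (mem_univ l)
  have hB : ∀ k l, frob (∑ i ∈ cell k l, G i) ^ 2 ≤ d * ((cell k l).card : ℝ) ^ 2 := fun k l =>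
    frob_sq_sum_le_of_mem_orthogonalGroup _ hGmem
  have hsq : ∀ k, ∑ l, ((cell k l).card : ℝ) ^ 2 ≤ (m : ℝ) ^ 2 := by
    intro k
    rw [pow_two (m : ℝ), ← hrow k, sum_mul]
    refine sum_le_sum fun l _ => ?_
    rw [pow_two, hrow k]
    exact mul_le_mul_of_nonneg_left (hle k l) (Nat.cast_nonneg _)
  have hS : ∀ k, ∑ l, frob (∑ i ∈ cell k l, G i) ^ 2 ≤ d * (m : ℝ) ^ 2 := fun k => by
    refine (sum_le_sum fun l _ => hB k l).trans ?_
    rw [← mul_sum]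
    exact mul_le_mul_of_nonneg_left (hsq k) hd0.le
  -- No cluster contributes more than `d m²`, so in the worst case a single one carries the whole
  -- deficit `κ K d m²`.
  have hSk : ∀ k, (1 - K * κ) * (d * (m : ℝ) ^ 2) ≤ ∑ l, frob (∑ i ∈ cell k l, G i) ^ 2 := by
    intro k
    have h1 := h
    rw [← add_sum_erase univ _ (mem_univ k)] at h1
    have h2 := sum_le_sum fun k' (_ : k' ∈ univ.erase k) => hS k'
    rw [sum_const, card_erase_of_mem (mem_univ k), card_univ, Fintype.card_fin, nsmul_eq_mul,
      Nat.cast_sub (Nat.one_le_of_lt k.pos), Nat.cast_one] at h2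
    linarith
  obtain ⟨π, hπ⟩ := exists_perm_of_overlap (κ := K * κ) hC hτ hm hκ fun k => by
    have h1 := (hSk k).trans (sum_le_sum fun l _ => hB k l)
    rw [← mul_sum] at h1
    have h2 : d * ((1 - K * κ) * (m : ℝ) ^ 2) ≤ d * ∑ l, ((cell k l).card : ℝ) ^ 2 := by linarith
    exact le_of_mul_le_mul_left h2 hd0
  -- The dominant cell carries nearly all of the overlap. By averaging, one of its own elements `G
  -- x` is well correlated with the rest and can serve as the rotation of that cluster, which avoids
  -- a polar decomposition.
  have hU : ∀ k, ∃ x, (1 - 2 * (K * κ)) * (d * m) ≤ ∑ i ∈ cell k (π k), frobInner (G i) (G x) := by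
    intro k
    have hpos : (0 : ℝ) < (cell k (π k)).card := lt_of_lt_of_le (by nlinarith) (hπ k)
    obtain ⟨x, -, hx⟩ := exists_frobInner_ge (card_pos.1 (by exact_mod_cast hpos)) G
    refine ⟨x, ?_⟩
    have h1 : ∑ l ∈ univ.erase (π k), frob (∑ i ∈ cell k l, G i) ^ 2 ≤
        K * κ * (d * (m : ℝ) ^ 2) := by
      have h2 : ∀ l ∈ univ.erase (π k), frob (∑ i ∈ cell k l, G i) ^ 2 ≤
          d * m * ((cell k l).card : ℝ) := fun l _ => by
        refine (hB k l).trans ?_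
        rw [pow_two, mul_assoc, mul_comm (m : ℝ)]
        gcongr
        exact_mod_cast hle k l
      have h3 := hrow k
      rw [← add_sum_erase univ _ (mem_univ (π k))] at h3
      refine (sum_le_sum h2).trans ?_
      rw [← mul_sum]
      have h4 : ∑ l ∈ univ.erase (π k), ((cell k l).card : ℝ) ≤ K * κ * m := by
        have := hπ k
        linarith
      refine (mul_le_mul_of_nonneg_left h4 (by positivity)).trans (le_of_eq ?_)
      ring
    have h2 := hSk k
    rw [← add_sum_erase univ _ (mem_univ (π k))] at h2
    have h3 : m * ((1 - 2 * (K * κ)) * (d * m)) ≤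
        (cell k (π k)).card * ∑ i ∈ cell k (π k), frobInner (G i) (G x) := by linarith
    by_contra! h4
    have h5 := mul_lt_mul_of_pos_left h4 hpos
    have h6 : 0 ≤ (1 - 2 * (K * κ)) * ((d : ℝ) * m) :=
      mul_nonneg (by linarith) (by positivity)
    have h7 := mul_le_mul_of_nonneg_right (hle k (π k)) h6
    linarith
  choose x hx using hU
  have h1 := estErr_le C R (entangle R' (clusterMatrix τ)) (fun k => G (x k))
    (fun k => hGmem _) π
  have h0 : 0 ≤ estErr (groundTruth C R) (entangle R' (clusterMatrix τ)) :=
    Real.iInf_nonneg fun _ => frob_nonneg _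
  refine (pow_le_pow_left₀ h0 h1 2).trans ?_
  rw [frob_sq_entangle_sub _ _ hR' (fun v => mul_mem (toMat_mem _) (hGmem _))]
  -- Every node contributes `2 d` minus twice its correlation, and mislabelled nodes simply have
  -- none. Summing `hU` over `k` gives `4 K² κ d m`.
  have h2 : ∀ v, (if τ v = π (C v) then frob (R' v - toMat (R v) * G (x (C v))) ^ 2
      else 2 * (d : ℝ)) = 2 * d - 2 * if τ v = π (C v) then frobInner (G v) (G (x (C v))) else 0 := by
    intro v
    split_ifs
    · have h3 : R' v - toMat (R v) * G (x (C v)) = toMat (R v) * (G v - G (x (C v))) := by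
        rw [mul_sub, hG]
        simp only
        rw [← mul_assoc (toMat (R v)) (toMat (R v)).transpose,
          (Matrix.mem_orthogonalGroup_iff _ ℝ).1 (toMat_mem (R v)), one_mul]
      rw [h3, frob_orthogonal_mul (toMat_mem _), frob_sq_sub, frob_sq_orthogonal (hGmem _),
        frob_sq_orthogonal (hGmem _)]
      ring
    · ring
  have h3 : ∑ v, (if τ v = π (C v) then frobInner (G v) (G (x (C v))) else 0) =
      ∑ k, ∑ i ∈ cell k (π k), frobInner (G i) (G (x k)) := by
    rw [← sum_fiberwise univ C]
    refine sum_congr rfl fun k _ => ?_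
    rw [← sum_filter, filter_filter]
    refine sum_congr ?_ ?_
    · ext i
      simp only [hcell, mem_filter, mem_univ, true_and]
      constructor
      · rintro ⟨rfl, h⟩; exact ⟨rfl, h⟩
      · rintro ⟨rfl, h⟩; exact ⟨rfl, h⟩
    · intro i hi
      rw [(mem_filter.1 hi).2.1]
  have h4 := sum_le_sum fun k (_ : k ∈ univ) => hx k
  rw [sum_const, card_univ, Fintype.card_fin, nsmul_eq_mul] at h4
  rw [sum_congr rfl fun v _ => h2 v, sum_sub_distrib,
    ← mul_sum univ (fun v => if τ v = π (C v) then frobInner (G v) (G (x (C v))) else 0), h3, sum_const, card_univ,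
    Fintype.card_fin, nsmul_eq_mul]
  have hn : (n : ℝ) = K * m := by exact_mod_cast hC.card_eq
  rw [hn]
  linarith

end Overlap

end SGBM

/-! ### The correlation with the observation. -/

namespace SGBM

open Finset

section Score

variable {n K m d : ℕ} {𝒢 : GroupKind} {ι κ : Type*} [Fintype ι] [Fintype κ]

theorem bil_add (M N : Matrix ι ι ℝ) (u w : ι → ℝ) : bil (M + N) u w = bil M u w + bil N u w := by
  simp only [bil, Matrix.add_apply, add_mul, sum_add_distrib]

theorem bil_smul_matrix (c : ℝ) (M : Matrix ι ι ℝ) (u w : ι → ℝ) : bil (c • M) u w = c * bil M u w := by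
  simp only [bil, Matrix.smul_apply, smul_eq_mul, mul_sum, mul_assoc]

theorem bil_one [DecidableEq ι] (u : ι → ℝ) : bil (1 : Matrix ι ι ℝ) u u = ∑ x, u x ^ 2 := by
  simp [bil, Matrix.one_apply, pow_two]

theorem bil_mul_transpose (V : Matrix ι κ ℝ) (u : ι → ℝ) :
    bil (V * V.transpose) u u = ∑ k, (∑ x, V x k * u x) ^ 2 := by
  simp only [bil, Matrix.mul_apply, Matrix.transpose_apply, pow_two, sum_mul, mul_sum]
  rw [(sum_congr rfl fun x _ => sum_comm).trans sum_comm]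
  exact sum_congr rfl fun k _ => sum_congr rfl fun x _ => sum_congr rfl fun y _ => by ring

/-- The correlation `⟨A, V Vᵀ⟩`. -/
noncomputable def score (A : Matrix ι ι ℝ) (V : Matrix ι κ ℝ) : ℝ :=
  ∑ k, bil A (fun x => V x k) fun x => V x k

/-- The group elements `R_i R_jᵀ` without regard to the clusters. -/
def pairwiseRatio (R : Fin n → grp d 𝒢) : Obs n d :=
  Matrix.of fun x y => (toMat (R x.1) * (toMat (R y.1)).transpose) x.2 y.2

theorem groundTruth_mul_transpose_apply (C : Fin n → Fin K) (R : Fin n → grp d 𝒢)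
    (x y : Fin n × Fin d) : (groundTruth C R * (groundTruth C R).transpose) x y =
      if C x.1 = C y.1 then pairwiseRatio R x y else 0 := by
  simp only [groundTruth, entangle, clusterMatrix, Matrix.mul_apply, Matrix.transpose_apply,
    Matrix.of_apply, Fintype.sum_prod_type, pairwiseRatio]
  rw [sum_eq_single (C x.1) (fun l _ hl => by simp [Ne.symm hl]) (by simp)]
  by_cases h : C x.1 = C y.1
  · simp [h]
  · simp [h, Ne.symm h]

theorem observation_eq' (hm : 0 < m) {p q : ℝ} (hp0 : 0 ≤ p) (hp1 : p ≤ 1) (hq0 : 0 ≤ q)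
    (hq1 : q ≤ 1) (C : Fin n → Fin K) (R : Fin n → grp d 𝒢) (ω : Sample n d 𝒢) :
    observation C R ω = (1 - p) • (1 : Obs n d) +
      (p - q * haarMean d 𝒢) • (groundTruth C R * (groundTruth C R).transpose) +
      (q * haarMean d 𝒢) • pairwiseRatio R + randMat (blockNoise p q C R) ω := by
  have h : signalBasis m C R * signalCoeff K d m p (q * haarMean d 𝒢) *
      (signalBasis m C R).transpose =
      (p - q * haarMean d 𝒢) • (groundTruth C R * (groundTruth C R).transpose) +
        (q * haarMean d 𝒢) • pairwiseRatio R := by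
    ext x y
    rw [signal_apply hm, Matrix.add_apply, Matrix.smul_apply, Matrix.smul_apply,
      groundTruth_mul_transpose_apply, smul_eq_mul, smul_eq_mul]
    simp only [pairwiseRatio, Matrix.of_apply]
    split_ifs <;> ring
  rw [observation_eq hm hp0 hp1 hq0 hq1, h]
  simp only [add_assoc]

/-- The squared Frobenius norm of `V*ᵀ V`. -/
noncomputable def overlap (V V' : Matrix ι κ ℝ) : ℝ := ∑ l, ∑ k, (∑ x, V x k * V' x l) ^ 2

/-- The correlation is linear in the matrix, and against `V* V*ᵀ` it equals the overlap. The
identity term is the same for all feasible candidates, so apart from noise only the overlap and the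
Haar mean distinguish them. -/
theorem score_observation (hm : 0 < m) {p q : ℝ} (hp0 : 0 ≤ p) (hp1 : p ≤ 1) (hq0 : 0 ≤ q)
    (hq1 : q ≤ 1) (C : Fin n → Fin K) (R : Fin n → grp d 𝒢) (ω : Sample n d 𝒢) (V : VMat n K d) :
    score (observation C R ω) V = (1 - p) * ∑ l, ∑ x, V x l ^ 2 +
      (p - q * haarMean d 𝒢) * overlap (groundTruth C R) V +
      (q * haarMean d 𝒢) * score (pairwiseRatio R) V +
      score (randMat (blockNoise p q C R) ω) V := by
  rw [observation_eq' hm hp0 hp1 hq0 hq1]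
  simp only [score, overlap, bil_add, bil_smul_matrix, bil_one, bil_mul_transpose, sum_add_distrib,
    ← mul_sum]

theorem abs_score_le {N : Matrix ι ι ℝ} {η : ℝ} (hN : ∀ u, |bil N u u| ≤ η * ∑ x, u x ^ 2)
    (V : Matrix ι κ ℝ) : |score N V| ≤ η * ∑ l, ∑ x, V x l ^ 2 := by
  rw [mul_sum]
  exact (abs_sum_le_sum_abs _ _).trans (sum_le_sum fun k _ => hN _)

theorem sum_sq_entangle {R : Fin n → Matrix (Fin d) (Fin d) ℝ}
    (hR : ∀ v, R v ∈ Matrix.orthogonalGroup (Fin d) ℝ) (τ : Fin n → Fin K) :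
    ∑ l, ∑ x, entangle R (clusterMatrix τ) x l ^ 2 = n * d := by
  rw [sum_comm, Fintype.sum_prod_type]
  have : ∀ v, ∑ a, ∑ l, entangle R (clusterMatrix τ) (v, a) l ^ 2 = d := by
    intro v
    rw [← frob_sq_orthogonal (hR v), frob_sq]
    refine sum_congr rfl fun a _ => ?_
    rw [Fintype.sum_prod_type]
    simp only [entangle, clusterMatrix, Matrix.of_apply]
    rw [sum_eq_single (τ v) (fun l _ hl => by simp [Ne.symm hl]) (by simp)]
    simp
  simp [this]

/-- The blocks of `V*ᵀ V` are indexed by a true and an estimated cluster, and only nodes common to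
both contribute. -/
theorem overlap_groundTruth (C τ : Fin n → Fin K) (R : Fin n → grp d 𝒢)
    (R' : Fin n → Matrix (Fin d) (Fin d) ℝ) :
    overlap (groundTruth C R) (entangle R' (clusterMatrix τ)) = ∑ k, ∑ l,
      frob (∑ i ∈ univ.filter fun i => C i = k ∧ τ i = l, (toMat (R i)).transpose * R' i) ^ 2 := by
  have h1 : ∀ k a l b, ∑ x, groundTruth C R x (k, a) * entangle R' (clusterMatrix τ) x (l, b) =
      (∑ i ∈ univ.filter fun i => C i = k ∧ τ i = l, (toMat (R i)).transpose * R' i) a b := by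
    intro k a l b
    rw [Fintype.sum_prod_type, Matrix.sum_apply, sum_filter]
    refine sum_congr rfl fun i _ => ?_
    simp only [groundTruth, entangle, clusterMatrix, Matrix.of_apply, Matrix.mul_apply,
      Matrix.transpose_apply]
    by_cases h1 : C i = k <;> by_cases h2 : τ i = l <;> simp [h1, h2]
  simp only [overlap, Fintype.sum_prod_type, h1, frob_sq]
  rw [(sum_congr rfl fun l _ => sum_comm).trans sum_comm]
  refine sum_congr rfl fun k _ => sum_congr rfl fun l _ => sum_comm

theorem overlap_self {C : Fin n → Fin K} (hC : IsBalanced m C) (R : Fin n → grp d 𝒢) :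
    overlap (groundTruth C R) (groundTruth C R) = K * d * (m : ℝ) ^ 2 := by
  refine (overlap_groundTruth C C R fun i => toMat (R i)).trans ?_
  have h1 : ∀ k l, (∑ i ∈ univ.filter fun i => C i = k ∧ C i = l,
      (toMat (R i)).transpose * toMat (R i)) =
      if k = l then (m : ℝ) • (1 : Matrix (Fin d) (Fin d) ℝ) else 0 := by
    intro k l
    rw [sum_congr rfl fun i _ => (Matrix.mem_orthogonalGroup_iff' _ ℝ).1 (toMat_mem (R i)),
      sum_const]
    split_ifs with h
    · subst h
      simp only [and_self]
      rw [hC k, Nat.cast_smul_eq_nsmul]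
    · rw [filter_false_of_mem fun i _ hi => h (hi.1.symm.trans hi.2), card_empty, zero_smul]
  have h2 : ∀ k l : Fin K, frob (if k = l then (m : ℝ) • (1 : Matrix (Fin d) (Fin d) ℝ) else 0) ^ 2 =
      if k = l then (d : ℝ) * m ^ 2 else 0 := by
    intro k l
    rw [frob_sq]
    split_ifs
    · simp [Matrix.one_apply]
    · simp
  simp only [h1, h2]
  simp [mul_assoc]

theorem mem_feasible_iff {V : VMat n K d} : V ∈ feasible n m K d ↔
    ∃ (R : Fin n → Matrix (Fin d) (Fin d) ℝ) (τ : Fin n → Fin K),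
      (∀ i, R i ∈ Matrix.orthogonalGroup (Fin d) ℝ) ∧ IsBalanced m τ ∧
        V = entangle R (clusterMatrix τ) := by
  constructor
  · rintro ⟨R, H, hR, hH, rfl⟩
    obtain ⟨τ, hτ, rfl⟩ := exists_eq_clusterMatrix hH
    exact ⟨R, τ, hR, hτ, rfl⟩
  · rintro ⟨R, τ, hR, hτ, rfl⟩
    exact ⟨R, _, hR, clusterMatrix_mem hτ, rfl⟩

theorem groundTruth_mem_feasible {C : Fin n → Fin K} (hC : IsBalanced m C)
    (R : Fin n → grp d 𝒢) : groundTruth C R ∈ feasible n m K d :=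
  mem_feasible_iff.2 ⟨_, C, fun i => toMat_mem (R i), hC, rfl⟩

/-- A near-maximizer of the correlation has almost full overlap if the outliers are centred. -/
theorem overlap_ge_of_score_le (hm : 0 < m) {p q η : ℝ} (hp0 : 0 ≤ p) (hp1 : p ≤ 1) (hq0 : 0 ≤ q)
    (hq1 : q ≤ 1) (hη : 0 ≤ η) (hγ : haarMean d 𝒢 = 0) {C : Fin n → Fin K} (hC : IsBalanced m C)
    (R : Fin n → grp d 𝒢) (ω : Sample n d 𝒢)
    (hN : ∀ u, |bil (randMat (blockNoise p q C R) ω) u u| ≤ η * ∑ x, u x ^ 2)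
    {V : VMat n K d} (hV : V ∈ feasible n m K d)
    (hmax : score (observation C R ω) (groundTruth C R) ≤ score (observation C R ω) V + 1) :
    p * (K * d * (m : ℝ) ^ 2 - overlap (groundTruth C R) V) ≤
      2 * (n * d) + 4 * η * (n * d) + 1 := by
  obtain ⟨R', τ, hR', hτ, rfl⟩ := mem_feasible_iff.1 hV
  have h1 := abs_score_le hN (entangle R' (clusterMatrix τ))
  have h2 := abs_score_le hN (groundTruth C R)
  have h3 : ∑ l, ∑ x, groundTruth C R x l ^ 2 = n * d := sum_sq_entangle (fun i => toMat_mem (R i)) C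
  rw [score_observation hm hp0 hp1 hq0 hq1, score_observation hm hp0 hp1 hq0 hq1,
    overlap_self hC, h3, sum_sq_entangle hR', hγ] at hmax
  rw [sum_sq_entangle hR'] at h1
  rw [h3] at h2
  have h4 := (abs_le.1 h1).2
  have h5 := (abs_le.1 h2).1
  have h6 : 0 ≤ η * (n * d) := by positivity
  have h7 : (0 : ℝ) ≤ n * d := by positivity
  linarith

/-- The correlation for `𝒮𝒪(1)`, centred so that the mean of the outliers drops out. -/
noncomputable def centredScore (A : Obs n d) (V : VMat n K d) : ℝ :=
  |score A V - bil A (fun _ => 1) (fun _ => 1) / K|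

/-- A near-maximizer of the centred correlation has almost full overlap for `𝒮𝒪(1)`. -/
theorem overlap_ge_of_centredScore_le (hm : 0 < m) {p q η : ℝ} (hp0 : 0 ≤ p) (hp1 : p ≤ 1)
    (hq0 : 0 ≤ q) (hq1 : q ≤ 1) (hγ : haarMean 1 𝒢 = 1) (hK : 1 ≤ K)
    {C τ : Fin n → Fin K} (hC : IsBalanced m C) (hτ : IsBalanced m τ)
    (R : Fin n → grp 1 𝒢) (ω : Sample n 1 𝒢)
    (hN : ∀ u, |bil (randMat (blockNoise p q C R) ω) u u| ≤ η * ∑ x, u x ^ 2)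
    (hmax : centredScore (observation C R ω) (groundTruth C R) ≤
      centredScore (observation C R ω) (entangle (fun _ => 1) (clusterMatrix τ)) + 1) :
    |p - q| * (K * (1 : ℕ) * (m : ℝ) ^ 2 -
      overlap (groundTruth C R) (entangle (fun _ => 1) (clusterMatrix τ))) ≤
      2 * (n * (1 : ℕ)) + 4 * η * (n * (1 : ℕ)) + 1 := by
  have hK0 : (0 : ℝ) < K := by exact_mod_cast hK
  have hK1 : (1 : ℝ) ≤ K := by exact_mod_cast hK
  have hn : (n : ℝ) = K * m := by exact_mod_cast hC.card_eq
  have hR : ∀ i, toMat (R i) = 1 := fun i => toMat_eq_one (by rw [hγ]; exact one_ne_zero) _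
  have hgt : groundTruth C R = entangle (fun _ => 1) (clusterMatrix C) := by
    simp only [groundTruth, hR]
  have hent : ∀ (σ : Fin n → Fin K) (x : Fin n × Fin 1) (l : Fin K × Fin 1),
      entangle (fun _ => (1 : Matrix (Fin 1) (Fin 1) ℝ)) (clusterMatrix σ) x l =
        if σ x.1 = l.1 then 1 else 0 := by
    intro σ x l
    simp [entangle, clusterMatrix, Matrix.one_apply, eq_iff_true_of_subsingleton]
  have hcol : ∀ σ : Fin n → Fin K, IsBalanced m σ → ∀ l : Fin K × Fin 1,
      ∑ x, entangle (fun _ => (1 : Matrix (Fin 1) (Fin 1) ℝ)) (clusterMatrix σ) x l = m := by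
    intro σ hσ l
    simp only [hent]
    rw [Fintype.sum_prod_type]
    simp only [Fin.sum_univ_one]
    rw [sum_boole, hσ l.1]
  have hrow : ∀ (σ : Fin n → Fin K) (x : Fin n × Fin 1),
      ∑ l, entangle (fun _ => (1 : Matrix (Fin 1) (Fin 1) ℝ)) (clusterMatrix σ) x l = 1 := by
    intro σ x
    simp only [hent, Fintype.sum_prod_type, Fin.sum_univ_one, sum_ite_eq, mem_univ, if_true]
  have hW : ∀ u : Fin n × Fin 1 → ℝ, bil (pairwiseRatio R) u u = (∑ x, u x) ^ 2 := by
    intro u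
    simp only [bil, pairwiseRatio, hR, Matrix.of_apply, Matrix.transpose_one, mul_one,
      Matrix.one_apply, eq_iff_true_of_subsingleton, if_true, one_mul]
    rw [pow_two, sum_mul_sum]
  set S := overlap (groundTruth C R) (entangle (fun _ => 1) (clusterMatrix τ)) with hS
  have hone : ∑ _x : Fin n × Fin 1, (1 : ℝ) ^ 2 = n := by simp
  have hbil : bil (observation C R ω) (fun _ => 1) (fun _ => 1) = (1 - p) * n +
      (p - q) * (K * (m : ℝ) ^ 2) + q * (n : ℝ) ^ 2 +
      bil (randMat (blockNoise p q C R) ω) (fun _ => 1) (fun _ => 1) := by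
    rw [observation_eq' hm hp0 hp1 hq0 hq1, bil_add, bil_add, bil_add, bil_smul_matrix,
      bil_smul_matrix, bil_smul_matrix,
      bil_one, bil_mul_transpose, hW, hone, hγ, hgt]
    simp only [mul_one, hcol C hC]
    simp
  have hsc : ∀ σ : Fin n → Fin K, IsBalanced m σ →
      score (observation C R ω) (entangle (fun _ => 1) (clusterMatrix σ)) = (1 - p) * n +
      (p - q) * overlap (groundTruth C R) (entangle (fun _ => 1) (clusterMatrix σ)) +
      q * (K * (m : ℝ) ^ 2) +
      score (randMat (blockNoise p q C R) ω) (entangle (fun _ => 1) (clusterMatrix σ)) := by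
    intro σ hσ
    rw [score_observation hm hp0 hp1 hq0 hq1, sum_sq_entangle (fun _ => one_mem _), hγ]
    have : score (pairwiseRatio R) (entangle (fun _ => 1) (clusterMatrix σ)) =
        K * (m : ℝ) ^ 2 := by
      simp only [score, hW, hcol σ hσ]
      simp
    rw [this]
    simp
  have hsN : ∀ σ : Fin n → Fin K,
      |score (randMat (blockNoise p q C R) ω) (entangle (fun _ => 1) (clusterMatrix σ))| ≤
        η * n := by
    intro σ
    refine (abs_score_le hN _).trans (le_of_eq ?_)
    rw [sum_sq_entangle (fun _ => one_mem _)]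
    simp
  have hbN : |bil (randMat (blockNoise p q C R) ω) (fun _ => 1) (fun _ => 1) / K| ≤ η * n := by
    rw [abs_div, abs_of_pos hK0]
    refine (div_le_self (abs_nonneg _) hK1).trans ((hN _).trans (le_of_eq ?_))
    rw [hone]
  -- Cauchy–Schwarz over the `K²` cells, whose sizes add up to `n = K m`. Thus `S - m²` is
  -- nonnegative and `|(p - q) (S - m²)|` increases with the overlap for either sign of `p - q`.
  have hSm : (m : ℝ) ^ 2 ≤ S := by
    set F : Fin K × Fin 1 → Fin K × Fin 1 → ℝ := fun l k => ∑ x, groundTruth C R x k *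
      entangle (fun _ => (1 : Matrix (Fin 1) (Fin 1) ℝ)) (clusterMatrix τ) x l with hF
    have h1 := sq_sum_le_card_mul_sum_sq (s := (univ : Finset ((Fin K × Fin 1) × (Fin K × Fin 1))))
      (f := fun z => F z.1 z.2)
    rw [Fintype.sum_prod_type (fun z : (Fin K × Fin 1) × (Fin K × Fin 1) => F z.1 z.2),
      Fintype.sum_prod_type (fun z : (Fin K × Fin 1) × (Fin K × Fin 1) => F z.1 z.2 ^ 2)] at h1
    have h2 : ∑ l, ∑ k, F l k = n := by
      simp only [hF]
      rw [(sum_congr rfl fun l _ => sum_comm).trans sum_comm]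
      simp only [← sum_mul, ← mul_sum, hgt, hrow]
      simp
    have h3 : (K : ℝ) ^ 2 * (m : ℝ) ^ 2 ≤ (K : ℝ) ^ 2 * S := by
      rw [← mul_pow, ← hn, ← h2]
      refine h1.trans (le_of_eq ?_)
      rw [hS, overlap]
      simp [pow_two, hF]
    exact le_of_mul_le_mul_left h3 (by positivity)
  have hn0 : (0 : ℝ) ≤ n := Nat.cast_nonneg n
  have hnK : (n : ℝ) / K = m := by rw [hn]; field_simp
  have hc : 0 ≤ (1 - p) * (n - m) ∧ (1 - p) * ((n : ℝ) - m) ≤ n := by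
    have h1 : (m : ℝ) ≤ n := by rw [hn]; nlinarith [(Nat.cast_nonneg m : (0 : ℝ) ≤ m)]
    have h2 : (0 : ℝ) ≤ m := Nat.cast_nonneg m
    constructor
    · exact mul_nonneg (by linarith) (by linarith)
    · nlinarith
  have hself := overlap_self hC R
  -- The `q` term is `q K m²` in the correlation and `q n² / K`, the same number, in the centring;
  -- they cancel exactly.
  have key : ∀ σ : Fin n → Fin K, IsBalanced m σ →
      centredScore (observation C R ω) (entangle (fun _ => 1) (clusterMatrix σ)) =
      |(1 - p) * (n - m) + (p - q) *
        (overlap (groundTruth C R) (entangle (fun _ => 1) (clusterMatrix σ)) - (m : ℝ) ^ 2) +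
        (score (randMat (blockNoise p q C R) ω) (entangle (fun _ => 1) (clusterMatrix σ)) -
        bil (randMat (blockNoise p q C R) ω) (fun _ => 1) (fun _ => 1) / K)| := by
    intro σ hσ
    rw [centredScore, hsc σ hσ, hbil, hn]
    congr 1
    field_simp
    ring
  have hV := hmax
  have hkC := key C hC
  rw [← hgt, hself] at hkC
  rw [key τ hτ, hkC, ← hS] at hV
  have ha := abs_le.1 (hsN τ)
  have hb := abs_le.1 (hsN C)
  have hb' := abs_le.1 hbN
  rw [← hgt] at hb
  have hup : |(1 - p) * (n - m) + (p - q) * (S - (m : ℝ) ^ 2) +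
        (score (randMat (blockNoise p q C R) ω) (entangle (fun _ => 1) (clusterMatrix τ)) -
        bil (randMat (blockNoise p q C R) ω) (fun _ => 1) (fun _ => 1) / K)| ≤
      n + |p - q| * (S - (m : ℝ) ^ 2) + 2 * (η * n) := by
    refine (abs_add_three _ _ _).trans (add_le_add (add_le_add ?_ ?_) ?_)
    · rw [abs_of_nonneg hc.1]; exact hc.2
    · rw [abs_mul, abs_of_nonneg (by linarith : 0 ≤ S - (m : ℝ) ^ 2)]
    · rw [abs_le]; constructor <;> linarith
  -- The identity contributes a number between `0` and `n`. It may oppose the signal when `p < q`,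
  -- which costs the extra `n`.
  have hlow : |p - q| * (K * (1 : ℕ) * (m : ℝ) ^ 2 - (m : ℝ) ^ 2) - n - 2 * (η * n) ≤
      |(1 - p) * (n - m) + (p - q) * (K * (1 : ℕ) * (m : ℝ) ^ 2 - (m : ℝ) ^ 2) +
        (score (randMat (blockNoise p q C R) ω) (groundTruth C R) -
        bil (randMat (blockNoise p q C R) ω) (fun _ => 1) (fun _ => 1) / K)| := by
    have h1 : 0 ≤ (K : ℝ) * (1 : ℕ) * (m : ℝ) ^ 2 - (m : ℝ) ^ 2 := by
      push_cast
      nlinarith [sq_nonneg (m : ℝ)]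
    rcases le_total 0 (p - q) with h | h
    · rw [abs_of_nonneg h]
      refine le_trans ?_ (le_abs_self _)
      linarith [hc.1]
    · rw [abs_of_nonpos h]
      refine le_trans ?_ (neg_le_abs _)
      linarith [hc.2]
  have := hlow.trans (hV.trans (add_le_add_left hup 1))
  push_cast at this ⊢
  linarith

end Score

end SGBM

/-! ### The correlation-maximizing initializer. -/

namespace SGBM

open MeasureTheory ProbabilityTheory Finset
open scoped ENNReal

section NearMaximizer

variable {n K m d : ℕ} {𝒢 : GroupKind}

open Classical in
/-- An element of `S` that maximizes `f` up to an error of at most one. -/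
noncomputable def nearMaximizer (S : Set (VMat n K d)) (f : VMat n K d → ℝ) : VMat n K d :=
  if h : ∃ V ∈ S, ∀ V' ∈ S, f V' ≤ f V + 1 then h.choose else 0

theorem nearMaximizer_spec {S : Set (VMat n K d)} {f : VMat n K d → ℝ} (hS : S.Nonempty) {M : ℝ}
    (hM : ∀ V ∈ S, f V ≤ M) :
    nearMaximizer S f ∈ S ∧ ∀ V' ∈ S, f V' ≤ f (nearMaximizer S f) + 1 := by
  have h : ∃ V ∈ S, ∀ V' ∈ S, f V' ≤ f V + 1 := by
    -- An error of one is negligible against scores of order `n log n`, so boundedness suffices and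
    -- no attained maximum is needed.
    have hb : BddAbove (f '' S) := ⟨M, by rintro _ ⟨V, hV, rfl⟩; exact hM V hV⟩
    obtain ⟨_, ⟨V, hV, rfl⟩, hlt⟩ :=
      exists_lt_of_lt_csSup (hS.image f) (sub_one_lt (sSup (f '' S)))
    exact ⟨V, hV, fun V' hV' => by linarith [le_csSup hb ⟨V', hV', rfl⟩]⟩
  rw [nearMaximizer, dif_pos h]
  exact h.choose_spec

theorem abs_apply_le_one_of_mem_feasible {V : VMat n K d} (hV : V ∈ feasible n m K d)
    (x : Fin n × Fin d) (k : Fin K × Fin d) : |V x k| ≤ 1 := by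
  obtain ⟨R, τ, hR, -, rfl⟩ := mem_feasible_iff.1 hV
  have := abs_apply_le_one_of_mem_orthogonalGroup (hR x.1) x.2 k.2
  simp only [entangle, clusterMatrix, Matrix.of_apply]
  split_ifs <;> simp [this]

theorem abs_score_le_of_mem_feasible (A : Obs n d) {V : VMat n K d} (hV : V ∈ feasible n m K d) :
    |score A V| ≤ ∑ _k : Fin K × Fin d, ∑ x, ∑ y, |A x y| := by
  refine (abs_sum_le_sum_abs _ _).trans (sum_le_sum fun k _ => ?_)
  refine (abs_sum_le_sum_abs _ _).trans (sum_le_sum fun x _ => ?_)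
  refine (abs_sum_le_sum_abs _ _).trans (sum_le_sum fun y _ => ?_)
  rw [abs_mul, abs_mul, mul_assoc]
  exact mul_le_of_le_one_right (abs_nonneg _) (mul_le_one₀
    (abs_apply_le_one_of_mem_feasible hV x k) (abs_nonneg _)
    (abs_apply_le_one_of_mem_feasible hV y k))

/-- The candidates whose group elements are all equal to the identity. -/
def pureClusterings (n m K d : ℕ) : Set (VMat n K d) :=
  {V | ∃ τ : Fin n → Fin K, IsBalanced m τ ∧ V = entangle (fun _ => 1) (clusterMatrix τ)}

theorem pureClusterings_subset : pureClusterings n m K d ⊆ feasible n m K d := by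
  rintro _ ⟨τ, hτ, rfl⟩
  exact mem_feasible_iff.2 ⟨_, τ, fun _ => one_mem _, hτ, rfl⟩

open Classical in
/-- The estimator that maximizes the correlation with the observation. -/
noncomputable def correlationEstimator (𝒢 : GroupKind) (n m K d : ℕ) (A : Obs n d) : VMat n K d :=
  if haarMean d 𝒢 = 0 then nearMaximizer (feasible n m K d) (score A)
  else nearMaximizer (pureClusterings n m K d) (centredScore A)

/-- The estimator is feasible and overlaps almost completely with the ground truth. -/
theorem correlationEstimator_spec (hm : 0 < m) (hK : 1 ≤ K) {p q η θ : ℝ} (hp0 : 0 ≤ p)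
    (hp1 : p ≤ 1) (hq0 : 0 ≤ q) (hq1 : q ≤ 1) (hη : 0 ≤ η) (hθp : θ ≤ p)
    (hθ : 𝒢 = GroupKind.rotation → d = 1 → θ ≤ |p - q|)
    {C : Fin n → Fin K} (hC : IsBalanced m C) (R : Fin n → grp d 𝒢) (ω : Sample n d 𝒢)
    (hN : ∀ u, |bil (randMat (blockNoise p q C R) ω) u u| ≤ η * ∑ x, u x ^ 2) :
    ∃ (R' : Fin n → Matrix (Fin d) (Fin d) ℝ) (τ : Fin n → Fin K) (θ' : ℝ), θ ≤ θ' ∧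
      (∀ i, R' i ∈ Matrix.orthogonalGroup (Fin d) ℝ) ∧ IsBalanced m τ ∧
      correlationEstimator 𝒢 n m K d (observation C R ω) = entangle R' (clusterMatrix τ) ∧
      θ' * (K * d * (m : ℝ) ^ 2 - overlap (groundTruth C R) (entangle R' (clusterMatrix τ))) ≤
        2 * (n * d) + 4 * η * (n * d) + 1 := by
  by_cases hγ : haarMean d 𝒢 = 0
  · have hgt := groundTruth_mem_feasible hC R
    obtain ⟨h1, h2⟩ := nearMaximizer_spec (f := score (observation C R ω)) ⟨_, hgt⟩
      fun V hV => (le_abs_self _).trans (abs_score_le_of_mem_feasible _ hV)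
    have h3 := overlap_ge_of_score_le hm hp0 hp1 hq0 hq1 hη hγ hC R ω hN h1 (h2 _ hgt)
    obtain ⟨R', τ, hR', hτ, hV⟩ := mem_feasible_iff.1 h1
    refine ⟨R', τ, p, hθp, hR', hτ, ?_, by rwa [hV] at h3⟩
    rw [correlationEstimator, if_pos hγ, hV]
  · have hrot : 𝒢 = GroupKind.rotation ∧ d = 1 := by
      cases 𝒢 with
      | orthogonal => exact absurd rfl hγ
      | rotation => exact ⟨rfl, by by_contra h; exact hγ (if_neg h)⟩
    obtain ⟨rfl, rfl⟩ := hrot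
    have hγ1 : haarMean 1 GroupKind.rotation = 1 := by simp [haarMean]
    have hgt : groundTruth C R ∈ pureClusterings n m K 1 :=
      ⟨C, hC, by simp only [groundTruth, toMat_eq_one hγ]⟩
    obtain ⟨h1, h2⟩ := nearMaximizer_spec (f := centredScore (observation C R ω)) ⟨_, hgt⟩
      (M := (∑ _k : Fin K × Fin 1, ∑ x, ∑ y, |observation C R ω x y|) +
        |bil (observation C R ω) (fun _ => 1) (fun _ => 1) / K|)
      fun V hV => (abs_sub _ _).trans
        (add_le_add_left (abs_score_le_of_mem_feasible _ (pureClusterings_subset hV)) _)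
    obtain ⟨τ, hτ, hV⟩ := h1
    have h3 := h2 _ hgt
    rw [hV] at h3
    refine ⟨_, τ, |p - q|, hθ rfl rfl, fun _ => one_mem _, hτ, ?_,
      overlap_ge_of_centredScore_le hm hp0 hp1 hq0 hq1 hγ1 hK hC hτ R ω hN h3⟩
    rw [correlationEstimator, if_neg hγ, hV]

/-- The estimator is deterministic, so the only failure is a large noise form, of probability at
most `1 / n`. A fixed deficit `κ` in the overlap would cost a score of order `n log n`, more than
the noise and the error terms of order `n` can compensate. -/
theorem correlation_initializer_success (d K : ℕ) (hd : 1 ≤ d) (hK : 1 ≤ K) (𝒢 : GroupKind)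
    (χ a b δ : ℝ) (ha : 0 < a) (hδ : 0 < δ) :
    ∃ c : ℝ, 0 < c ∧ ∃ N : ℕ, ∀ n m : ℕ, N ≤ n → n = K * m →
      ∀ α β : ℝ, α ∈ Set.Icc a b → β ∈ Set.Icc a b →
      (𝒢 = GroupKind.rotation → d = 1 → δ ≤ |α - β|) →
      ∀ (C : Fin n → Fin K) (R : Fin n → grp d 𝒢), IsBalanced m C →
        ENNReal.ofReal (1 - Real.log n ^ (-c)) ≤
          successProb α β C R
            (fun A => PMF.pure (correlationEstimator 𝒢 n (n / K) K d A))
            {V | ConditionIII m α β χ (groundTruth C R) V} := by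
  by_cases hb : b < a
  · exact ⟨1, one_pos, 0, fun n m _ _ α β hα => absurd (hα.1.trans hα.2) (not_le.2 hb)⟩
  push Not at hb
  have hb0 : 0 < b := ha.trans_le hb
  have hK0 : (0 : ℝ) < K := by exact_mod_cast hK
  have hd0 : (0 : ℝ) < d := by exact_mod_cast hd
  have hd1 : (1 : ℝ) ≤ d := by exact_mod_cast hd
  -- The threshold at its worst case `α = b`, `β = a`, plus one for strictness; this makes `ρ`
  -- uniform in `α` and `β`.
  set ρ := 2 * Real.sqrt 2 * Real.sqrt ((d : ℝ) ^ 2 / χ ^ 2 + b ^ 2 / (2 * K * a)) + 1 with hρ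
  have hρ0 : 0 < ρ := by positivity
  -- The first summand turns `4 K² κ d m` into at most `m / ρ²`, the second ensures `K κ < 1 / 2`.
  set κ := 1 / (4 * K ^ 2 * d * ρ ^ 2 + 4 * K) with hκ
  have hκ0 : 0 < κ := by positivity
  -- A common lower bound for the signal strength: `p` for centred outliers, `|p - q|` for `𝒮𝒪(1)`,
  -- both in units of `log n / n`.
  set ζ := min a δ with hζ
  have hζ0 : 0 < ζ := lt_min ha hδ
  obtain ⟨N₁, hN₁⟩ := exists_quadForm_noise_le d (2 * b) (4 * (d : ℝ) ^ 2) (ζ * κ / (8 * K)) hd0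
    (by positivity) (by positivity) (by positivity)
  obtain ⟨N₂, hN₂⟩ := exists_log_large b (1 + 6 * K / (ζ * κ))
  refine ⟨1 / 4, by norm_num, max N₁ N₂, fun n m hn hnm α β hα hβ hαβ C R hC => ?_⟩
  obtain ⟨hn2, hl1, hln, hbl, hM⟩ := hN₂ n (by omega)
  set l := Real.log n with hl
  have hl0 : 0 < l := by linarith
  have hn0 : (0 : ℝ) < n := by exact_mod_cast (by omega : 0 < n)
  have hm : 0 < m := by
    rcases Nat.eq_zero_or_pos m with rfl | h
    · simp at hnm; omega
    · exact h
  have hm0 : (0 : ℝ) < m := by exact_mod_cast hm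
  have hnm' : (n : ℝ) = K * m := by exact_mod_cast hnm
  have hdiv : n / K = m := by rw [hnm]; exact Nat.mul_div_cancel_left m hK
  set r := l ^ (1 / 4 : ℝ) with hr
  have hr1 : 1 ≤ r := by
    have : (0 : ℝ) < 6 * K / (ζ * κ) := by positivity
    linarith
  have hr0 : 0 < r := by linarith
  have hl4 : l = r ^ 4 := by
    rw [hr, ← Real.rpow_natCast, ← Real.rpow_mul hl0.le]; norm_num
  have hrl : r ≤ l := by rw [hl4]; exact le_self_pow₀ hr1 (by norm_num)
  set p := α * l / n with hp
  set q := β * l / n with hq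
  set P := b * l / n with hP
  have hpP : p ≤ P := by
    rw [hp, hP]; gcongr; exact hα.2
  have hqP : q ≤ P := by
    rw [hq, hP]; gcongr; exact hβ.2
  have hp0 : 0 ≤ p := div_nonneg (mul_nonneg (ha.le.trans hα.1) hl0.le) hn0.le
  have hq0 : 0 ≤ q := div_nonneg (mul_nonneg (ha.le.trans hβ.1) hl0.le) hn0.le
  have hp1 : p ≤ 1 := hpP.trans hbl
  have hq1 : q ≤ 1 := hqP.trans hbl
  have hnb := isNoise_blockNoise hp0 hp1 hq0 hq1 hpP hqP C R
  have hP1 := hN₁ n (by omega) (Fin n × Fin d) (Fin n × Fin n) (Bool × grp d 𝒢)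
    (edgeMeasure d 𝒢 p q C) (blockNoise p q C R) (2 * P) hnb (by simp [mul_comm])
    (le_of_eq (by rw [hP]; ring))
  rw [← sampleMeasure_eq] at hP1
  refine le_trans ?_ (ofReal_le_successProb (x := 0) hP1 le_rfl fun ω hω => ?_)
  · refine ENNReal.ofReal_le_ofReal (sub_le_sub_left ?_ 1)
    rw [add_zero, Real.rpow_neg hl0.le, ← hr, ← one_div]
    exact one_div_le_one_div_of_le hr0 (hrl.trans hln)
  rw [Set.mem_ofPred_eq, not_not] at hω
  have hζp : ζ * l / n ≤ p := by
    rw [hp]; gcongr; exact (min_le_left _ _).trans hα.1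
  have hζpq : 𝒢 = GroupKind.rotation → d = 1 → ζ * l / n ≤ |p - q| := fun h1 h2 => by
    have h3 : p - q = (α - β) * (l / n) := by rw [hp, hq]; ring
    rw [h3, abs_mul, abs_of_pos (div_pos hl0 hn0), mul_div_assoc]
    exact mul_le_mul_of_nonneg_right ((min_le_right _ _).trans (hαβ h1 h2)) (by positivity)
  obtain ⟨R', τ, θ, hθ, hR', hτ, hV, hS⟩ := correlationEstimator_spec hm hK hp0 hp1 hq0 hq1
    (by positivity) hζp hζpq hC R ω hω
  rw [sub_zero, ENNReal.ofReal_one]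
  have hgood : correlationEstimator 𝒢 n (n / K) K d (observation C R ω) ∈
      {V | ConditionIII m α β χ (groundTruth C R) V} := by
    rw [hdiv, hV, Set.mem_ofPred_eq]
    refine ⟨mem_feasible_iff.2 ⟨R', τ, hR', hτ, rfl⟩, ρ, ?_, ?_⟩
    · rw [hρ]
      refine lt_add_of_le_of_pos ?_ one_pos
      have := ha.le.trans hα.1
      have := hα.2
      have := hβ.1
      gcongr
    have hover : (1 - κ) * (K * d * (m : ℝ) ^ 2) ≤ overlap (groundTruth C R)
        (entangle R' (clusterMatrix τ)) := by
      by_contra! h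
      have h1 : κ * (K * d * (m : ℝ) ^ 2) <
          K * d * (m : ℝ) ^ 2 - overlap (groundTruth C R) (entangle R' (clusterMatrix τ)) := by
        linarith
      have hζl : 0 < ζ * l / n := by positivity
      have h2 : ζ * l / n * (κ * (K * d * (m : ℝ) ^ 2)) <
          2 * (n * d) + 4 * (ζ * κ / (8 * K) * l) * (n * d) + 1 :=
        (mul_lt_mul_of_pos_left h1 hζl).trans_le
          ((mul_le_mul_of_nonneg_right hθ (h1.le.trans' (by positivity))).trans hS)
      have h3 : ζ * l / n * (κ * (K * d * (m : ℝ) ^ 2)) = ζ * κ * l / K * (n * d) := by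
        rw [hnm']; field_simp
      have h4 : 4 * (ζ * κ / (8 * K) * l) * (n * d) = ζ * κ * l / K * (n * d) / 2 := by
        ring
      -- The noise level was chosen to absorb half of the gain `ζ κ l / K * (n d)`. With the factor
      -- `6`, the other half is at least `3 n d ≥ 2 n d + 1`.
      have h5 : (6 : ℝ) ≤ ζ * κ * l / K := by
        have : 6 * K / (ζ * κ) ≤ l := by linarith
        rw [div_le_iff₀ (by positivity)] at this
        rw [le_div_iff₀ hK0]
        linarith
      have h6 : (1 : ℝ) ≤ n * d := by
        have : (2 : ℝ) ≤ n := by exact_mod_cast hn2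
        nlinarith
      rw [h3, h4] at h2
      have h7 := mul_le_mul_of_nonneg_right h5 (by linarith : (0 : ℝ) ≤ n * d)
      linarith
    have hκK : K * κ < 1 / 2 := by
      rw [hκ, mul_one_div, div_lt_div_iff₀ (by positivity) (by norm_num)]
      have : 0 < 4 * (K : ℝ) ^ 2 * d * ρ ^ 2 := by positivity
      linarith
    rw [overlap_groundTruth] at hover
    have hest := estErr_sq_le_of_overlap hd hm hC hτ R hR' hκK hover
    refine (abs_le_of_sq_le_sq' ?_ (by positivity)).2
    refine hest.trans ?_
    rw [div_pow, Real.sq_sqrt hm0.le, le_div_iff₀ (by positivity)]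
    have h7 : 4 * (K : ℝ) ^ 2 * κ * d * ρ ^ 2 ≤ 1 := by
      have : 4 * (K : ℝ) ^ 2 * κ * d * ρ ^ 2 =
          4 * K ^ 2 * d * ρ ^ 2 / (4 * K ^ 2 * d * ρ ^ 2 + 4 * K) := by rw [hκ]; ring
      rw [this, div_le_one (by positivity)]
      linarith
    have h8 := mul_le_mul_of_nonneg_right h7 hm0.le
    linarith
  rw [PMF.toOuterMeasure_pure_apply, if_pos hgood]

end NearMaximizer

end SGBM

/-- In the second part the initializer is fixed before all constants. It recovers the cluster size
as `n / K`, so it depends only on `n`, `K`, `d` and the group. -/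
theorem theorem3 (d K : ℕ) (hd : 1 ≤ d) (hK : 1 ≤ K) (𝒢 : SGBM.GroupKind) :
    (∀ μ ρ a b δ : ℝ, 0 < μ → μ ≤ 1 / 2 → 0 < ρ → 0 < a → 0 < δ →
      ∃ c : ℝ, 0 < c ∧ ∃ N : ℕ, ∀ n m : ℕ, N ≤ n → n = K * m →
        ∀ α β : ℝ, α ∈ Set.Icc a b → β ∈ Set.Icc a b → β + δ ≤ α →
        ∀ (C : Fin n → Fin K) (R : Fin n → SGBM.grp d 𝒢), SGBM.IsBalanced m C →
        ∀ alg : SGBM.SpectralClustering n m K d μ,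
          ENNReal.ofReal (1 - Real.log n ^ (-c)) ≤
            SGBM.successProb α β C R alg.toInitializer
              {V | V ∈ SGBM.feasible n m K d ∧
                SGBM.estErr (SGBM.groundTruth C R) V ≤ Real.sqrt m / ρ}) ∧
    (∃ alg : ∀ n : ℕ, SGBM.Initializer n K d,
      ∀ χ a b δ : ℝ, 0 < χ → 0 < a → 0 < δ →
      ∃ c : ℝ, 0 < c ∧ ∃ N : ℕ, ∀ n m : ℕ, N ≤ n → n = K * m →
        ∀ α β : ℝ, α ∈ Set.Icc a b → β ∈ Set.Icc a b →
        (𝒢 = SGBM.GroupKind.rotation → d = 1 → δ ≤ |α - β|) →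
        ∀ (C : Fin n → Fin K) (R : Fin n → SGBM.grp d 𝒢), SGBM.IsBalanced m C →
          ENNReal.ofReal (1 - Real.log n ^ (-c)) ≤
            SGBM.successProb α β C R (alg n)
              {V | SGBM.ConditionIII m α β χ (SGBM.groundTruth C R) V}) := by
  refine ⟨fun μ ρ a b δ => SGBM.spectral_clustering_success d K hd hK 𝒢 μ ρ a b δ,
    fun n A => PMF.pure (SGBM.correlationEstimator 𝒢 n (n / K) K d A),
    fun χ a b δ _ => SGBM.correlation_initializer_success d K hd hK 𝒢 χ a b δ⟩
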